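/- For $d\ge 1$ write $\langle y\rangle=\sqrt{1+|y|^2}$ for $y\in\mathbb{R}^d$, let $\mathbb{H}^d=\{(y,y')\in\mathbb{R}^d\times\mathbb{R}: y'=\langle y\rangle\}$, and let $\sigma$ be the measure on $\mathbb{H}^d$ given by $\int_{\mathbb{H}^d}\varphi\,d\sigma=\int_{\mathbb{R}^d}\varphi(y,\langle y\rangle)\,\frac{dy}{\langle y\rangle}$; put $L^2(\mathbb{H}^d)=L^2(\mathbb{H}^d,\sigma)$, and for measurable $\mathcal{C}\subset\mathbb{H}^d$ let $\|f\|_{L^2(\mathcal{C})}^2=\int_{\mathcal{C}}|f|^2\,d\sigma$. Functions on $\mathbb{H}^d$ are identified with functions on $\mathbb{R}^d$ via $y\leftrightarrow(y,\langle y\rangle)$. Let $T$ be the extension operator $$Tf(x,t)=\int_{\mathbb{R}^d}e^{ix\cdot y}e^{it\langle y\rangle}f(y)\,\frac{dy}{\langle y\rangle},\qquad (x,t)\in\mathbb{R}^d\times\mathbb{R},$$ defined first for $f$ in the Schwartz class and extended by density to a bounded operator $L^2(\mathbb{H}^d)\to L^p(\mathbb{R}^{d+1})$ (this is possible for all pairs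 $(d,p)$ below, by Strichartz), and let $$\mathbf{H}_{d,p}=\sup_{0\ne f\in L^2(\mathbb{H}^d)}\frac{\|Tf\|_{L^p(\mathbb{R}^{d+1})}}{\|f\|_{L^2(\mathbb{H}^d)}}.$$ A sequence of nonzero functions $f_n\in L^2(\mathbb{H}^d)$ is *extremizing* for $(d,p)$ if $\|Tf_n\|_{L^p(\mathbb{R}^{d+1})}/\|f_n\|_{L^2(\mathbb{H}^d)}\to\mathbf{H}_{d,p}$. For $s\in(-1,1)$ let $$L^s(\xi_1,\dots,\xi_d,\tau)=\Big(\tfrac{\xi_1+s\tau}{\sqrt{1-s^2}},\xi_2,\dots,\xi_d,\tfrac{\tau+s\xi_1}{\sqrt{1-s^2}}\Big),$$ and for $d=2$ and $\varphi\in[0,2\pi)$ let $R_\varphi(\xi_1,\xi_2,\tau)=(\xi_1\cos\varphi+\xi_2\sin\varphi,\,-\xi_1\sin\varphi+\xi_2\cos\varphi,\,\tau)$. These maps preserve $\mathbb{H}^d$; for such a map $L$ write $L^*f=f\circ L$. (1) Let $d=1$ and $6\le p<\infty$, and for $k\in\mathbb{Z}$ let $\mathcal{C}_k=\{(\xi,\tau)\in\mathbb{H}^1:\sinh(k-\tfrac12)\le\xi<\sinh(k+\tfrac12)\}$.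 There exists a constant $\eta_{1,p}>0$, depending only on $p$, with the following property. For every extremizing sequence $\{f_n\}\subset L^2(\mathbb{H}^1)$ for $(1,p)$ with $\|f_n\|_{L^2(\mathbb{H}^1)}=1$ for all $n$, there exists $n_0$ such that for every $n\ge n_0$ there exists $s_n\in(-1,1)$ with $$\|(L^{s_n})^*f_n\|_{L^2(\mathcal{C}_0)}\ \ge\ \tfrac12\sup_{k\in\mathbb{Z}}\|(L^{s_n})^*f_n\|_{L^2(\mathcal{C}_k)}\ \ge\ \eta_{1,p}.$$ (2) Let $d=2$ and $4\le p<6$, and let $\mathcal{D}=\{(\xi,\tau)\in\mathbb{H}^2:|\xi|\le 2\sqrt2\,\pi\}$. There exists a constant $\eta_{2,p}>0$, depending only on $p$, with the following property. For every extremizing sequence $\{f_n\}\subset L^2(\mathbb{H}^2)$ for $(2,p)$ with $\|f_n\|_{L^2(\mathbb{H}^2)}=1$ for all $n$, there exists $n_0$ such that for every $n\ge n_0$ there exist $s_n\in(-1,1)$ and $\varphi_n\in[0,2\pi)$ with $$\|f_n\circ R_{\varphi_n}\circ L^{s_n}\|_{L^2(\mathcal{D})}\ \ge\ \eta_{2,p}.$$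 -/

import Mathlib

open MeasureTheory Filter Topology Set
open scoped ENNReal SchwartzMap

noncomputable section

namespace Hyperboloid

/-- The frequency space `ℝ^d` with its Euclidean norm. -/
abbrev E (d : ℕ) : Type := EuclideanSpace ℝ (Fin d)

/-- The ambient space `ℝ^{d+1} = ℝ^d × ℝ`; its `volume` is Lebesgue measure. -/
abbrev Ambient (d : ℕ) : Type := E d × ℝ

/-- The Japanese bracket `⟨y⟩ = √(1 + |y|²)`. -/
def bracket {d : ℕ} (y : E d) : ℝ := Real.sqrt (1 + ‖y‖ ^ 2)

/-- The upper sheet `ℍ^d = {(y, y') : y' = √(1 + |y|²)}`. -/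
def hyperboloid (d : ℕ) : Set (Ambient d) := {z | z.2 = bracket z.1}

/-- The Lorentz invariant measure `δ(y' - ⟨y⟩) dy dy' / ⟨y⟩`, as a measure on the ambient space
carried by `ℍ^d`: the image of `dy / ⟨y⟩` under `y ↦ (y, ⟨y⟩)`. Thus `L^q(ℍ^d)` is
`L^q(ℝ^{d+1}, σ)`. -/
def sigma (d : ℕ) : Measure (Ambient d) :=
  Measure.map (fun y : E d => (y, bracket y))
    ((volume : Measure (E d)).withDensity fun y => ENNReal.ofReal (1 / bracket y))

/-- A function on `ℝ^d` viewed as a function on the hyperboloid. -/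
def lift {d : ℕ} (g : E d → ℂ) : Ambient d → ℂ := fun z => g z.1

/-- The extension integral
`∫_{ℍ^d} e^{i x·y} e^{i t y'} f(y, y') dσ = ∫_{ℝ^d} e^{i x·y} e^{i t ⟨y⟩} f(y) dy / ⟨y⟩`. -/
def extensionIntegral {d : ℕ} (f : Ambient d → ℂ) (w : Ambient d) : ℂ :=
  ∫ z, Complex.exp (Complex.I * (inner ℝ w.1 z.1 : ℝ)) *
    Complex.exp (Complex.I * (w.2 * z.2 : ℝ)) * f z ∂(sigma d)

/-- `F ∈ L^p(ℝ^{d+1})` is the image of `f` under the extension operator, defined on the Schwartz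
class by the extension integral and extended to `L²(ℍ^d)` by density: `F` is the `L^p` limit of
the extension integrals of Schwartz functions which converge to `f` in `L²(ℍ^d)`. -/
def IsExtensionOf {d : ℕ} (p : ℝ) (f F : Ambient d → ℂ) : Prop :=
  MemLp F (ENNReal.ofReal p) volume ∧
    ∃ g : ℕ → 𝓢(E d, ℂ),
      Tendsto (fun k => eLpNorm (f - lift (g k)) 2 (sigma d)) atTop (𝓝 0) ∧
      Tendsto (fun k => eLpNorm (F - extensionIntegral (lift (g k))) (ENNReal.ofReal p) volume)
        atTop (𝓝 0)

open scoped Classical in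
/-- The extension operator `T : L²(ℍ^d) → L^p(ℝ^{d+1})`. For `p` in the Strichartz range (the only
case in which it is used) the image exists and is unique up to null sets for every
`f ∈ L²(ℍ^d)`. -/
def extension {d : ℕ} (p : ℝ) (f : Ambient d → ℂ) : Ambient d → ℂ :=
  if h : ∃ F, IsExtensionOf p f F then h.choose else 0

/-- The quotient `‖T f‖_{L^p(ℝ^{d+1})} / ‖f‖_{L²(ℍ^d)}`. -/
def extensionRatio {d : ℕ} (p : ℝ) (f : Ambient d → ℂ) : ℝ≥0∞ :=
  eLpNorm (extension p f) (ENNReal.ofReal p) volume / eLpNorm f 2 (sigma d)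

/-- The optimal constant `H_{d,p}`: the supremum of the quotient over `0 ≠ f ∈ L²(ℍ^d)`. -/
def optimalConstant (d : ℕ) (p : ℝ) : ℝ≥0∞ :=
  ⨆ f : {f : Ambient d → ℂ // MemLp f 2 (sigma d) ∧ eLpNorm f 2 (sigma d) ≠ 0},
    extensionRatio p f.1

/-- A sequence of nonzero functions of `L²(ℍ^d)` along which the quotient tends to the optimal
constant. -/
def IsExtremizingSequence {d : ℕ} (p : ℝ) (f : ℕ → Ambient d → ℂ) : Prop :=
  (∀ n, MemLp (f n) 2 (sigma d) ∧ eLpNorm (f n) 2 (sigma d) ≠ 0) ∧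
    Tendsto (fun n => extensionRatio p (f n)) atTop (𝓝 (optimalConstant d p))

/-- The Lorentz boost `L^t` in the first coordinate direction:
`(ξ₁, …, ξ_d, τ) ↦ ((ξ₁ + tτ)/√(1-t²), ξ₂, …, ξ_d, (τ + tξ₁)/√(1-t²))`. -/
def boost {d : ℕ} [NeZero d] (t : ℝ) (z : Ambient d) : Ambient d :=
  (WithLp.toLp 2 (Function.update (fun i => z.1 i) 0 ((z.1 0 + t * z.2) / Real.sqrt (1 - t ^ 2))),
    (z.2 + t * z.1 0) / Real.sqrt (1 - t ^ 2))

/-- The rotation `R_φ` of `ℝ³` by the angle `φ` around the vertical axis. -/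
def rotation (φ : ℝ) (z : Ambient 2) : Ambient 2 :=
  (!₂[z.1 0 * Real.cos φ + z.1 1 * Real.sin φ, -z.1 0 * Real.sin φ + z.1 1 * Real.cos φ], z.2)

/-- The one-dimensional cap `C_k = {(ξ, τ) ∈ ℍ¹ : sinh(k - 1/2) ≤ ξ < sinh(k + 1/2)}`. -/
def cap (k : ℤ) : Set (Ambient 1) :=
  {z | z ∈ hyperboloid 1 ∧ Real.sinh ((k : ℝ) - 1 / 2) ≤ z.1 0 ∧
    z.1 0 < Real.sinh ((k : ℝ) + 1 / 2)}

/-- The two-dimensional cap `D = {(ξ, τ) ∈ ℍ² : |ξ| ≤ 2√2 π}`. -/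
def centralCap : Set (Ambient 2) :=
  {z | z ∈ hyperboloid 2 ∧ ‖z.1‖ ≤ 2 * Real.sqrt 2 * Real.pi}

/-- The norm of `f` in `L²(C)`, for a subset `C` of the hyperboloid. -/
def capNorm {d : ℕ} (f : Ambient d → ℂ) (C : Set (Ambient d)) : ℝ≥0∞ :=
  eLpNorm f 2 ((sigma d).restrict C)

end Hyperboloid

end

/-! Both parts rest on one principle, `HasSmallExtension`: if `‖f‖₂ ≤ 2` and `f` has small `L²` mass
on every cap of a suitable family, then its extension is small in `L^p`. Since the optimal constant
is positive, an extremizing sequence cannot eventually be small on all caps, so some cap carries a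
fixed amount of mass (`HasSmallExtension.exists_lt_capNorm`). A Lorentz map preserves `σ` and
carries that cap to the prescribed one. For `d = 1` the caps are unit intervals of rapidity, shifted
by the boosts with `s = tanh k`, `k ∈ ℤ`. For `d = 2` they are the hyperbolic balls congruent to
`D`, moved transitively by the maps `R_φ ∘ L^s`.

The smallness comes from convolution estimates. A product of extensions is an oscillatory integral
over sums of points of the hyperboloid, and `lintegral_enorm_sq_le` bounds its `L²` norm by the `L²`
norm of the amplitude, weighted by an upper bound for the density of the convolved measure. Its
proof replaces Plancherel by a Gaussian regularisation and a Schur test.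

For `d = 1`, `σ * σ * σ` has density at most `2π s^{-1/2}` at Lorentz length `s`. Points of `C_k`
and `C_l` have Minkowski product of size `e^{|k-l|}`, so the interactions of caps decay
geometrically, and summing them gives `‖Tf‖_p⁴ ≲ sup_k ‖f‖²_{L²(C_k)} ‖f‖₂²`. Exponents above 6 are
reached with the pointwise bound of each piece by its `L²` norm.

For `d = 2`, `σ * σ` has density at most `2π / s`. This gives an `L⁴` bound whose kernel decays with
hyperbolic distance: the near part is controlled by the mass on balls, the far part by the decay.
Integrating the same density once more bounds `σ * σ * σ` and yields an `L⁶` estimate. Hölder's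
inequality between 4 and 6 retains a positive power of the small `L⁴` norm exactly when `p < 6`. -/

noncomputable section

namespace Hyperboloid

/-! ### Gaussian regularisation and a weighted `L²` bound for oscillatory integrals -/

/-- The character `e^{i (x·y + t y')}` of the ambient space. -/
def character {d : ℕ} (w z : Ambient d) : ℂ :=
  Complex.exp (Complex.I * (inner ℝ w.1 z.1 : ℝ)) * Complex.exp (Complex.I * (w.2 * z.2 : ℝ))

instance {d : ℕ} : (volume : Measure (Ambient d)).IsAddHaarMeasure :=
  Measure.prod.instIsAddHaarMeasure (volume : Measure (E d)) (volume : Measure ℝ)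

lemma norm_character {d : ℕ} (w z : Ambient d) : ‖character w z‖ = 1 := by
  simp [character, mul_comm Complex.I, Complex.norm_exp_ofReal_mul_I, -Complex.ofReal_mul]

lemma character_add {d : ℕ} (w z z' : Ambient d) :
    character w (z + z') = character w z * character w z' := by
  simp only [character, Prod.fst_add, Prod.snd_add, inner_add_right, mul_add, Complex.ofReal_add,
    Complex.exp_add]
  ring

lemma character_sub {d : ℕ} (w z z' : Ambient d) :
    character w (z - z') = character w z * (starRingEnd ℂ) (character w z') := by
  have h1 : (starRingEnd ℂ) (character w z') = character w (-z') := by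
    simp [character, ← Complex.exp_conj]
  rw [h1, ← character_add, sub_eq_add_neg]

lemma measurable_character {d : ℕ} {X : Type*} [MeasurableSpace X] {f g : X → Ambient d}
    (hf : Measurable f) (hg : Measurable g) : Measurable fun x => character (f x) (g x) := by
  unfold character
  have h1 : Measurable fun x => (inner ℝ (f x).1 (g x).1 : ℝ) := hf.fst.inner hg.fst
  have h2 : Measurable fun x => (f x).2 * (g x).2 := hf.snd.mul hg.snd
  exact ((h1.complex_ofReal.const_mul _).cexp).mul ((h2.complex_ofReal.const_mul _).cexp)

/-- The Gaussian `e^{-ε (|x|² + t²)}` on the ambient space. -/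
def gauss {d : ℕ} (ε : ℝ) (w : Ambient d) : ℝ :=
  Real.exp (-ε * ‖w.1‖ ^ 2) * Real.exp (-ε * ‖w.2‖ ^ 2)

lemma continuous_gauss {d : ℕ} (ε : ℝ) : Continuous (gauss (d := d) ε) := by
  unfold gauss
  fun_prop

lemma gauss_pos {d : ℕ} (ε : ℝ) (w : Ambient d) : 0 < gauss ε w := by
  unfold gauss; positivity

/-- The integral of the Gaussian `gauss ε`. -/
def gaussMass (d : ℕ) (ε : ℝ) : ℝ := (Real.pi / ε) ^ ((d : ℝ) / 2) * (Real.pi / ε) ^ ((1 : ℝ) / 2)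

lemma integrable_exp_neg_mul_norm_sq {V : Type*} [NormedAddCommGroup V] [InnerProductSpace ℝ V]
    [FiniteDimensional ℝ V] [MeasurableSpace V] [BorelSpace V] {ε : ℝ} (hε : 0 < ε) :
    Integrable fun v : V => Real.exp (-ε * ‖v‖ ^ 2) := by
  have h := (GaussianFourier.integrable_cexp_neg_mul_sq_norm_add (V := V) (b := (ε : ℂ))
    (by simpa using hε) 0 0).re
  refine h.congr (Eventually.of_forall fun v => ?_)
  have : (-(ε : ℂ) * (‖v‖ : ℂ) ^ 2 + 0 * ((inner ℝ (0 : V) v : ℝ) : ℂ))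
      = ((-ε * ‖v‖ ^ 2 : ℝ) : ℂ) := by
    push_cast; ring
  simp only [this, ← Complex.ofReal_exp, RCLike.re_eq_complex_re, Complex.ofReal_re]

lemma integrable_gauss {d : ℕ} {ε : ℝ} (hε : 0 < ε) : Integrable (gauss (d := d) ε) :=
  (integrable_exp_neg_mul_norm_sq (V := E d) hε).mul_prod
    (integrable_exp_neg_mul_norm_sq (V := ℝ) hε)

lemma integral_gauss {d : ℕ} {ε : ℝ} (hε : 0 < ε) :
    ∫ w : Ambient d, gauss ε w = gaussMass d ε := by
  unfold gauss gaussMass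
  rw [Measure.volume_eq_prod, integral_prod_mul (fun v : E d => Real.exp (-ε * ‖v‖ ^ 2))
    (fun v : ℝ => Real.exp (-ε * ‖v‖ ^ 2)), GaussianFourier.integral_rexp_neg_mul_sq_norm hε,
    GaussianFourier.integral_rexp_neg_mul_sq_norm hε]
  simp

lemma integral_gauss_mul_character {d : ℕ} {ε : ℝ} (hε : 0 < ε) (z : Ambient d) :
    ∫ w : Ambient d, (gauss ε w : ℂ) * character w z
      = ((gaussMass d ε * gauss (1 / (4 * ε)) z : ℝ) : ℂ) := by
  have key : ∀ (V : Type) [NormedAddCommGroup V] [InnerProductSpace ℝ V]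
      [FiniteDimensional ℝ V] [MeasurableSpace V] [BorelSpace V] (a : V),
      ∫ v : V, ((Real.exp (-ε * ‖v‖ ^ 2) : ℝ) : ℂ) * Complex.exp (Complex.I * (inner ℝ v a : ℝ))
        = (((Real.pi / ε) ^ ((Module.finrank ℝ V : ℝ) / 2)
          * Real.exp (-(1 / (4 * ε)) * ‖a‖ ^ 2) : ℝ) : ℂ) := by
    intro V _ _ _ _ _ a
    have h := GaussianFourier.integral_cexp_neg_mul_sq_norm_add (V := V) (b := (ε : ℂ))
      (by simpa using hε) Complex.I a
    have e1 : ∀ v : V, ((Real.exp (-ε * ‖v‖ ^ 2) : ℝ) : ℂ)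
        * Complex.exp (Complex.I * (inner ℝ v a : ℝ))
        = Complex.exp (-(ε : ℂ) * (‖v‖ : ℂ) ^ 2 + Complex.I * ((inner ℝ a v : ℝ) : ℂ)) := by
      intro v
      rw [Complex.exp_add, real_inner_comm]
      push_cast
      rfl
    simp_rw [e1]
    rw [h]
    push_cast
    rw [Complex.ofReal_cpow (by positivity)]
    push_cast
    congr 2
    rw [Complex.I_sq]
    field_simp
  have h1 := key (E d) z.1
  have h2 := key ℝ z.2
  rw [Measure.volume_eq_prod]
  have e : ∀ w : Ambient d, (gauss ε w : ℂ) * character w z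
      = (((Real.exp (-ε * ‖w.1‖ ^ 2) : ℝ) : ℂ) * Complex.exp (Complex.I * (inner ℝ w.1 z.1 : ℝ)))
        * (((Real.exp (-ε * ‖w.2‖ ^ 2) : ℝ) : ℂ)
          * Complex.exp (Complex.I * (inner ℝ w.2 z.2 : ℝ))) := by
    intro w
    have : (inner ℝ w.2 z.2 : ℝ) = w.2 * z.2 := by simp [mul_comm]
    rw [this]
    simp only [gauss, character]
    push_cast
    ring
  simp_rw [e]
  rw [integral_prod_mul (fun v : E d => ((Real.exp (-ε * ‖v‖ ^ 2) : ℝ) : ℂ)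
      * Complex.exp (Complex.I * (inner ℝ v z.1 : ℝ)))
    (fun v : ℝ => ((Real.exp (-ε * ‖v‖ ^ 2) : ℝ) : ℂ)
      * Complex.exp (Complex.I * (inner ℝ v z.2 : ℝ))), h1, h2, ← Complex.ofReal_mul]
  congr 1
  simp only [gaussMass, gauss, finrank_euclideanSpace, Fintype.card_fin, Module.finrank_self,
    Nat.cast_one]
  ring

/-- This is the Plancherel constant. Its independence of `ε` is what lets the regularisation be
removed at the end. -/
lemma gaussMass_mul_gaussMass {d : ℕ} {ε : ℝ} (hε : 0 < ε) :
    gaussMass d ε * gaussMass d (1 / (4 * ε)) = (2 * Real.pi) ^ (d + 1) := by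
  unfold gaussMass
  have h1 : 0 < Real.pi / ε := by positivity
  have h2 : 0 < Real.pi / (1 / (4 * ε)) := by positivity
  have h3 : Real.pi / ε * (Real.pi / (1 / (4 * ε))) = (2 * Real.pi) ^ (2 : ℝ) := by
    rw [Real.rpow_two]; field_simp; ring
  rw [mul_mul_mul_comm, ← Real.mul_rpow h1.le h2.le, ← Real.mul_rpow h1.le h2.le, h3,
    ← Real.rpow_mul (by positivity), ← Real.rpow_mul (by positivity), pow_succ,
    show (2 : ℝ) * ((d : ℝ) / 2) = d by ring, Real.rpow_natCast]
  norm_num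

/-- If `a p ≤ b q`, then `a b = (a p)(b / p)` is at most the second term; otherwise it is at most
the first. This is the weighted Young inequality of the Schur test, with `p` and `q` the weights at
two points. -/
lemma mul_le_sq_mul_div_add {a b p q : ℝ≥0∞} (hp : p ≠ 0) (hp' : p ≠ ∞) (hq : q ≠ 0)
    (hq' : q ≠ ∞) : a * b ≤ a ^ 2 * p * q⁻¹ + b ^ 2 * q * p⁻¹ := by
  rcases le_total (a * p) (b * q) with h | h
  · refine le_trans ?_ le_add_self
    calc a * b = (a * p) * (b * p⁻¹) := by
          rw [mul_mul_mul_comm, ENNReal.mul_inv_cancel hp hp', mul_one]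
      _ ≤ (b * q) * (b * p⁻¹) := by gcongr
      _ = b ^ 2 * q * p⁻¹ := by ring
  · refine le_trans ?_ le_self_add
    calc a * b = (b * q) * (a * q⁻¹) := by
          rw [mul_mul_mul_comm, mul_comm b a, ENNReal.mul_inv_cancel hq hq', mul_one]
      _ ≤ (a * p) * (a * q⁻¹) := by gcongr
      _ = a ^ 2 * p * q⁻¹ := by ring

lemma integrable_gauss_mul_character_mul {d : ℕ} {Y : Type*} [MeasurableSpace Y] {ν : Measure Y}
    [SFinite ν] {ε : ℝ} (hε : 0 < ε) {T : Y → Ambient d} (hT : Measurable T) {H : Y → ℂ}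
    (hH : Integrable H ν) :
    Integrable (fun r : Ambient d × Y => (gauss ε r.1 : ℂ) * (character r.1 (T r.2) * H r.2))
      (volume.prod ν) := by
  have h1 : Integrable (fun r : Ambient d × Y => (gauss ε r.1 : ℂ) * H r.2) (volume.prod ν) :=
    (integrable_gauss (d := d) hε).ofReal.mul_prod hH
  have h2 : Measurable fun r : Ambient d × Y => character r.1 (T r.2) :=
    measurable_character measurable_fst (hT.comp measurable_snd)
  refine (h1.bdd_mul (c := 1) h2.aestronglyMeasurable
    (Eventually.of_forall fun r => (norm_character _ _).le)).congr
    (Eventually.of_forall fun r => ?_)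
  simp only
  ring

/-- The square expands into a double integral with phase `S x - S x'`. The Gaussian makes everything
absolutely integrable in `w`, so Fubini applies and the `w`-integral becomes the transform of the
Gaussian, which is positive. Only then are absolute values taken inside. -/
theorem lintegral_enorm_sq_mul_gauss_le {d : ℕ} {X : Type*} [MeasurableSpace X] (μ : Measure X)
    [SFinite μ] {S : X → Ambient d} (hS : Measurable S) {h : X → ℂ} (hm : Measurable h)
    (hh : Integrable h μ) {ε : ℝ} (hε : 0 < ε) :
    ∫⁻ w, ‖∫ x, character w (S x) * h x ∂μ‖ₑ ^ 2 * ENNReal.ofReal (gauss ε w) ≤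
      ∫⁻ q, ‖h q.1‖ₑ * ‖h q.2‖ₑ *
        ENNReal.ofReal (gaussMass d ε * gauss (1 / (4 * ε)) (S q.1 - S q.2)) ∂(μ.prod μ) := by
  set A : Ambient d → ℂ := fun w => ∫ x, character w (S x) * h x ∂μ with hA
  have hmeas : Measurable fun q : Ambient d × X => character q.1 (S q.2) * h q.2 :=
    (measurable_character measurable_fst (hS.comp measurable_snd)).mul
      (hm.comp measurable_snd)
  have hAm : StronglyMeasurable A := hmeas.stronglyMeasurable.integral_prod_right'
  have hAb : ∀ w, ‖A w‖ ≤ ∫ x, ‖h x‖ ∂μ := fun w => by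
    refine (norm_integral_le_integral_norm _).trans_eq ?_
    simp [norm_character]
  have hsq : ∀ w, A w * (starRingEnd ℂ) (A w)
      = ∫ q, character w (S q.1 - S q.2) * (h q.1 * (starRingEnd ℂ) (h q.2)) ∂(μ.prod μ) := by
    intro w
    rw [hA]
    simp only
    rw [← integral_conj, ← integral_prod_mul]
    refine integral_congr_ae ?_
    filter_upwards with q
    simp only [character_sub, map_mul]
    ring
  have hconj : Integrable (fun x => (starRingEnd ℂ) (h x)) μ :=
    hh.mono (Complex.continuous_conj.measurable.comp hm).aestronglyMeasurable
      (Eventually.of_forall fun x => (RCLike.norm_conj _).le)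
  have hT : Measurable fun q : X × X => S q.1 - S q.2 := by fun_prop
  have hH : Integrable (fun q : X × X => h q.1 * (starRingEnd ℂ) (h q.2)) (μ.prod μ) :=
    hh.mul_prod hconj
  set Φ : Ambient d → X × X → ℂ := fun w q => (gauss ε w : ℂ) *
    (character w (S q.1 - S q.2) * (h q.1 * (starRingEnd ℂ) (h q.2))) with hΦ
  have hint : Integrable (Function.uncurry Φ) (volume.prod (μ.prod μ)) := by
    have := integrable_gauss_mul_character_mul (T := fun q : X × X => S q.1 - S q.2)
      (H := fun q : X × X => h q.1 * (starRingEnd ℂ) (h q.2)) hε hT hH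
    exact this
  have hswap := integral_integral_swap hint
  have hL : ∫ w, ∫ q, Φ w q ∂(μ.prod μ) = ((∫ w, gauss ε w * ‖A w‖ ^ 2 : ℝ) : ℂ) := by
    rw [← integral_complex_ofReal]
    refine integral_congr_ae ?_
    filter_upwards with w
    simp only [hΦ]
    rw [integral_const_mul, ← hsq, Complex.mul_conj, Complex.normSq_eq_norm_sq]
    push_cast
    rfl
  have hR : ∀ q, ∫ w, Φ w q = ((gaussMass d ε * gauss (1 / (4 * ε)) (S q.1 - S q.2) : ℝ) : ℂ)
      * (h q.1 * (starRingEnd ℂ) (h q.2)) := by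
    intro q
    simp only [hΦ, ← mul_assoc]
    rw [integral_mul_const, integral_mul_const, integral_gauss_mul_character hε]
  rw [hL] at hswap
  simp_rw [hR] at hswap
  have hgm : 0 ≤ gaussMass d ε := by unfold gaussMass; positivity
  have hAint : Integrable fun w => gauss ε w * ‖A w‖ ^ 2 := by
    have hA2 : AEStronglyMeasurable (fun w => ‖A w‖ ^ 2) volume :=
      (hAm.norm.pow 2).aestronglyMeasurable
    refine (integrable_gauss hε).mul_bdd (c := (∫ x, ‖h x‖ ∂μ) ^ 2) hA2
      (Eventually.of_forall fun w => ?_)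
    rw [norm_pow, norm_norm]
    gcongr
    exact hAb w
  calc ∫⁻ w, ‖A w‖ₑ ^ 2 * ENNReal.ofReal (gauss ε w)
      = ∫⁻ w, ENNReal.ofReal (gauss ε w * ‖A w‖ ^ 2) := by
        refine lintegral_congr fun w => ?_
        rw [mul_comm, ENNReal.ofReal_mul (gauss_pos ε w).le, ENNReal.ofReal_pow (norm_nonneg _),
          ofReal_norm]
    _ = ENNReal.ofReal (∫ w, gauss ε w * ‖A w‖ ^ 2) :=
        (ofReal_integral_eq_lintegral_ofReal hAint (Eventually.of_forall fun w =>
          mul_nonneg (gauss_pos ε w).le (by positivity))).symm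
    _ ≤ ‖((∫ w, gauss ε w * ‖A w‖ ^ 2 : ℝ) : ℂ)‖ₑ := by
        rw [← ofReal_norm, Complex.norm_real]
        exact ENNReal.ofReal_le_ofReal (le_abs_self _)
    _ ≤ ∫⁻ q, ‖((gaussMass d ε * gauss (1 / (4 * ε)) (S q.1 - S q.2) : ℝ) : ℂ)
          * (h q.1 * (starRingEnd ℂ) (h q.2))‖ₑ ∂(μ.prod μ) := by
        rw [hswap]
        exact enorm_integral_le_lintegral_enorm _
    _ = _ := by
        refine lintegral_congr fun q => ?_
        rw [enorm_mul, enorm_mul, RCLike.enorm_conj, ← ofReal_norm (Complex.ofReal _),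
          Complex.norm_real, Real.norm_of_nonneg (mul_nonneg hgm (gauss_pos _ _).le)]
        ring

/-- A weighted `L²` bound for oscillatory integrals whose phase map has a controlled
push-forward. -/
theorem lintegral_enorm_sq_le {d : ℕ} {X : Type*} [MeasurableSpace X] (μ : Measure X)
    [SFinite μ] {S : X → Ambient d} (hS : Measurable S) {h : X → ℂ} (hm : Measurable h)
    (hh : Integrable h μ) {ω : Ambient d → ℝ≥0∞} (hω : Measurable ω)
    (hω0 : ∀ᵐ x ∂μ, ω (S x) ≠ 0 ∧ ω (S x) ≠ ∞) {C : ℝ≥0∞}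
    (hC : ∀ φ : Ambient d → ℝ≥0∞, Measurable φ → ∫⁻ x, φ (S x) ∂μ ≤ C * ∫⁻ z, φ z * ω z) :
    ∫⁻ w, ‖∫ x, character w (S x) * h x ∂μ‖ₑ ^ 2 ≤
      2 * C * ENNReal.ofReal ((2 * Real.pi) ^ (d + 1)) * ∫⁻ x, ‖h x‖ₑ ^ 2 * ω (S x) ∂μ := by
  set B := 2 * C * ENNReal.ofReal ((2 * Real.pi) ^ (d + 1)) * ∫⁻ x, ‖h x‖ₑ ^ 2 * ω (S x) ∂μ
  have hmeas : Measurable fun q : Ambient d × X => character q.1 (S q.2) * h q.2 :=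
    (measurable_character measurable_fst (hS.comp measurable_snd)).mul
      (hm.comp measurable_snd)
  have hAm : StronglyMeasurable fun w => ∫ x, character w (S x) * h x ∂μ :=
    hmeas.stronglyMeasurable.integral_prod_right'
  have hgm : ∀ ε : ℝ, 0 < ε → 0 ≤ gaussMass d ε := fun ε hε => by unfold gaussMass; positivity
  have hε : ∀ ε : ℝ, 0 < ε →
      ∫⁻ w, ‖∫ x, character w (S x) * h x ∂μ‖ₑ ^ 2 * ENNReal.ofReal (gauss ε w) ≤ B := by
    intro ε hε
    refine (lintegral_enorm_sq_mul_gauss_le μ hS hm hh hε).trans ?_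
    set g : Ambient d → ℝ≥0∞ := fun z =>
      ENNReal.ofReal (gaussMass d ε * gauss (1 / (4 * ε)) z) with hg
    have hgmeas : Measurable g :=
      ((continuous_gauss _).measurable.const_mul _).ennreal_ofReal
    have hgneg : ∀ z, g (-z) = g z := fun z => by simp [hg, gauss]
    have hgint : ∀ a, ∫⁻ z, g (a - z) = ENNReal.ofReal ((2 * Real.pi) ^ (d + 1)) := by
      intro a
      rw [lintegral_sub_left_eq_self (fun z => g z) a,
        ← ofReal_integral_eq_lintegral_ofReal ((integrable_gauss (by positivity)).const_mul _)
          (Eventually.of_forall fun z => mul_nonneg (hgm ε hε) (gauss_pos _ _).le),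
        integral_const_mul, integral_gauss (by positivity), gaussMass_mul_gaussMass hε]
    have hae : ∀ᵐ q ∂(μ.prod μ), (ω (S q.1) ≠ 0 ∧ ω (S q.1) ≠ ∞) ∧
        (ω (S q.2) ≠ 0 ∧ ω (S q.2) ≠ ∞) :=
      (Measure.quasiMeasurePreserving_fst.ae hω0).and (Measure.quasiMeasurePreserving_snd.ae hω0)
    -- One half of the Young bound with weights `ω (S q.1)` and `ω (S q.2)`; the other half is its
    -- image under the swap, which explains the factor 2 in the constant.
    set P : X × X → ℝ≥0∞ := fun q =>
      ‖h q.1‖ₑ ^ 2 * ω (S q.1) * ((ω (S q.2))⁻¹ * g (S q.1 - S q.2)) with hP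
    have hPm : Measurable P := by
      have := hm.enorm; fun_prop
    have hswap : ∫⁻ q, P q.swap ∂(μ.prod μ) = ∫⁻ q, P q ∂(μ.prod μ) :=
      lintegral_prod_swap P
    have hPle : ∫⁻ q, P q ∂(μ.prod μ) ≤
        (∫⁻ x, ‖h x‖ₑ ^ 2 * ω (S x) ∂μ) * (C * ENNReal.ofReal ((2 * Real.pi) ^ (d + 1))) := by
      rw [lintegral_prod _ hPm.aemeasurable,
        ← lintegral_mul_const _ (by have := hm.enorm; fun_prop)]
      refine lintegral_mono fun x => ?_
      simp only [hP]
      rw [lintegral_const_mul _ (by fun_prop)]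
      gcongr
      -- The density bound produces a factor `ω`, which cancels against `ω⁻¹` and leaves the full
      -- mass of the Gaussian kernel.
      refine (hC (fun z => (ω z)⁻¹ * g (S x - z)) (by fun_prop)).trans ?_
      gcongr
      rw [← hgint (S x)]
      refine lintegral_mono fun z => ?_
      rw [mul_right_comm]
      exact mul_le_of_le_one_left' (ENNReal.inv_mul_le_one _)
    calc ∫⁻ q, ‖h q.1‖ₑ * ‖h q.2‖ₑ * g (S q.1 - S q.2) ∂(μ.prod μ)
        ≤ ∫⁻ q, (P q + P q.swap) ∂(μ.prod μ) := by
          refine lintegral_mono_ae (hae.mono fun q hq => ?_)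
          have h1 := mul_le_sq_mul_div_add (a := ‖h q.1‖ₑ) (b := ‖h q.2‖ₑ)
            hq.1.1 hq.1.2 hq.2.1 hq.2.2
          have h2 : g (S q.2 - S q.1) = g (S q.1 - S q.2) := by rw [← hgneg, neg_sub]
          simp only [hP, Prod.fst_swap, Prod.snd_swap, h2]
          calc _ ≤ _ := mul_le_mul_left h1 (g (S q.1 - S q.2))
            _ = _ := by ring
      _ = 2 * ∫⁻ q, P q ∂(μ.prod μ) := by
          rw [lintegral_add_left hPm, hswap, two_mul]
      _ ≤ B := by
          refine (mul_le_mul_right hPle 2).trans_eq ?_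
          ring
  -- The bound by `B` is uniform in `ε`, so Fatou's lemma along `ε = 1 / (n + 1)` removes the
  -- Gaussian.
  have hlim : ∀ w : Ambient d, Tendsto (fun n : ℕ =>
      ‖∫ x, character w (S x) * h x ∂μ‖ₑ ^ 2 * ENNReal.ofReal (gauss (1 / ((n : ℝ) + 1)) w)) atTop
      (𝓝 (‖∫ x, character w (S x) * h x ∂μ‖ₑ ^ 2)) := by
    intro w
    have h1 : Tendsto (fun n : ℕ => gauss (1 / ((n : ℝ) + 1)) w) atTop (𝓝 1) := by
      have h2 : Continuous fun ε : ℝ => gauss ε w := by unfold gauss; fun_prop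
      have h3 := (h2.tendsto 0).comp tendsto_one_div_add_atTop_nhds_zero_nat
      simpa [gauss, Function.comp_def] using h3
    have h4 := ENNReal.Tendsto.const_mul (a := ‖∫ x, character w (S x) * h x ∂μ‖ₑ ^ 2)
      (ENNReal.tendsto_ofReal h1) (Or.inr (by finiteness))
    simpa using h4
  calc ∫⁻ w, ‖∫ x, character w (S x) * h x ∂μ‖ₑ ^ 2
      = ∫⁻ w, liminf (fun n : ℕ => ‖∫ x, character w (S x) * h x ∂μ‖ₑ ^ 2 *
          ENNReal.ofReal (gauss (1 / ((n : ℝ) + 1)) w)) atTop :=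
        lintegral_congr fun w => (hlim w).liminf_eq.symm
    _ ≤ liminf (fun n : ℕ => ∫⁻ w, ‖∫ x, character w (S x) * h x ∂μ‖ₑ ^ 2 *
          ENNReal.ofReal (gauss (1 / ((n : ℝ) + 1)) w)) atTop :=
        lintegral_liminf_le fun n => (hAm.enorm.pow_const 2).mul
          (continuous_gauss _).measurable.ennreal_ofReal
    _ ≤ B := liminf_le_of_frequently_le'
        (Frequently.of_forall fun n => hε _ (by positivity))

/-! ### Hyperbolic polar coordinates and the threefold convolution on the hyperbola -/

/-- The upper bound in the change of variables formula for nonnegative integrands. -/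
lemma lintegral_comp_mul_abs_deriv_le {s t : Set ℝ} {f f' : ℝ → ℝ} (hs : MeasurableSet s)
    (hf' : ∀ x ∈ s, HasDerivAt f (f' x) x) (hf : InjOn f s) (hst : MapsTo f s t)
    (g : ℝ → ℝ≥0∞) :
    ∫⁻ x in s, ENNReal.ofReal |f' x| * g (f x) ≤ ∫⁻ x in t, g x := by
  rw [← lintegral_image_eq_lintegral_abs_deriv_mul hs (fun x hx => (hf' x hx).hasDerivWithinAt) hf]
  exact lintegral_mono_set hst.image_subset

/-- The point `s (sinh β, cosh β)` of the plane. -/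
def hypPolar (s β : ℝ) : ℝ × ℝ := (s * Real.sinh β, s * Real.cosh β)

lemma measurable_hypPolar : Measurable fun q : ℝ × ℝ => hypPolar q.1 q.2 := by
  unfold hypPolar; fun_prop

lemma hypPolar_add (a b θ ρ : ℝ) :
    hypPolar a θ + hypPolar b (θ + ρ) =
      (Real.cosh θ * (b * Real.sinh ρ) + Real.sinh θ * (a + b * Real.cosh ρ),
        Real.cosh θ * (a + b * Real.cosh ρ) + Real.sinh θ * (b * Real.sinh ρ)) := by
  simp only [hypPolar, Real.sinh_add, Real.cosh_add, Prod.mk_add_mk]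
  ext <;> ring_nf

/-- The Lorentz length of `a (0, 1) + b (sinh ρ, cosh ρ)`. -/
def pairMass (a b ρ : ℝ) : ℝ := Real.sqrt (a ^ 2 + b ^ 2 + 2 * a * b * Real.cosh ρ)

lemma pairMass_arg_pos {a b : ℝ} (ha : 0 < a) (hb : 0 < b) (ρ : ℝ) :
    0 < a ^ 2 + b ^ 2 + 2 * a * b * Real.cosh ρ := by
  have := Real.cosh_pos ρ; positivity

lemma pairMass_pos {a b : ℝ} (ha : 0 < a) (hb : 0 < b) (ρ : ℝ) : 0 < pairMass a b ρ :=
  Real.sqrt_pos.2 (pairMass_arg_pos ha hb ρ)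

lemma pairMass_sq {a b : ℝ} (ha : 0 < a) (hb : 0 < b) (ρ : ℝ) :
    pairMass a b ρ ^ 2 = a ^ 2 + b ^ 2 + 2 * a * b * Real.cosh ρ :=
  Real.sq_sqrt (pairMass_arg_pos ha hb ρ).le

lemma hypPolar_add_eq {a b : ℝ} (ha : 0 < a) (hb : 0 < b) (θ ρ : ℝ) :
    hypPolar a θ + hypPolar b (θ + ρ) =
      hypPolar (pairMass a b ρ) (θ + Real.arsinh (b * Real.sinh ρ / pairMass a b ρ)) := by
  have hs := pairMass_pos ha hb ρ
  have hs2 := pairMass_sq ha hb ρ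
  have hc : Real.cosh (Real.arsinh (b * Real.sinh ρ / pairMass a b ρ)) =
      (a + b * Real.cosh ρ) / pairMass a b ρ := by
    rw [Real.cosh_arsinh]
    have h1 : 0 ≤ (a + b * Real.cosh ρ) / pairMass a b ρ := by
      have := Real.cosh_pos ρ; positivity
    rw [← Real.sqrt_sq h1]
    congr 1
    rw [div_pow, div_pow, eq_div_iff (by positivity), add_mul, one_mul,
      div_mul_cancel₀ _ (by positivity), hs2]
    have := Real.cosh_sq ρ
    linear_combination (-b ^ 2) * this
  rw [hypPolar_add]
  simp only [hypPolar, Real.sinh_add, Real.cosh_add, hc, Real.sinh_arsinh]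
  ext
  all_goals
    field_simp
    try ring

/-- With `ρ` the rapidity difference, the length of the sum depends on `ρ` alone, and its rapidity
is `θ` plus a function of `ρ`. Translation invariance in `θ` absorbs that shift. -/
lemma lintegral_lintegral_hypPolar_add {a b : ℝ} (ha : 0 < a) (hb : 0 < b)
    {φ : ℝ × ℝ → ℝ≥0∞} (hφ : Measurable φ) :
    ∫⁻ θ, ∫⁻ θ', φ (hypPolar a θ + hypPolar b θ') =
      ∫⁻ ρ, ∫⁻ β, φ (hypPolar (pairMass a b ρ) β) := by
  have h1 : ∀ θ, ∫⁻ θ', φ (hypPolar a θ + hypPolar b θ') =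
      ∫⁻ ρ, φ (hypPolar (pairMass a b ρ)
        (θ + Real.arsinh (b * Real.sinh ρ / pairMass a b ρ))) := by
    intro θ
    rw [← lintegral_add_left_eq_self _ θ]
    simp_rw [hypPolar_add_eq ha hb]
  simp_rw [h1]
  have hm : Measurable fun q : ℝ × ℝ => φ (hypPolar (pairMass a b q.2)
      (q.1 + Real.arsinh (b * Real.sinh q.2 / pairMass a b q.2))) := by
    have := Real.continuous_arsinh.measurable
    unfold pairMass hypPolar; fun_prop
  rw [lintegral_lintegral_swap hm.aemeasurable]
  refine lintegral_congr fun ρ => ?_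
  exact lintegral_add_right_eq_self (fun β => φ (hypPolar (pairMass a b ρ) β)) _

/-- The area element is `s ds dβ`. It is obtained from two one-dimensional substitutions, `τ = s
cosh β` at fixed `β` and then `ξ = τ tanh β` at fixed `τ`. These coordinates cover only the forward
cone, which suffices for an upper bound. -/
lemma lintegral_hypPolar_le {φ : ℝ × ℝ → ℝ≥0∞} (hφ : Measurable φ) :
    ∫⁻ β, ∫⁻ s in Ioi (0 : ℝ), φ (hypPolar s β) * ENNReal.ofReal s ≤ ∫⁻ z, φ z := by
  have h1 : ∀ β, ∫⁻ s in Ioi (0 : ℝ), φ (hypPolar s β) * ENNReal.ofReal s ≤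
      ∫⁻ τ in Ioi (0 : ℝ), φ (τ * Real.tanh β, τ) * ENNReal.ofReal (τ / Real.cosh β ^ 2) := by
    intro β
    have hc := Real.cosh_pos β
    have := lintegral_comp_mul_abs_deriv_le (s := Ioi (0 : ℝ)) (t := Ioi 0)
      (f := fun s => s * Real.cosh β) (f' := fun _ => Real.cosh β) measurableSet_Ioi
      (fun x _ => by simpa using (hasDerivAt_id x).mul_const (Real.cosh β))
      (fun x _ y _ h => by simpa [hc.ne'] using h)
      (fun x hx => mul_pos hx hc)
      (fun τ => φ (τ * Real.tanh β, τ) * ENNReal.ofReal (τ / Real.cosh β ^ 2))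
    refine le_trans (le_of_eq ?_) this
    refine setLIntegral_congr_fun measurableSet_Ioi fun s hs => ?_
    simp only [hypPolar]
    rw [mul_left_comm, ← ENNReal.ofReal_mul (abs_nonneg _), abs_of_pos hc,
      Real.tanh_eq_sinh_div_cosh]
    congr 2
    · congr 1; field_simp
    · field_simp
  refine (lintegral_mono h1).trans ?_
  have hm : Measurable fun q : ℝ × ℝ => φ (q.2 * Real.tanh q.1, q.2) *
      ENNReal.ofReal (q.2 / Real.cosh q.1 ^ 2) := by
    simp only [Real.tanh_eq_sinh_div_cosh]
    fun_prop
  rw [lintegral_lintegral_swap hm.aemeasurable, Measure.volume_eq_prod, lintegral_prod_symm' _ hφ]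
  refine (setLIntegral_mono' measurableSet_Ioi fun τ hτ => ?_).trans (setLIntegral_le_lintegral _ _)
  have hd : ∀ β, HasDerivAt (fun β => τ * Real.tanh β) (τ / Real.cosh β ^ 2) β := by
    intro β
    have hc := Real.cosh_pos β
    have h2 := ((Real.hasDerivAt_sinh β).div (Real.hasDerivAt_cosh β) hc.ne').const_mul τ
    have h3 : (fun β => τ * Real.tanh β) = fun β => τ * (Real.sinh β / Real.cosh β) := by
      funext x; rw [Real.tanh_eq_sinh_div_cosh]
    rw [h3]
    refine h2.congr_deriv ?_
    rw [← mul_div_assoc]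
    congr 1
    have := Real.cosh_sq β
    linear_combination τ * this
  have hmono : StrictMono fun β => τ * Real.tanh β :=
    strictMono_of_deriv_pos fun β => by
      rw [(hd β).deriv]; exact div_pos hτ (by have := Real.cosh_pos β; positivity)
  have := lintegral_comp_mul_abs_deriv_le (s := univ) (t := univ) MeasurableSet.univ
    (fun x _ => hd x) hmono.injective.injOn (mapsTo_univ _ _) (fun ξ => φ (ξ, τ))
  simp only [Measure.restrict_univ] at this
  refine le_trans (le_of_eq (lintegral_congr fun β => ?_)) this
  rw [abs_of_pos (div_pos hτ (by have := Real.cosh_pos β; positivity)), mul_comm]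

lemma lintegral_eq_two_mul_Ioi {F : ℝ → ℝ≥0∞} (hF : ∀ x, F (-x) = F x) :
    ∫⁻ x, F x = 2 * ∫⁻ x in Ioi (0 : ℝ), F x := by
  have h1 : ∫⁻ x in Iio (0 : ℝ), F x = ∫⁻ x in Ioi (0 : ℝ), F x := by
    have := (Measure.measurePreserving_neg (volume : Measure ℝ)).setLIntegral_comp_preimage_emb
      (MeasurableEquiv.neg ℝ).measurableEmbedding F (Ioi 0)
    simpa [hF] using this
  rw [← lintegral_add_compl F (measurableSet_Ioi (a := (0 : ℝ))), compl_Ioi,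
    setLIntegral_congr Iio_ae_eq_Iic.symm, h1, two_mul]

/-- Substitution `m = pairMass a b ρ` on `ρ > 0`, where `dm / dρ = a b sinh ρ / m`. The product
under the root equals `(2 a b sinh ρ)²`; the constant 4 is this 2 times the 2 coming from evenness
in `ρ`. -/
lemma lintegral_comp_pairMass_le {a b : ℝ} (ha : 0 < a) (hb : 0 < b) (F : ℝ → ℝ≥0∞) :
    ∫⁻ ρ, F (pairMass a b ρ) ≤ ∫⁻ m in Ioi (a + b), F m * ENNReal.ofReal
      (4 * m / Real.sqrt ((m ^ 2 - (a - b) ^ 2) * (m ^ 2 - (a + b) ^ 2))) := by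
  have hab : 0 < a * b := mul_pos ha hb
  rw [lintegral_eq_two_mul_Ioi (fun x => by simp [pairMass])]
  have hd : ∀ ρ ∈ Ioi (0 : ℝ), HasDerivAt (pairMass a b)
      (a * b * Real.sinh ρ / pairMass a b ρ) ρ := by
    intro ρ _
    have h1 := (((Real.hasDerivAt_cosh ρ).const_mul (2 * a * b)).const_add (a ^ 2 + b ^ 2)).sqrt
      (pairMass_arg_pos ha hb ρ).ne'
    refine h1.congr_deriv ?_
    rw [show √(a ^ 2 + b ^ 2 + 2 * a * b * Real.cosh ρ) = pairMass a b ρ from rfl]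
    have := pairMass_pos ha hb ρ
    field_simp
  have hmono : StrictMonoOn (pairMass a b) (Ioi 0) := by
    intro x hx y hy hxy
    refine Real.sqrt_lt_sqrt (pairMass_arg_pos ha hb x).le ?_
    have : Real.cosh x < Real.cosh y := by
      rw [Real.cosh_lt_cosh, abs_of_pos hx, abs_of_pos hy]; exact hxy
    have := mul_lt_mul_of_pos_left this (show 0 < 2 * (a * b) by positivity)
    linarith
  have hmaps : MapsTo (pairMass a b) (Ioi 0) (Ioi (a + b)) := by
    intro x hx
    refine Real.lt_sqrt_of_sq_lt ?_
    have : 1 < Real.cosh x := Real.one_lt_cosh.2 (ne_of_gt hx)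
    nlinarith
  have := lintegral_comp_mul_abs_deriv_le measurableSet_Ioi hd hmono.injOn hmaps
    (fun m => F m * ENNReal.ofReal
      (4 * m / Real.sqrt ((m ^ 2 - (a - b) ^ 2) * (m ^ 2 - (a + b) ^ 2))))
  refine le_trans (le_of_eq ?_) this
  rw [← lintegral_const_mul' _ _ ENNReal.ofNat_ne_top]
  refine setLIntegral_congr_fun measurableSet_Ioi fun ρ hρ => ?_
  have hs : 0 < Real.sinh ρ := Real.sinh_pos_iff.2 hρ
  have hm := pairMass_pos ha hb ρ
  have hQ : Real.sqrt ((pairMass a b ρ ^ 2 - (a - b) ^ 2) * (pairMass a b ρ ^ 2 - (a + b) ^ 2))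
      = 2 * a * b * Real.sinh ρ := by
    rw [← Real.sqrt_sq (show 0 ≤ 2 * a * b * Real.sinh ρ by positivity), pairMass_sq ha hb]
    congr 1
    have := Real.cosh_sq ρ
    linear_combination (4 * a ^ 2 * b ^ 2) * this
  rw [hQ, mul_left_comm, ← ENNReal.ofReal_mul (abs_nonneg _), abs_of_pos (by positivity), mul_comm]
  congr 1
  rw [show a * b * Real.sinh ρ / pairMass a b ρ * (4 * pairMass a b ρ / (2 * a * b * Real.sinh ρ))
    = 2 by field_simp; norm_num]
  simp

lemma lintegral_inv_sqrt_sub_sq_le {R : ℝ} :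
    ∫⁻ x in Ioo (-R) R, ENNReal.ofReal (1 / Real.sqrt (R ^ 2 - x ^ 2)) ≤ ENNReal.ofReal Real.pi := by
  rcases le_or_gt R 0 with hR | hR
  · rw [Ioo_eq_empty (by linarith)]; simp
  have himg : Ioo (-R) R ⊆ (fun t => R * Real.sin t) '' Ioo (-(Real.pi / 2)) (Real.pi / 2) := by
    intro x hx
    refine ⟨Real.arcsin (x / R), ⟨Real.neg_pi_div_two_lt_arcsin.2 ?_,
      Real.arcsin_lt_pi_div_two.2 ?_⟩, ?_⟩
    · rw [lt_div_iff₀ hR]; linarith [hx.1]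
    · rw [div_lt_one hR]; exact hx.2
    · simp only
      rw [Real.sin_arcsin (by rw [le_div_iff₀ hR]; linarith [hx.1])
        (by rw [div_le_one hR]; exact hx.2.le)]
      field_simp
  refine (lintegral_mono_set himg).trans ?_
  rw [lintegral_image_eq_lintegral_abs_deriv_mul (f' := fun t => R * Real.cos t) measurableSet_Ioo
    (fun x _ => ((Real.hasDerivAt_sin x).const_mul R).hasDerivWithinAt)
    (fun x hx y hy h => Real.injOn_sin ⟨hx.1.le, hx.2.le⟩ ⟨hy.1.le, hy.2.le⟩
      (mul_left_cancel₀ hR.ne' h))]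
  have : ∀ t ∈ Ioo (-(Real.pi / 2)) (Real.pi / 2), ENNReal.ofReal |R * Real.cos t| *
      ENNReal.ofReal (1 / Real.sqrt (R ^ 2 - (R * Real.sin t) ^ 2)) = 1 := by
    intro t ht
    have hc := Real.cos_pos_of_mem_Ioo ht
    have h1 : R ^ 2 - (R * Real.sin t) ^ 2 = (R * Real.cos t) ^ 2 := by
      have := Real.sin_sq_add_cos_sq t
      linear_combination (-R ^ 2) * this
    rw [h1, Real.sqrt_sq (by positivity), abs_of_pos (by positivity),
      ← ENNReal.ofReal_mul (by positivity), mul_one_div_cancel (by positivity), ENNReal.ofReal_one]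
  rw [setLIntegral_congr_fun measurableSet_Ioo this]
  simp

/-- The difference is `2 sinh ((R + ρ) / 2) sinh ((R - ρ) / 2)`, and `sinh x ≥ x` for `x ≥ 0`. It
compares the triple kernel with the arcsine density. -/
lemma half_sq_sub_sq_le_cosh_sub_cosh {R ρ : ℝ} (h : |ρ| < R) :
    R ^ 2 - ρ ^ 2 ≤ 2 * (Real.cosh R - Real.cosh ρ) := by
  have h1 := abs_lt.1 h
  have hx : (R + ρ) / 2 ≤ Real.sinh ((R + ρ) / 2) := Real.self_le_sinh_iff.2 (by linarith)
  have hy : (R - ρ) / 2 ≤ Real.sinh ((R - ρ) / 2) := Real.self_le_sinh_iff.2 (by linarith)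
  have e : Real.cosh R - Real.cosh ρ = 2 * (Real.sinh ((R + ρ) / 2) * Real.sinh ((R - ρ) / 2)) := by
    have e1 := Real.cosh_add ((R + ρ) / 2) ((R - ρ) / 2)
    have e2 := Real.cosh_sub ((R + ρ) / 2) ((R - ρ) / 2)
    rw [show (R + ρ) / 2 + (R - ρ) / 2 = R by ring] at e1
    rw [show (R + ρ) / 2 - (R - ρ) / 2 = ρ by ring] at e2
    rw [e1, e2]; ring
  have := mul_le_mul hx hy (by linarith) (by linarith)
  rw [e]
  linarith

lemma two_le_pairMass_one_one (ρ : ℝ) : 2 ≤ pairMass 1 1 ρ := by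
  refine Real.le_sqrt_of_sq_le ?_
  linarith [Real.one_le_cosh ρ]

lemma lintegral_triple_kernel_le {m : ℝ} :
    ∫⁻ ρ, {ρ | pairMass 1 1 ρ + 1 < m}.indicator (fun ρ => ENNReal.ofReal (4 * m / Real.sqrt
      ((m ^ 2 - (pairMass 1 1 ρ - 1) ^ 2) * (m ^ 2 - (pairMass 1 1 ρ + 1) ^ 2)))) ρ ≤
      ENNReal.ofReal (m * (2 * Real.pi / Real.sqrt m)) := by
  rcases le_or_gt m 3 with hm | hm
  · have : {ρ | pairMass 1 1 ρ + 1 < m} = ∅ := by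
      ext ρ
      simp only [mem_ofPred_eq, mem_empty_iff_false, iff_false, not_lt]
      linarith [two_le_pairMass_one_one ρ]
    simp [this]
  -- `R` is the endpoint of the domain, where `pairMass 1 1 R = m - 1`.
  obtain ⟨R, hR0, hR⟩ : ∃ R : ℝ, 0 ≤ R ∧ Real.cosh R = ((m - 1) ^ 2 - 2) / 2 :=
    ⟨Real.arcosh (((m - 1) ^ 2 - 2) / 2), Real.arcosh_nonneg (by nlinarith),
      Real.cosh_arcosh (by nlinarith)⟩
  have hpt : ∀ ρ, {ρ | pairMass 1 1 ρ + 1 < m}.indicator (fun ρ => ENNReal.ofReal (4 * m /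
      Real.sqrt ((m ^ 2 - (pairMass 1 1 ρ - 1) ^ 2) * (m ^ 2 - (pairMass 1 1 ρ + 1) ^ 2)))) ρ ≤
      (Ioo (-R) R).indicator (fun ρ => ENNReal.ofReal (2 * Real.sqrt m) *
        ENNReal.ofReal (1 / Real.sqrt (R ^ 2 - ρ ^ 2))) ρ := by
    intro ρ
    by_cases hρ : pairMass 1 1 ρ + 1 < m
    · have hs2 := pairMass_sq one_pos one_pos ρ
      have hs := two_le_pairMass_one_one ρ
      set s := pairMass 1 1 ρ
      have hlt : Real.cosh ρ < Real.cosh R := by nlinarith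
      have hρR : |ρ| < R := by
        rw [Real.cosh_lt_cosh, abs_of_nonneg hR0] at hlt; exact hlt
      have h1 := half_sq_sub_sq_le_cosh_sub_cosh hρR
      have hpos : 0 < R ^ 2 - ρ ^ 2 := by
        have := sq_lt_sq' (by linarith [(abs_lt.1 hρR).1]) (abs_lt.1 hρR).2
        linarith
      rw [indicator_of_mem (by exact hρ), indicator_of_mem (mem_Ioo.2 (abs_lt.1 hρR)),
        ← ENNReal.ofReal_mul (by positivity)]
      refine ENNReal.ofReal_le_ofReal ?_
      -- After regrouping, the first factor is at least `(m + 1)² - (m - 1)² = 4m` since `s < m -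
      -- 1`, and the second is `2 (cosh R - cosh ρ)`. Only the second is singular, and it is
      -- integrated as an arcsine density.
      have h2 : 4 * m * (R ^ 2 - ρ ^ 2) ≤ (m ^ 2 - (s - 1) ^ 2) * (m ^ 2 - (s + 1) ^ 2) := by
        have e : (m ^ 2 - (s - 1) ^ 2) * (m ^ 2 - (s + 1) ^ 2) =
            ((m + 1) ^ 2 - s ^ 2) * ((m - 1) ^ 2 - s ^ 2) := by ring
        rw [e]
        have h3 : 4 * m ≤ (m + 1) ^ 2 - s ^ 2 := by nlinarith
        have h4 : R ^ 2 - ρ ^ 2 ≤ (m - 1) ^ 2 - s ^ 2 := by linarith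
        exact mul_le_mul h3 h4 hpos.le (by linarith)
      have hm0 : 0 < m := by linarith
      have h5 : 2 * Real.sqrt m * Real.sqrt (R ^ 2 - ρ ^ 2) ≤
          Real.sqrt ((m ^ 2 - (s - 1) ^ 2) * (m ^ 2 - (s + 1) ^ 2)) := by
        refine Real.le_sqrt_of_sq_le (le_trans (le_of_eq ?_) h2)
        rw [mul_pow, mul_pow, Real.sq_sqrt hm0.le, Real.sq_sqrt hpos.le]; ring
      have h6 := Real.sqrt_pos.2 hm0
      have h7 := Real.sqrt_pos.2 hpos
      calc 4 * m / Real.sqrt ((m ^ 2 - (s - 1) ^ 2) * (m ^ 2 - (s + 1) ^ 2))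
          ≤ 4 * m / (2 * Real.sqrt m * Real.sqrt (R ^ 2 - ρ ^ 2)) := by gcongr
        _ = 2 * Real.sqrt m * (1 / Real.sqrt (R ^ 2 - ρ ^ 2)) := by
            field_simp
            rw [Real.sq_sqrt hm0.le]; norm_num
    · rw [indicator_of_notMem (by exact hρ)]; exact zero_le
  refine (lintegral_mono hpt).trans ?_
  rw [lintegral_indicator measurableSet_Ioo, lintegral_const_mul' _ _ ENNReal.ofReal_ne_top]
  refine (mul_le_mul_right lintegral_inv_sqrt_sub_sq_le _).trans_eq ?_
  rw [← ENNReal.ofReal_mul (by positivity)]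
  congr 1
  have hm0 : 0 < m := by linarith
  have := Real.sq_sqrt hm0.le
  have h6 := Real.sqrt_pos.2 hm0
  field_simp
  rw [this]

/-- Passage from a density in the Lorentz length to one in the plane: the factor `m` in the bound
for `W` is the Jacobian of polar coordinates, so `ω` remains as planar density. -/
lemma lintegral_lintegral_hypPolar_mul_le {Y : Type*} [MeasurableSpace Y] (ν : Measure Y)
    [SFinite ν] {φ : ℝ × ℝ → ℝ≥0∞} (hφ : Measurable φ) {W : ℝ → Y → ℝ≥0∞}
    (hW : Measurable (Function.uncurry W)) {ω : ℝ → ℝ≥0∞} (hω : Measurable ω)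
    (h0 : ∀ m ≤ 0, ∀ y, W m y = 0)
    (h : ∀ m, 0 < m → ∫⁻ y, W m y ∂ν ≤ ENNReal.ofReal m * ω m) :
    ∫⁻ y, (∫⁻ m, (∫⁻ β, φ (hypPolar m β)) * W m y) ∂ν ≤
      ∫⁻ z, {z : ℝ × ℝ | 0 < z.2}.indicator
        (fun z => φ z * ω (Real.sqrt (z.2 ^ 2 - z.1 ^ 2))) z := by
  have hφm : ∀ m, Measurable fun β => φ (hypPolar m β) := fun m =>
    hφ.comp (by unfold hypPolar; fun_prop)
  have hΦ : Measurable fun m => ∫⁻ β, φ (hypPolar m β) :=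
    Measurable.lintegral_prod_right' (f := fun q : ℝ × ℝ => φ (hypPolar q.1 q.2))
      (hφ.comp measurable_hypPolar)
  have hWm : ∀ m, Measurable (W m) := fun m => hW.comp measurable_prodMk_left
  have hψ : Measurable ({z : ℝ × ℝ | 0 < z.2}.indicator
      (fun z => φ z * ω (Real.sqrt (z.2 ^ 2 - z.1 ^ 2)))) := by
    refine Measurable.indicator (by fun_prop) ?_
    exact measurableSet_lt measurable_const measurable_snd
  refine le_trans ?_ (lintegral_hypPolar_le hψ)
  have e1 : AEMeasurable (Function.uncurry fun y m => (∫⁻ β, φ (hypPolar m β)) * W m y)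
      (ν.prod volume) := by
    have h1 : Measurable fun q : Y × ℝ => W q.2 q.1 := hW.comp measurable_swap
    exact ((hΦ.comp measurable_snd).mul h1).aemeasurable
  rw [lintegral_lintegral_swap e1]
  have e2 : ∀ m, ∫⁻ y, (∫⁻ β, φ (hypPolar m β)) * W m y ∂ν ≤
      (Ioi 0).indicator (fun m => ∫⁻ β, φ (hypPolar m β) * (ENNReal.ofReal m * ω m)) m := by
    intro m
    rw [lintegral_const_mul _ (hWm m)]
    by_cases hm : 0 < m
    · rw [indicator_of_mem (mem_Ioi.2 hm), lintegral_mul_const _ (hφm m)]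
      gcongr
      exact h m hm
    · simp [h0 m (not_lt.1 hm)]
  refine (lintegral_mono e2).trans_eq ?_
  rw [lintegral_indicator measurableSet_Ioi, lintegral_lintegral_swap]
  · refine lintegral_congr fun β => setLIntegral_congr_fun measurableSet_Ioi fun m hm => ?_
    have h1 : (hypPolar m β).2 ^ 2 - (hypPolar m β).1 ^ 2 = m ^ 2 := by
      have := Real.cosh_sq β
      simp only [hypPolar]
      linear_combination m ^ 2 * this
    have h2 : hypPolar m β ∈ {z : ℝ × ℝ | 0 < z.2} := mul_pos hm (Real.cosh_pos β)
    simp only [indicator_of_mem h2, h1, Real.sqrt_sq (le_of_lt hm)]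
    ring
  · have h1 : Measurable fun q : ℝ × ℝ => φ (hypPolar q.1 q.2) := hφ.comp measurable_hypPolar
    exact (h1.mul (by fun_prop)).aemeasurable

/-- The density of the threefold convolution of the Lorentz invariant measure of the hyperbola
is at most `2π s^{-1/2}`, where `s` is the Lorentz length. -/
theorem lintegral_triple_hypPolar_le {φ : ℝ × ℝ → ℝ≥0∞} (hφ : Measurable φ) :
    ∫⁻ θ₁, ∫⁻ θ₂, ∫⁻ θ₃, φ (hypPolar 1 θ₁ + hypPolar 1 θ₂ + hypPolar 1 θ₃) ≤
      ∫⁻ z, φ z * ENNReal.ofReal (2 * Real.pi / Real.sqrt (Real.sqrt (z.2 ^ 2 - z.1 ^ 2))) := by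
  have hφ3 : Measurable fun z => ∫⁻ θ₃, φ (z + hypPolar 1 θ₃) := by
    refine Measurable.lintegral_prod_right' (f := fun q : (ℝ × ℝ) × ℝ => φ (q.1 + hypPolar 1 q.2)) ?_
    unfold hypPolar; fun_prop
  have e1 : ∫⁻ θ₁, ∫⁻ θ₂, ∫⁻ θ₃, φ (hypPolar 1 θ₁ + hypPolar 1 θ₂ + hypPolar 1 θ₃) =
      ∫⁻ ρ, ∫⁻ ρ', ∫⁻ β, φ (hypPolar (pairMass (pairMass 1 1 ρ) 1 ρ') β) := by
    rw [lintegral_lintegral_hypPolar_add one_pos one_pos hφ3]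
    refine lintegral_congr fun ρ => ?_
    exact lintegral_lintegral_hypPolar_add (pairMass_pos one_pos one_pos ρ) one_pos hφ
  rw [e1]
  -- For a given rapidity difference `ρ` of the first two points, `W m ρ` is the density in `m` of
  -- the length after the third point is added.
  set W : ℝ → ℝ → ℝ≥0∞ := fun m ρ => {ρ | pairMass 1 1 ρ + 1 < m}.indicator
    (fun ρ => ENNReal.ofReal (4 * m / Real.sqrt
      ((m ^ 2 - (pairMass 1 1 ρ - 1) ^ 2) * (m ^ 2 - (pairMass 1 1 ρ + 1) ^ 2)))) ρ with hW
  have hWm : Measurable (Function.uncurry W) := by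
    have hpm : Measurable (pairMass 1 1) := by unfold pairMass; fun_prop
    have h1 : MeasurableSet {q : ℝ × ℝ | pairMass 1 1 q.2 + 1 < q.1} :=
      measurableSet_lt (by fun_prop) (by fun_prop)
    have h2 : Measurable fun q : ℝ × ℝ => ENNReal.ofReal (4 * q.1 / Real.sqrt
      ((q.1 ^ 2 - (pairMass 1 1 q.2 - 1) ^ 2) * (q.1 ^ 2 - (pairMass 1 1 q.2 + 1) ^ 2))) := by
      fun_prop
    exact h2.indicator h1
  calc ∫⁻ ρ, ∫⁻ ρ', ∫⁻ β, φ (hypPolar (pairMass (pairMass 1 1 ρ) 1 ρ') β)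
      ≤ ∫⁻ ρ, ∫⁻ m, (∫⁻ β, φ (hypPolar m β)) * W m ρ := by
        refine lintegral_mono fun ρ => ?_
        refine (lintegral_comp_pairMass_le (pairMass_pos one_pos one_pos ρ) one_pos
          fun m => ∫⁻ β, φ (hypPolar m β)).trans_eq ?_
        rw [← lintegral_indicator measurableSet_Ioi]
        refine lintegral_congr fun m => ?_
        by_cases h : pairMass 1 1 ρ + 1 < m
        · simp [hW, indicator, h]
        · simp [hW, indicator, h]
    _ ≤ _ := lintegral_lintegral_hypPolar_mul_le volume hφ hWm
        (ω := fun m => ENNReal.ofReal (2 * Real.pi / Real.sqrt m)) (by fun_prop)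
        (fun m hm ρ => indicator_of_notMem
            (by simp only [mem_ofPred_eq]; linarith [two_le_pairMass_one_one ρ]) _)
        (fun m hm => by
          rw [← ENNReal.ofReal_mul hm.le]
          exact lintegral_triple_kernel_le)
    _ ≤ _ := lintegral_mono fun z => indicator_le_self _ _ _

/-! ### Slicing and the twofold convolution on the two-dimensional hyperboloid -/

/-- The mass `√(1 + v²)` of the hyperbola `{y₂ = v}` of the two-dimensional hyperboloid. -/
def sliceMass (v : ℝ) : ℝ := Real.sqrt (1 + v ^ 2)

lemma sliceMass_pos (v : ℝ) : 0 < sliceMass v := Real.sqrt_pos.2 (by positivity)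

lemma sliceMass_sq (v : ℝ) : sliceMass v ^ 2 = 1 + v ^ 2 := Real.sq_sqrt (by positivity)

lemma measurable_sliceMass : Measurable sliceMass := by unfold sliceMass; fun_prop

/-- Triangle inequality for the plane vectors `(1, v)` and `(1, u - v)`, whose sum is `(2, u)`. It
is the source of the threshold `s ≥ 2` for the Lorentz length of a sum. -/
lemma four_add_sq_le_sliceMass_add_sq (u v : ℝ) :
    4 + u ^ 2 ≤ (sliceMass v + sliceMass (u - v)) ^ 2 := by
  have h1 := sliceMass_sq v
  have h2 := sliceMass_sq (u - v)
  have h3 : 1 + v * (u - v) ≤ sliceMass v * sliceMass (u - v) := by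
    refine le_trans (le_abs_self _) (abs_le_of_sq_le_sq ?_ ?_)
    · rw [mul_pow, h1, h2]; nlinarith [sq_nonneg (v - (u - v))]
    · exact (mul_pos (sliceMass_pos _) (sliceMass_pos _)).le
  nlinarith

/-- The density in `m` of the Lorentz length of a sum of two points of the hyperbolas with
second coordinates `v` and `u - v`. -/
def sliceKernel (u m v : ℝ) : ℝ≥0∞ :=
  if sliceMass v + sliceMass (u - v) < m then ENNReal.ofReal (4 * m /
    Real.sqrt ((m ^ 2 - (sliceMass v - sliceMass (u - v)) ^ 2) *
      (m ^ 2 - (sliceMass v + sliceMass (u - v)) ^ 2))) else 0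

lemma measurable_sliceKernel {X : Type*} [MeasurableSpace X] {f g h : X → ℝ} (hf : Measurable f)
    (hg : Measurable g) (hh : Measurable h) : Measurable fun x => sliceKernel (f x) (g x) (h x) := by
  have := measurable_sliceMass
  exact Measurable.ite (measurableSet_lt (by fun_prop) (by fun_prop)) (by fun_prop)
    measurable_const

/-- Under the root the quartic terms in `v` cancel, leaving a quadratic in `v` centred at `u / 2`.
The integral is thus of arcsine type, contributing `π` times `2m / √(m² - u²)`. -/
lemma lintegral_sliceKernel_le {u m : ℝ} (hm : 0 < m) :
    ∫⁻ v, sliceKernel u m v ≤ ENNReal.ofReal m *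
      (if 4 + u ^ 2 ≤ m ^ 2 then ENNReal.ofReal (2 * Real.pi / Real.sqrt (m ^ 2 - u ^ 2)) else 0) := by
  have key : ∀ v, sliceMass v + sliceMass (u - v) < m → 4 + u ^ 2 < m ^ 2 := fun v hv => by
    refine (four_add_sq_le_sliceMass_add_sq u v).trans_lt ?_
    have := sliceMass_pos v
    have := sliceMass_pos (u - v)
    exact pow_lt_pow_left₀ hv (by positivity) two_ne_zero
  by_cases hu : 4 + u ^ 2 ≤ m ^ 2
  swap
  · have : ∀ v, sliceKernel u m v = 0 := fun v => if_neg fun hv => hu (key v hv).le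
    simp [this]
  rw [if_pos hu]
  have hB : 0 < m ^ 2 - u ^ 2 := by linarith
  set B := m ^ 2 - u ^ 2 with hBdef
  -- Completing the square gives `4 B (R² - (v - u/2)²)` under the root.
  set R := Real.sqrt (m ^ 2 * (m ^ 2 - 4 - u ^ 2) / (4 * B)) with hR
  have hR2 : R ^ 2 = m ^ 2 * (m ^ 2 - 4 - u ^ 2) / (4 * B) :=
    Real.sq_sqrt (div_nonneg (mul_nonneg (sq_nonneg _) (by linarith)) (by linarith))
  have hpt : ∀ v, sliceKernel u m v ≤ (Ioo (-R) R).indicator (fun x =>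
      ENNReal.ofReal (2 * m / Real.sqrt B) * ENNReal.ofReal (1 / Real.sqrt (R ^ 2 - x ^ 2)))
      (v - u / 2) := by
    intro v
    by_cases hv : sliceMass v + sliceMass (u - v) < m
    · have p1 := sliceMass_pos v
      have p2 := sliceMass_pos (u - v)
      have s1 := sliceMass_sq v
      have s2 := sliceMass_sq (u - v)
      have hQ : (m ^ 2 - (sliceMass v - sliceMass (u - v)) ^ 2) *
          (m ^ 2 - (sliceMass v + sliceMass (u - v)) ^ 2) =
          4 * B * (R ^ 2 - (v - u / 2) ^ 2) := by
        have e : (m ^ 2 - (sliceMass v - sliceMass (u - v)) ^ 2) *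
          (m ^ 2 - (sliceMass v + sliceMass (u - v)) ^ 2) =
          (m ^ 2 - sliceMass v ^ 2 - sliceMass (u - v) ^ 2) ^ 2 -
            4 * sliceMass v ^ 2 * sliceMass (u - v) ^ 2 := by ring
        rw [e, s1, s2, mul_sub, hR2, mul_div_cancel₀ _ (by positivity), hBdef]
        ring
      have hQpos : 0 < (m ^ 2 - (sliceMass v - sliceMass (u - v)) ^ 2) *
          (m ^ 2 - (sliceMass v + sliceMass (u - v)) ^ 2) := by
        refine mul_pos ?_ ?_ <;> nlinarith
      have hx : 0 < R ^ 2 - (v - u / 2) ^ 2 := by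
        rw [hQ] at hQpos
        exact pos_of_mul_pos_right hQpos (by positivity)
      have hmem : v - u / 2 ∈ Ioo (-R) R :=
        abs_lt.1 (abs_lt_of_sq_lt_sq (by linarith) (Real.sqrt_nonneg _))
      rw [sliceKernel, if_pos hv, indicator_of_mem hmem,
        ← ENNReal.ofReal_mul (by positivity), hQ, Real.sqrt_mul (by positivity),
        Real.sqrt_mul (by norm_num), show Real.sqrt 4 = 2 by
          rw [show (4 : ℝ) = 2 ^ 2 by norm_num]; exact Real.sqrt_sq (by norm_num)]
      refine ENNReal.ofReal_le_ofReal (le_of_eq ?_)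
      have h6 := Real.sqrt_pos.2 hB
      have h7 := Real.sqrt_pos.2 hx
      field_simp
      norm_num
    · rw [sliceKernel, if_neg hv]; exact zero_le
  refine (lintegral_mono hpt).trans ?_
  rw [lintegral_sub_right_eq_self (fun v => (Ioo (-R) R).indicator (fun x =>
      ENNReal.ofReal (2 * m / Real.sqrt B) * ENNReal.ofReal (1 / Real.sqrt (R ^ 2 - x ^ 2))) v),
    lintegral_indicator measurableSet_Ioo, lintegral_const_mul' _ _ ENNReal.ofReal_ne_top]
  refine (mul_le_mul_right lintegral_inv_sqrt_sub_sq_le _).trans_eq ?_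
  rw [← ENNReal.ofReal_mul (by positivity), ← ENNReal.ofReal_mul hm.le]
  congr 1
  ring

/-- The density of the twofold convolution of the Lorentz invariant measure of the
two-dimensional hyperboloid is at most `2π / s`, where `s ≥ 2` is the Lorentz length. -/
theorem lintegral_pair_slice_le {φ : (ℝ × ℝ) × ℝ → ℝ≥0∞} (hφ : Measurable φ) :
    ∫⁻ v, ∫⁻ v', ∫⁻ θ, ∫⁻ θ', φ (hypPolar (sliceMass v) θ + hypPolar (sliceMass v') θ', v + v') ≤
      ∫⁻ z : (ℝ × ℝ) × ℝ, φ z *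
        (if 0 < z.1.2 ∧ 4 ≤ z.1.2 ^ 2 - z.1.1 ^ 2 - z.2 ^ 2 then
          ENNReal.ofReal (2 * Real.pi / Real.sqrt (z.1.2 ^ 2 - z.1.1 ^ 2 - z.2 ^ 2)) else 0) := by
  have hφu : ∀ u, Measurable fun z => φ (z, u) := fun u => hφ.comp measurable_prodMk_right
  have e1 : ∀ v v', ∫⁻ θ, ∫⁻ θ',
      φ (hypPolar (sliceMass v) θ + hypPolar (sliceMass v') θ', v + v') ≤
      ∫⁻ m, (∫⁻ β, φ (hypPolar m β, v + v')) * sliceKernel (v + v') m v := by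
    intro v v'
    rw [lintegral_lintegral_hypPolar_add (sliceMass_pos v) (sliceMass_pos v') (hφu (v + v'))]
    refine (lintegral_comp_pairMass_le (sliceMass_pos v) (sliceMass_pos v')
      fun m => ∫⁻ β, φ (hypPolar m β, v + v')).trans_eq ?_
    rw [← lintegral_indicator measurableSet_Ioi]
    refine lintegral_congr fun m => ?_
    have e : v + v' - v = v' := by ring
    by_cases h : sliceMass v + sliceMass v' < m
    · simp [sliceKernel, indicator, h, e]
    · simp [sliceKernel, indicator, h, e]
  have hmeas : Measurable fun q : ℝ × ℝ =>
      ∫⁻ m, (∫⁻ β, φ (hypPolar m β, q.2)) * sliceKernel q.2 m q.1 := by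
    refine Measurable.lintegral_prod_right' (f := fun r : (ℝ × ℝ) × ℝ =>
      (∫⁻ β, φ (hypPolar r.2 β, r.1.2)) * sliceKernel r.1.2 r.2 r.1.1) ?_
    refine Measurable.mul ?_ ?_
    · refine Measurable.lintegral_prod_right' (f := fun r : ((ℝ × ℝ) × ℝ) × ℝ =>
        φ (hypPolar r.1.2 r.2, r.1.1.2)) ?_
      unfold hypPolar; fun_prop
    · exact measurable_sliceKernel (by fun_prop) (by fun_prop) (by fun_prop)
  calc ∫⁻ v, ∫⁻ v', ∫⁻ θ, ∫⁻ θ', φ (hypPolar (sliceMass v) θ + hypPolar (sliceMass v') θ', v + v')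
      ≤ ∫⁻ v, ∫⁻ v', ∫⁻ m, (∫⁻ β, φ (hypPolar m β, v + v')) * sliceKernel (v + v') m v :=
        lintegral_mono fun v => lintegral_mono fun v' => e1 v v'
    -- The variable `u = v + v'` is the second coordinate of the sum, which boosts in the first
    -- direction leave fixed.
    _ = ∫⁻ v, ∫⁻ u, ∫⁻ m, (∫⁻ β, φ (hypPolar m β, u)) * sliceKernel u m v :=
        lintegral_congr fun v => lintegral_add_left_eq_self
          (fun u => ∫⁻ m, (∫⁻ β, φ (hypPolar m β, u)) * sliceKernel u m v) v
    _ = ∫⁻ u, ∫⁻ v, ∫⁻ m, (∫⁻ β, φ (hypPolar m β, u)) * sliceKernel u m v :=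
        lintegral_lintegral_swap (f := fun v u =>
          ∫⁻ m, (∫⁻ β, φ (hypPolar m β, u)) * sliceKernel u m v) hmeas.aemeasurable
    _ ≤ ∫⁻ u, ∫⁻ z : ℝ × ℝ, φ (z, u) * (if 0 < z.2 ∧ 4 ≤ z.2 ^ 2 - z.1 ^ 2 - u ^ 2 then
          ENNReal.ofReal (2 * Real.pi / Real.sqrt (z.2 ^ 2 - z.1 ^ 2 - u ^ 2)) else 0) := by
        refine lintegral_mono fun u => ?_
        have hk : Measurable (Function.uncurry (sliceKernel u)) :=
          measurable_sliceKernel measurable_const measurable_fst measurable_snd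
        refine (lintegral_lintegral_hypPolar_mul_le volume (hφu u) hk
          (ω := fun m => if 4 + u ^ 2 ≤ m ^ 2 then
            ENNReal.ofReal (2 * Real.pi / Real.sqrt (m ^ 2 - u ^ 2)) else 0) ?_ ?_ ?_).trans ?_
        · exact Measurable.ite (measurableSet_le measurable_const (by fun_prop)) (by fun_prop)
            measurable_const
        · intro m hm v
          refine if_neg ?_
          linarith [sliceMass_pos v, sliceMass_pos (u - v)]
        · intro m hm
          exact lintegral_sliceKernel_le hm
        · refine lintegral_mono fun z => ?_
          by_cases hz : 0 < z.2
          · rw [indicator_of_mem (by exact hz)]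
            gcongr
            rcases le_or_gt 0 (z.2 ^ 2 - z.1 ^ 2) with h | h
            · rw [Real.sq_sqrt h]
              by_cases h4 : 4 + u ^ 2 ≤ z.2 ^ 2 - z.1 ^ 2
              · rw [if_pos h4, if_pos ⟨hz, by linarith⟩]
              · rw [if_neg h4]; exact zero_le
            -- Outside the cone `Real.sqrt` is 0, and the condition `4 + u² ≤ 0` fails.
            · rw [Real.sqrt_eq_zero_of_nonpos h.le, if_neg (by nlinarith [sq_nonneg u])]
              exact zero_le
          · rw [indicator_of_notMem (by exact hz)]; exact zero_le
    _ = _ := by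
        rw [Measure.volume_eq_prod (ℝ × ℝ) ℝ, lintegral_prod_symm']
        refine hφ.mul (Measurable.ite ?_ (by fun_prop) measurable_const)
        exact (measurableSet_lt (f := fun _ => (0 : ℝ)) (g := fun z : (ℝ × ℝ) × ℝ => z.1.2)
          measurable_const (by fun_prop)).inter (measurableSet_le (f := fun _ => (4 : ℝ))
          (g := fun z : (ℝ × ℝ) × ℝ => z.1.2 ^ 2 - z.1.1 ^ 2 - z.2 ^ 2)
          measurable_const (by fun_prop))

/-! ### The Minkowski form and rapidity coordinates for `σ` -/

lemma one_le_bracket {d : ℕ} (y : E d) : 1 ≤ bracket y :=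
  Real.le_sqrt_of_sq_le (by nlinarith [sq_nonneg ‖y‖])

lemma bracket_pos {d : ℕ} (y : E d) : 0 < bracket y := one_pos.trans_le (one_le_bracket y)

lemma bracket_sq {d : ℕ} (y : E d) : bracket y ^ 2 = 1 + ‖y‖ ^ 2 := Real.sq_sqrt (by positivity)

lemma continuous_bracket {d : ℕ} : Continuous (bracket (d := d)) := by
  unfold bracket; fun_prop

lemma measurable_bracket {d : ℕ} : Measurable (bracket (d := d)) := continuous_bracket.measurable

instance {d : ℕ} : SFinite (sigma d) := by unfold sigma; infer_instance

lemma measurable_graph {d : ℕ} : Measurable fun y : E d => (y, bracket y) :=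
  measurable_id.prodMk measurable_bracket

lemma lintegral_sigma {d : ℕ} {φ : Ambient d → ℝ≥0∞} (hφ : Measurable φ) :
    ∫⁻ z, φ z ∂(sigma d) = ∫⁻ y, φ (y, bracket y) * ENNReal.ofReal (1 / bracket y) := by
  have := measurable_bracket (d := d)
  rw [sigma, lintegral_map hφ measurable_graph, lintegral_withDensity_eq_lintegral_mul _
    (by fun_prop) (show Measurable fun y : E d => φ (y, bracket y) from hφ.comp measurable_graph)]
  refine lintegral_congr fun y => ?_
  simp [mul_comm]

/-- The Minkowski form on the ambient space. -/
def mink {d : ℕ} (z w : Ambient d) : ℝ := z.2 * w.2 - inner ℝ z.1 w.1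

lemma measurable_mink {d : ℕ} {X : Type*} [MeasurableSpace X] {f g : X → Ambient d}
    (hf : Measurable f) (hg : Measurable g) : Measurable fun x => mink (f x) (g x) := by
  unfold mink
  exact (hf.snd.mul hg.snd).sub (hf.fst.inner hg.fst)

lemma mink_add_left {d : ℕ} (z z' w : Ambient d) : mink (z + z') w = mink z w + mink z' w := by
  simp only [mink, Prod.fst_add, Prod.snd_add, inner_add_left]; ring

lemma mink_comm {d : ℕ} (z w : Ambient d) : mink z w = mink w z := by
  simp only [mink, real_inner_comm, mul_comm]

lemma mink_add_right {d : ℕ} (z w w' : Ambient d) : mink z (w + w') = mink z w + mink z w' := by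
  rw [mink_comm, mink_add_left, mink_comm w, mink_comm w']

lemma mink_sub_self {d : ℕ} (z w : Ambient d) :
    mink (z - w) (z - w) = mink z z - 2 * mink z w + mink w w := by
  simp only [mink, Prod.fst_sub, Prod.snd_sub, inner_sub_left, inner_sub_right,
    real_inner_comm w.1 z.1]
  ring

lemma mink_self_eq_one {d : ℕ} {z : Ambient d} (hz : z ∈ hyperboloid d) : mink z z = 1 := by
  have h : z.2 = bracket z.1 := hz
  have := bracket_sq z.1
  rw [mink, real_inner_self_eq_norm_sq, h]
  linarith [sq (bracket z.1)]

lemma snd_pos_of_mem {d : ℕ} {z : Ambient d} (hz : z ∈ hyperboloid d) : 0 < z.2 :=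
  (bracket_pos z.1).trans_eq hz.symm

lemma mem_hyperboloid_of_mink {d : ℕ} {z : Ambient d} (h : mink z z = 1) (h0 : 0 < z.2) :
    z ∈ hyperboloid d := by
  change z.2 = bracket z.1
  rw [mink, real_inner_self_eq_norm_sq] at h
  rw [bracket, eq_comm, Real.sqrt_eq_iff_mul_self_eq (by positivity) h0.le]
  linarith

/-- Reversed Cauchy–Schwarz inequality: the product is the hyperbolic cosine of the distance between
the two points. -/
lemma one_le_mink {d : ℕ} {z w : Ambient d} (hz : z ∈ hyperboloid d) (hw : w ∈ hyperboloid d) :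
    1 ≤ mink z w := by
  have h1 : z.2 = bracket z.1 := hz
  have h2 : w.2 = bracket w.1 := hw
  have h3 := real_inner_le_norm z.1 w.1
  have h4 := bracket_sq z.1
  have h5 := bracket_sq w.1
  have h6 : 1 + ‖z.1‖ * ‖w.1‖ ≤ bracket z.1 * bracket w.1 := by
    refine abs_le_of_sq_le_sq' ?_ (mul_pos (bracket_pos _) (bracket_pos _)).le |>.2
    rw [mul_pow, h4, h5]
    nlinarith [sq_nonneg (‖z.1‖ - ‖w.1‖)]
  rw [mink, h1, h2]
  linarith

lemma measurableSet_hyperboloid {d : ℕ} : MeasurableSet (hyperboloid d) :=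
  measurableSet_eq_fun measurable_snd (measurable_bracket.comp measurable_fst)

lemma ae_mem_hyperboloid {d : ℕ} : ∀ᵐ z ∂(sigma d), z ∈ hyperboloid d := by
  refine (ae_map_iff measurable_graph.aemeasurable measurableSet_hyperboloid).2 ?_
  exact Eventually.of_forall fun y => rfl

/-- The plane as the ambient space of the hyperbola. -/
def planeEmb (z : ℝ × ℝ) : Ambient 1 := (!₂[z.1], z.2)

/-- The three-dimensional ambient space, with the plane of the first and last coordinates
split off. -/
def sliceEmb (z : (ℝ × ℝ) × ℝ) : Ambient 2 := (!₂[z.1.1, z.2], z.1.2)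

lemma planeEmb_add (z w : ℝ × ℝ) : planeEmb (z + w) = planeEmb z + planeEmb w := by
  refine Prod.ext ?_ rfl
  ext i
  fin_cases i
  simp [planeEmb]

lemma sliceEmb_add (z w : (ℝ × ℝ) × ℝ) : sliceEmb (z + w) = sliceEmb z + sliceEmb w := by
  refine Prod.ext ?_ rfl
  ext i
  fin_cases i <;> simp [sliceEmb]

lemma measurePreserving_line : MeasurePreserving fun x : ℝ => (!₂[x] : E 1) := by
  have h := (PiLp.volume_preserving_toLp (Fin 1)).comp
    ((volume_preserving_funUnique (Fin 1) ℝ).symm _)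
  have e : (fun x : ℝ => (!₂[x] : E 1)) =
      WithLp.toLp 2 ∘ ⇑(MeasurableEquiv.funUnique (Fin 1) ℝ).symm := by
    funext x
    ext i
    fin_cases i
    simp [MeasurableEquiv.funUnique]
  rw [e]
  exact h

lemma measurePreserving_plane : MeasurePreserving fun x : ℝ × ℝ => (!₂[x.1, x.2] : E 2) := by
  have h := (PiLp.volume_preserving_toLp (Fin 2)).comp
    ((volume_preserving_finTwoArrow ℝ).symm _)
  have e : (fun x : ℝ × ℝ => (!₂[x.1, x.2] : E 2)) =
      WithLp.toLp 2 ∘ ⇑(MeasurableEquiv.finTwoArrow (α := ℝ)).symm := by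
    funext x
    ext i
    fin_cases i <;> simp [MeasurableEquiv.finTwoArrow]
  rw [e]
  exact h

lemma norm_sq_line (x : ℝ) : ‖(!₂[x] : E 1)‖ ^ 2 = x ^ 2 := by
  simp [EuclideanSpace.norm_sq_eq]

lemma norm_sq_plane (x y : ℝ) : ‖(!₂[x, y] : E 2)‖ ^ 2 = x ^ 2 + y ^ 2 := by
  simp [EuclideanSpace.norm_sq_eq, Fin.sum_univ_two]

lemma measurePreserving_planeEmb : MeasurePreserving planeEmb :=
  measurePreserving_line.prod (MeasurePreserving.id (volume : Measure ℝ))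

lemma measurePreserving_sliceEmb : MeasurePreserving sliceEmb := by
  have h1 : MeasurePreserving (fun z : (ℝ × ℝ) × ℝ => ((z.1.1, z.2), z.1.2)) := by
    have a := measurePreserving_prodAssoc (volume : Measure ℝ) (volume : Measure ℝ)
      (volume : Measure ℝ)
    have b := (MeasurePreserving.id (volume : Measure ℝ)).prod
      (Measure.measurePreserving_swap (μ := (volume : Measure ℝ)) (ν := (volume : Measure ℝ)))
    have c := (measurePreserving_prodAssoc (volume : Measure ℝ) (volume : Measure ℝ)
      (volume : Measure ℝ)).symm
    exact c.comp (b.comp a)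
  exact (measurePreserving_plane.prod (MeasurePreserving.id (volume : Measure ℝ))).comp h1

lemma measurable_planeEmb : Measurable planeEmb := measurePreserving_planeEmb.measurable

lemma measurable_sliceEmb : Measurable sliceEmb := measurePreserving_sliceEmb.measurable

/-- The substitution `x = μ sinh θ` makes the invariant measure of a hyperbola of mass `μ` Lebesgue
measure in the rapidity. -/
lemma lintegral_div_sqrt_eq {μ : ℝ} (hμ : 0 < μ) (G : ℝ → ℝ≥0∞) :
    ∫⁻ x, G x * ENNReal.ofReal (1 / Real.sqrt (μ ^ 2 + x ^ 2)) = ∫⁻ θ, G (μ * Real.sinh θ) := by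
  have himg : (fun θ => μ * Real.sinh θ) '' univ = univ := by
    rw [image_univ]
    refine Function.Surjective.range_eq fun x => ⟨Real.arsinh (x / μ), ?_⟩
    simp only [Real.sinh_arsinh]
    field_simp
  have h := lintegral_image_eq_lintegral_abs_deriv_mul (s := univ)
    (f := fun θ => μ * Real.sinh θ) (f' := fun θ => μ * Real.cosh θ) MeasurableSet.univ
    (fun x _ => ((Real.hasDerivAt_sinh x).const_mul μ).hasDerivWithinAt)
    (fun x _ y _ h => Real.sinh_injective (mul_left_cancel₀ hμ.ne' h))
    (fun x => G x * ENNReal.ofReal (1 / Real.sqrt (μ ^ 2 + x ^ 2)))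
  rw [himg] at h
  simp only [Measure.restrict_univ] at h
  rw [h]
  refine lintegral_congr fun θ => ?_
  have hc := Real.cosh_pos θ
  have e : μ ^ 2 + (μ * Real.sinh θ) ^ 2 = (μ * Real.cosh θ) ^ 2 := by
    have := Real.cosh_sq θ
    linear_combination (-μ ^ 2) * this
  rw [e, Real.sqrt_sq (by positivity), abs_of_pos (by positivity), mul_left_comm,
    ← ENNReal.ofReal_mul (by positivity), mul_one_div_cancel (by positivity)]
  simp

lemma lintegral_sigma_one {φ : Ambient 1 → ℝ≥0∞} (hφ : Measurable φ) :
    ∫⁻ z, φ z ∂(sigma 1) = ∫⁻ θ, φ (planeEmb (hypPolar 1 θ)) := by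
  have hb := measurable_bracket (d := 1)
  rw [lintegral_sigma hφ, ← measurePreserving_line.lintegral_comp (by fun_prop)]
  have e : ∀ x : ℝ, bracket (!₂[x] : E 1) = Real.sqrt (1 ^ 2 + x ^ 2) := fun x => by
    rw [bracket, norm_sq_line, one_pow]
  simp_rw [e]
  rw [lintegral_div_sqrt_eq one_pos (fun x => φ (!₂[x], Real.sqrt (1 ^ 2 + x ^ 2)))]
  refine lintegral_congr fun θ => ?_
  have := Real.cosh_sq θ
  have e2 : Real.sqrt (1 ^ 2 + (1 * Real.sinh θ) ^ 2) = Real.cosh θ := by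
    rw [show 1 ^ 2 + (1 * Real.sinh θ) ^ 2 = Real.cosh θ ^ 2 by rw [this]; ring]
    exact Real.sqrt_sq (Real.cosh_pos θ).le
  rw [e2]
  simp [planeEmb, hypPolar]

/-- At fixed second coordinate `v` the hyperboloid is a hyperbola of mass `√(1 + v²)`, so the planar
calculus of `hypPolar` applies slice by slice. -/
lemma lintegral_sigma_two {φ : Ambient 2 → ℝ≥0∞} (hφ : Measurable φ) :
    ∫⁻ z, φ z ∂(sigma 2) = ∫⁻ v, ∫⁻ θ, φ (sliceEmb (hypPolar (sliceMass v) θ, v)) := by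
  have hb := measurable_bracket (d := 2)
  have e : ∀ x : ℝ × ℝ, bracket (!₂[x.1, x.2] : E 2) = Real.sqrt (sliceMass x.2 ^ 2 + x.1 ^ 2) :=
    fun x => by
      rw [sliceMass_sq, bracket, norm_sq_plane]
      congr 1
      ring
  rw [lintegral_sigma hφ, ← measurePreserving_plane.lintegral_comp (by fun_prop)]
  simp_rw [e]
  have hs := measurable_sliceMass
  have hp := measurePreserving_plane.measurable
  rw [Measure.volume_eq_prod, lintegral_prod_symm' _ (by fun_prop)]
  refine lintegral_congr fun v => ?_
  rw [lintegral_div_sqrt_eq (sliceMass_pos v)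
    (fun x => φ (!₂[x, v], Real.sqrt (sliceMass v ^ 2 + x ^ 2)))]
  refine lintegral_congr fun θ => ?_
  have := Real.cosh_sq θ
  have e2 : Real.sqrt (sliceMass v ^ 2 + (sliceMass v * Real.sinh θ) ^ 2) =
      sliceMass v * Real.cosh θ := by
    rw [show sliceMass v ^ 2 + (sliceMass v * Real.sinh θ) ^ 2 = (sliceMass v * Real.cosh θ) ^ 2 by
      linear_combination (-sliceMass v ^ 2) * this]
    exact Real.sqrt_sq (mul_pos (sliceMass_pos v) (Real.cosh_pos θ)).le
  rw [e2]
  simp [sliceEmb, hypPolar]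

lemma mink_planeEmb_self (z : ℝ × ℝ) : mink (planeEmb z) (planeEmb z) = z.2 ^ 2 - z.1 ^ 2 := by
  rw [mink, real_inner_self_eq_norm_sq]
  simp only [planeEmb, norm_sq_line]
  ring

lemma mink_sliceEmb_self (z : (ℝ × ℝ) × ℝ) :
    mink (sliceEmb z) (sliceEmb z) = z.1.2 ^ 2 - z.1.1 ^ 2 - z.2 ^ 2 := by
  rw [mink, real_inner_self_eq_norm_sq]
  simp only [sliceEmb, norm_sq_plane]
  ring

theorem lintegral_sigma_one_triple_le {φ : Ambient 1 → ℝ≥0∞} (hφ : Measurable φ) :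
    ∫⁻ q : Ambient 1 × Ambient 1 × Ambient 1, φ (q.1 + q.2.1 + q.2.2)
        ∂((sigma 1).prod ((sigma 1).prod (sigma 1))) ≤
      ∫⁻ z, φ z * ENNReal.ofReal (2 * Real.pi / Real.sqrt (Real.sqrt (mink z z))) := by
  have hp := measurable_planeEmb
  have hm : Measurable fun z : Ambient 1 => mink z z := measurable_mink measurable_id measurable_id
  have hh : Measurable (hypPolar 1) := by unfold hypPolar; fun_prop
  rw [← measurePreserving_planeEmb.lintegral_comp (by fun_prop),
    lintegral_prod _ (by fun_prop)]
  simp_rw [mink_planeEmb_self]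
  refine le_trans (le_of_eq ?_) (lintegral_triple_hypPolar_le (φ := fun z => φ (planeEmb z))
    (by fun_prop))
  have h1 : ∀ x : Ambient 1, ∫⁻ q : Ambient 1 × Ambient 1, φ (x + q.1 + q.2)
      ∂((sigma 1).prod (sigma 1)) = ∫⁻ θ₂, ∫⁻ θ₃,
        φ (x + planeEmb (hypPolar 1 θ₂) + planeEmb (hypPolar 1 θ₃)) := by
    intro x
    rw [lintegral_prod _ (by fun_prop), lintegral_sigma_one]
    · refine lintegral_congr fun θ₂ => ?_
      exact lintegral_sigma_one (φ := fun z => φ (x + planeEmb (hypPolar 1 θ₂) + z)) (by fun_prop)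
    · exact Measurable.lintegral_prod_right' (ν := sigma 1)
        (f := fun q : Ambient 1 × Ambient 1 => φ (x + q.1 + q.2)) (by fun_prop)
  simp only [h1]
  rw [lintegral_sigma_one]
  · simp only [planeEmb_add]
  · refine Measurable.lintegral_prod_right' (f := fun q : Ambient 1 × ℝ => ∫⁻ θ₃,
      φ (q.1 + planeEmb (hypPolar 1 q.2) + planeEmb (hypPolar 1 θ₃))) ?_
    exact Measurable.lintegral_prod_right' (f := fun q : (Ambient 1 × ℝ) × ℝ =>
      φ (q.1.1 + planeEmb (hypPolar 1 q.1.2) + planeEmb (hypPolar 1 q.2))) (by fun_prop)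

theorem lintegral_sigma_two_pair_le {φ : Ambient 2 → ℝ≥0∞} (hφ : Measurable φ) :
    ∫⁻ q : Ambient 2 × Ambient 2, φ (q.1 + q.2) ∂((sigma 2).prod (sigma 2)) ≤
      ∫⁻ z, φ z * (if 0 < z.2 ∧ 4 ≤ mink z z then
        ENNReal.ofReal (2 * Real.pi / Real.sqrt (mink z z)) else 0) := by
  have hp := measurable_sliceEmb
  have hm : Measurable fun z : Ambient 2 => mink z z := measurable_mink measurable_id measurable_id
  have hh : Measurable fun q : ℝ × ℝ => hypPolar (sliceMass q.1) q.2 :=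
    measurable_hypPolar.comp ((measurable_sliceMass.comp measurable_fst).prodMk measurable_snd)
  have hw : Measurable fun z : Ambient 2 => (if 0 < z.2 ∧ 4 ≤ mink z z then
        ENNReal.ofReal (2 * Real.pi / Real.sqrt (mink z z)) else 0) :=
    Measurable.ite ((measurableSet_lt measurable_const measurable_snd).inter
      (measurableSet_le measurable_const hm)) (by fun_prop) measurable_const
  have hφw : Measurable fun z => φ z * (if 0 < z.2 ∧ 4 ≤ mink z z then
      ENNReal.ofReal (2 * Real.pi / Real.sqrt (mink z z)) else 0) := hφ.mul hw
  rw [← measurePreserving_sliceEmb.lintegral_comp hφw, lintegral_prod _ (by fun_prop)]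
  simp_rw [mink_sliceEmb_self]
  refine le_trans (le_of_eq ?_) (lintegral_pair_slice_le (φ := fun z => φ (sliceEmb z))
    (by fun_prop))
  have h1 : ∀ x : Ambient 2, ∫⁻ z, φ (x + z) ∂(sigma 2) =
      ∫⁻ v', ∫⁻ θ', φ (x + sliceEmb (hypPolar (sliceMass v') θ', v')) := fun x =>
    lintegral_sigma_two (φ := fun z => φ (x + z)) (by fun_prop)
  simp only [h1]
  have h2 : Measurable fun q : Ambient 2 × ℝ =>
      ∫⁻ θ', φ (q.1 + sliceEmb (hypPolar (sliceMass q.2) θ', q.2)) :=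
    Measurable.lintegral_prod_right' (f := fun r : (Ambient 2 × ℝ) × ℝ =>
      φ (r.1.1 + sliceEmb (hypPolar (sliceMass r.1.2) r.2, r.1.2))) (by
        have : Measurable fun r : (Ambient 2 × ℝ) × ℝ => hypPolar (sliceMass r.1.2) r.2 :=
          hh.comp (measurable_fst.snd.prodMk measurable_snd)
        fun_prop)
  rw [lintegral_sigma_two (Measurable.lintegral_prod_right' h2)]
  refine lintegral_congr fun v => ?_
  rw [lintegral_lintegral_swap]
  · refine lintegral_congr fun v' => lintegral_congr fun θ => lintegral_congr fun θ' => ?_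
    rw [← sliceEmb_add]
    rfl
  · refine Measurable.aemeasurable ?_
    have h3 : Measurable fun q : ℝ × ℝ => (sliceEmb (hypPolar (sliceMass v) q.1, v), q.2) := by
      have : Measurable fun q : ℝ × ℝ => hypPolar (sliceMass v) q.1 := by
        unfold hypPolar; fun_prop
      fun_prop
    exact h2.comp h3

/-! ### Summation of geometrically decaying interactions -/

lemma lintegral_rpow_finset_sum_le {X ι : Type*} [MeasurableSpace X] {μ : Measure X}
    {g : ι → X → ℝ≥0∞} (hg : ∀ i, Measurable (g i)) {r : ℝ} (hr : 1 ≤ r) (s : Finset ι) :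
    (∫⁻ x, (∑ i ∈ s, g i x) ^ r ∂μ) ^ (1 / r) ≤ ∑ i ∈ s, (∫⁻ x, g i x ^ r ∂μ) ^ (1 / r) := by
  classical
  have hr0 : 0 < r := by linarith
  induction s using Finset.induction_on with
  | empty => simp [hr0]
  | insert i s hi ih =>
    simp only [Finset.sum_insert hi]
    refine (ENNReal.lintegral_Lp_add_le (hg i).aemeasurable
      (Finset.measurable_sum s fun j _ => hg j).aemeasurable hr).trans ?_
    gcongr

/-- Minkowski's inequality for series. -/
lemma lintegral_rpow_tsum_le {X ι : Type*} [MeasurableSpace X] [Countable ι] {μ : Measure X}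
    {g : ι → X → ℝ≥0∞} (hg : ∀ i, Measurable (g i)) {r : ℝ} (hr : 1 ≤ r) :
    (∫⁻ x, (∑' i, g i x) ^ r ∂μ) ^ (1 / r) ≤ ∑' i, (∫⁻ x, g i x ^ r ∂μ) ^ (1 / r) := by
  have hr0 : 0 < r := by linarith
  have h1 : ∀ x, (∑' i, g i x) ^ r = ⨆ s : Finset ι, (∑ i ∈ s, g i x) ^ r := fun x => by
    rw [ENNReal.tsum_eq_iSup_sum]
    exact (ENNReal.orderIsoRpow r hr0).map_iSup _
  simp_rw [h1]
  rw [lintegral_iSup_directed]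
  · rw [show ∀ a : ℝ≥0∞, a ^ (1 / r) = ENNReal.orderIsoRpow (1 / r) (by positivity) a from
      fun a => rfl, OrderIso.map_iSup]
    refine iSup_le fun s => ?_
    exact (lintegral_rpow_finset_sum_le hg hr s).trans (ENNReal.sum_le_tsum s)
  · exact fun s => ((Finset.measurable_sum s fun j _ => hg j).pow_const r).aemeasurable
  · refine Monotone.directed_le fun s t hst x => ?_
    exact ENNReal.rpow_le_rpow (Finset.sum_le_sum_of_subset hst) hr0.le

lemma lintegral_mul_le_sqrt_mul_sqrt {X : Type*} [MeasurableSpace X] {μ : Measure X}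
    {f g : X → ℝ≥0∞} (hf : Measurable f) (hg : Measurable g) :
    ∫⁻ x, f x * g x ∂μ ≤ (∫⁻ x, f x ^ 2 ∂μ) ^ (1 / 2 : ℝ) * (∫⁻ x, g x ^ 2 ∂μ) ^ (1 / 2 : ℝ) := by
  have := ENNReal.lintegral_mul_le_Lp_mul_Lq μ Real.HolderConjugate.two_two hf.aemeasurable
    hg.aemeasurable
  simpa only [ENNReal.rpow_two, Pi.mul_apply] using this

lemma le_rpow_half_mul_rpow_half {x y z : ℝ≥0∞} (hy : x ≤ y) (hz : x ≤ z) :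
    x ≤ y ^ (1 / 2 : ℝ) * z ^ (1 / 2 : ℝ) := by
  calc x = x ^ (1 / 2 : ℝ) * x ^ (1 / 2 : ℝ) := by
        rw [← ENNReal.rpow_add_of_nonneg _ _ (by norm_num) (by norm_num)]; norm_num
    _ ≤ _ := by gcongr

/-- The geometric weight `e^{-c |j|}`. -/
def geomWeight (c : ℝ) (j : ℤ) : ℝ≥0∞ := ENNReal.ofReal (Real.exp (-c * |(j : ℝ)|))

lemma geomWeight_neg (c : ℝ) (j : ℤ) : geomWeight c (-j) = geomWeight c j := by
  simp [geomWeight]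

lemma geomWeight_le_one {c : ℝ} (hc : 0 ≤ c) (j : ℤ) : geomWeight c j ≤ 1 := by
  rw [geomWeight, ENNReal.ofReal_le_one, Real.exp_le_one_iff]
  nlinarith [abs_nonneg (j : ℝ)]

lemma geomWeight_rpow (c s : ℝ) (j : ℤ) : geomWeight c j ^ s = geomWeight (c * s) j := by
  rw [geomWeight, geomWeight, ENNReal.ofReal_rpow_of_pos (Real.exp_pos _), ← Real.exp_mul]
  ring_nf

lemma tsum_geomWeight_ne_top {c : ℝ} (hc : 0 < c) : ∑' j, geomWeight c j ≠ ∞ := by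
  have hs : Summable fun j : ℤ => Real.exp (-c * |(j : ℝ)|) := by
    have h1 : Summable fun n : ℕ => Real.exp (-c * n) := by
      have := Real.summable_exp_nat_mul_iff.2 (show -c < 0 by linarith)
      refine this.congr fun n => by rw [mul_comm]
    refine Summable.of_nat_of_neg ?_ ?_
    · simpa using h1
    · simpa using h1
  unfold geomWeight
  rw [← ENNReal.ofReal_tsum_of_nonneg (fun _ => (Real.exp_pos _).le) hs]
  exact ENNReal.ofReal_ne_top

/-- Schur's test for a convolution kernel on `ℤ`: `a k * a l ≤ a k ^ 2 + a l ^ 2`, and the weights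
sum to the same value along rows and columns. -/
lemma tsum_tsum_mul_le (w a : ℤ → ℝ≥0∞) :
    ∑' k, ∑' l, w (k - l) * (a k * a l) ≤ 2 * (∑' j, w j) * ∑' k, a k ^ 2 := by
  have h0 : ∀ x y : ℝ≥0∞, x * y ≤ x ^ 2 + y ^ 2 := fun x y => by
    rcases le_total x y with h | h
    · exact (mul_le_mul_left h y).trans (by rw [← sq]; exact le_add_self)
    · exact (mul_le_mul_right h x).trans (by rw [← sq]; exact le_self_add)
  have h1 : ∀ k : ℤ, ∑' l, w (k - l) = ∑' j, w j := fun k =>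
    (Equiv.subLeft k).tsum_eq w
  have h2 : ∀ l : ℤ, ∑' k, w (k - l) = ∑' j, w j := fun l =>
    (Equiv.subRight l).tsum_eq w
  calc ∑' k, ∑' l, w (k - l) * (a k * a l)
      ≤ ∑' k, ∑' l, (w (k - l) * a k ^ 2 + w (k - l) * a l ^ 2) := by
        refine ENNReal.tsum_le_tsum fun k => ENNReal.tsum_le_tsum fun l => ?_
        rw [← mul_add]
        gcongr
        exact h0 _ _
    _ = ∑' k, ∑' l, w (k - l) * a k ^ 2 + ∑' k, ∑' l, w (k - l) * a l ^ 2 := by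
        simp_rw [ENNReal.tsum_add]
    _ = _ := by
        rw [ENNReal.tsum_comm (f := fun k l => w (k - l) * a l ^ 2)]
        simp_rw [ENNReal.tsum_mul_right, h1, h2, ENNReal.tsum_mul_left]
        ring

/-- The weights link `l` to `k`, `n` to `m` and `k` to `m`. Summing over `l` and `n` costs one
supremum each; Schur's test in `k, m` uses the other two factors for the `ℓ²` sum. -/
lemma tsum_quadruple_le (w a : ℤ → ℝ≥0∞) :
    ∑' q : (ℤ × ℤ) × (ℤ × ℤ), w (q.1.1 - q.1.2) * w (q.2.1 - q.2.2) * w (q.1.1 - q.2.1) *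
        (a q.1.1 * a q.1.2 * (a q.2.1 * a q.2.2)) ≤
      2 * (∑' j, w j) ^ 3 * (⨆ k, a k) ^ 2 * ∑' k, a k ^ 2 := by
  set M := ∑' j, w j
  set A := ⨆ k, a k
  have h1 : ∀ k : ℤ, ∑' l, w (k - l) * a l ≤ M * A := fun k => by
    have e : ∑' l, w (k - l) = M := (Equiv.subLeft k).tsum_eq w
    rw [← e, ← ENNReal.tsum_mul_right]
    exact ENNReal.tsum_le_tsum fun l => mul_le_mul_right (le_iSup a l) _
  calc _ = ∑' k, ∑' m, w (k - m) * (a k * a m) *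
        ((∑' l, w (k - l) * a l) * ∑' n, w (m - n) * a n) := by
        rw [ENNReal.tsum_prod', ENNReal.tsum_prod']
        refine tsum_congr fun k => ?_
        have : ∀ l : ℤ, ∑' q : ℤ × ℤ, w (k - l) * w (q.1 - q.2) * w (k - q.1) *
            (a k * a l * (a q.1 * a q.2)) = ∑' m, w (k - l) * a l * (w (k - m) * (a k * a m) *
              ∑' n, w (m - n) * a n) := fun l => by
          rw [ENNReal.tsum_prod']
          refine tsum_congr fun m => ?_
          rw [← ENNReal.tsum_mul_left, ← ENNReal.tsum_mul_left]
          refine tsum_congr fun n => ?_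
          ring
        simp only [this]
        simp_rw [ENNReal.tsum_mul_left]
        rw [ENNReal.tsum_mul_right, ← ENNReal.tsum_mul_left]
        refine tsum_congr fun m => ?_
        ring
    _ ≤ ∑' k, ∑' m, w (k - m) * (a k * a m) * ((M * A) * (M * A)) := by
        refine ENNReal.tsum_le_tsum fun k => ENNReal.tsum_le_tsum fun m => ?_
        gcongr
        · exact h1 k
        · exact h1 m
    _ ≤ (2 * M * ∑' k, a k ^ 2) * ((M * A) * (M * A)) := by
        simp_rw [ENNReal.tsum_mul_right]
        gcongr
        exact tsum_tsum_mul_le w a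
    _ = _ := by ring

lemma tsum_quadruple_eq (a : ℤ → ℝ≥0∞) :
    ∑' q : (ℤ × ℤ) × (ℤ × ℤ), a q.1.1 * a q.1.2 * (a q.2.1 * a q.2.2) = (∑' k, a k) ^ 4 := by
  have h2 : ∑' q : ℤ × ℤ, a q.1 * a q.2 = (∑' k, a k) * ∑' k, a k := by
    rw [ENNReal.tsum_prod']
    simp only [ENNReal.tsum_mul_left, ENNReal.tsum_mul_right]
  rw [ENNReal.tsum_prod' (f := fun q : (ℤ × ℤ) × (ℤ × ℤ) =>
    a q.1.1 * a q.1.2 * (a q.2.1 * a q.2.2))]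
  simp only [ENNReal.tsum_mul_left, ENNReal.tsum_mul_right, h2]
  ring

section Summation

variable {X : Type*} [MeasurableSpace X] {μ : Measure X} {u : ℤ → X → ℝ≥0∞} {a : ℤ → ℝ≥0∞}
  {C : ℝ≥0∞} {c p : ℝ}

/-- The cube of `u k * u l` is `(u k ^ 2 * u l) * (u l ^ 2 * u k)`, so Cauchy–Schwarz reduces it to
the hypothesis for `(k, l)` and `(l, k)`. The remaining power `p / 2 - 3 ≥ 0` is absorbed by the
pointwise bound. -/
lemma lintegral_pair_rpow_le (hu : ∀ k, Measurable (u k)) (hua : ∀ k x, u k x ≤ a k)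
    (h : ∀ k l, ∫⁻ x, u k x ^ 4 * u l x ^ 2 ∂μ ≤ C * geomWeight c (k - l) * (a k ^ 4 * a l ^ 2))
    (hp : 6 ≤ p) (k l : ℤ) :
    ∫⁻ x, (u k x * u l x) ^ (p / 2) ∂μ ≤ C * geomWeight c (k - l) * (a k * a l) ^ (p / 2) := by
  have h3 : ∫⁻ x, (u k x * u l x) ^ (3 : ℝ) ∂μ ≤ C * geomWeight c (k - l) * (a k * a l) ^ (3 : ℝ) := by
    have e1 : ∀ x, (u k x * u l x) ^ (3 : ℝ) = (u k x ^ 2 * u l x) * (u l x ^ 2 * u k x) := by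
      intro x
      rw [show (3 : ℝ) = ((3 : ℕ) : ℝ) by norm_num, ENNReal.rpow_natCast]
      ring
    simp_rw [e1]
    refine (lintegral_mul_le_sqrt_mul_sqrt (by have := hu k; have := hu l; fun_prop)
      (by have := hu k; have := hu l; fun_prop)).trans ?_
    have e2 : ∀ k l x, (u k x ^ 2 * u l x) ^ 2 = u k x ^ 4 * u l x ^ 2 := fun k l x => by ring
    simp_rw [e2]
    have e3 : geomWeight c (l - k) = geomWeight c (k - l) := by
      rw [← geomWeight_neg, neg_sub]
    have h1 := h k l
    have h2 := h l k
    rw [e3] at h2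
    calc _ ≤ (C * geomWeight c (k - l) * (a k ^ 4 * a l ^ 2)) ^ (1 / 2 : ℝ) *
          (C * geomWeight c (k - l) * (a l ^ 4 * a k ^ 2)) ^ (1 / 2 : ℝ) := by gcongr
      _ = ((C * geomWeight c (k - l) * (a k * a l) ^ (3 : ℝ)) ^ 2) ^ (1 / 2 : ℝ) := by
          rw [← ENNReal.mul_rpow_of_nonneg _ _ (by norm_num)]
          congr 1
          rw [show (3 : ℝ) = ((3 : ℕ) : ℝ) by norm_num, ENNReal.rpow_natCast]
          ring
      _ = _ := by
          rw [← ENNReal.rpow_two, ← ENNReal.rpow_mul]; norm_num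
  have hp3 : 0 ≤ p / 2 - 3 := by linarith
  have e : ∀ y : ℝ≥0∞, y ^ (p / 2) = y ^ (3 : ℝ) * y ^ (p / 2 - 3) := fun y => by
    rw [← ENNReal.rpow_add_of_nonneg _ _ (by norm_num) hp3]; ring_nf
  calc ∫⁻ x, (u k x * u l x) ^ (p / 2) ∂μ
      ≤ ∫⁻ x, (u k x * u l x) ^ (3 : ℝ) * (a k * a l) ^ (p / 2 - 3) ∂μ := by
        refine lintegral_mono fun x => ?_
        rw [e]
        gcongr
        · exact hua k x
        · exact hua l x
    _ = (∫⁻ x, (u k x * u l x) ^ (3 : ℝ) ∂μ) * (a k * a l) ^ (p / 2 - 3) :=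
        lintegral_mul_const _ (by have := hu k; have := hu l; fun_prop)
    _ ≤ _ := by
        rw [e (a k * a l), ← mul_assoc]
        gcongr

/-- Pairing the factors as `(k, l), (m, n)` yields decay in `k - l` and `m - n`; pairing them as
`(k, m), (l, n)` yields decay in `k - m`. The geometric mean of the two bounds has all three decays,
and the weight in `l - n` is discarded. -/
lemma lintegral_quadruple_rpow_le (hu : ∀ k, Measurable (u k)) (hua : ∀ k x, u k x ≤ a k)
    (h : ∀ k l, ∫⁻ x, u k x ^ 4 * u l x ^ 2 ∂μ ≤ C * geomWeight c (k - l) * (a k ^ 4 * a l ^ 2))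
    (hc : 0 ≤ c) (hp : 6 ≤ p) (k l m n : ℤ) :
    (∫⁻ x, (u k x * u l x * (u m x * u n x)) ^ (p / 4) ∂μ) ^ (1 / (p / 4)) ≤
      C ^ (4 / p) * (geomWeight (c / p) (k - l) * geomWeight (c / p) (m - n) *
        geomWeight (c / p) (k - m) * (a k * a l * (a m * a n))) := by
  have hp0 : 0 < p := by linarith
  have key : ∀ k l m n : ℤ, ∫⁻ x, (u k x * u l x * (u m x * u n x)) ^ (p / 4) ∂μ ≤
      C * (geomWeight (c / 2) (k - l) * geomWeight (c / 2) (m - n)) *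
        (a k * a l * (a m * a n)) ^ (p / 4) := by
    intro k l m n
    have e1 : ∀ x, (u k x * u l x * (u m x * u n x)) ^ (p / 4) =
        (u k x * u l x) ^ (p / 4) * (u m x * u n x) ^ (p / 4) := fun x =>
      ENNReal.mul_rpow_of_nonneg _ _ (by positivity)
    simp_rw [e1]
    refine (lintegral_mul_le_sqrt_mul_sqrt (by have := hu k; have := hu l; fun_prop)
      (by have := hu m; have := hu n; fun_prop)).trans ?_
    have e2 : ∀ y : ℝ≥0∞, (y ^ (p / 4)) ^ 2 = y ^ (p / 2) := fun y => by
      rw [← ENNReal.rpow_two, ← ENNReal.rpow_mul]; ring_nf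
    simp_rw [e2]
    have h1 := lintegral_pair_rpow_le hu hua h hp k l
    have h2 := lintegral_pair_rpow_le hu hua h hp m n
    calc _ ≤ (C * geomWeight c (k - l) * (a k * a l) ^ (p / 2)) ^ (1 / 2 : ℝ) *
          (C * geomWeight c (m - n) * (a m * a n) ^ (p / 2)) ^ (1 / 2 : ℝ) := by gcongr
      _ = (C ^ (1 / 2 : ℝ) * C ^ (1 / 2 : ℝ)) * (geomWeight (c / 2) (k - l) *
          geomWeight (c / 2) (m - n)) * (a k * a l * (a m * a n)) ^ (p / 4) := by
          have e3 : ∀ y : ℝ≥0∞, (y ^ (p / 2)) ^ (1 / 2 : ℝ) = y ^ (p / 4) := fun y => by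
            rw [← ENNReal.rpow_mul]; ring_nf
          have hh : (0 : ℝ) ≤ 1 / 2 := by norm_num
          simp only [ENNReal.mul_rpow_of_nonneg _ _ hh, e3, geomWeight_rpow,
            ENNReal.mul_rpow_of_nonneg (a k * a l) (a m * a n) (show 0 ≤ p / 4 by positivity)]
          ring_nf
      _ = _ := by
          rw [← ENNReal.rpow_add_of_nonneg _ _ (by norm_num) (by norm_num)]; norm_num
  have h1 := key k l m n
  have h2 := key k m l n
  have e3 : ∀ x, u k x * u m x * (u l x * u n x) = u k x * u l x * (u m x * u n x) := fun x => by
    ring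
  have e4 : a k * a m * (a l * a n) = a k * a l * (a m * a n) := by ring
  simp_rw [e3] at h2
  rw [e4] at h2
  have h3 : ∫⁻ x, (u k x * u l x * (u m x * u n x)) ^ (p / 4) ∂μ ≤
      C * (geomWeight (c / 4) (k - l) * geomWeight (c / 4) (m - n) * geomWeight (c / 4) (k - m)) *
        (a k * a l * (a m * a n)) ^ (p / 4) := by
    refine (le_rpow_half_mul_rpow_half h1 h2).trans ?_
    have hh : (0 : ℝ) ≤ 1 / 2 := by norm_num
    simp only [ENNReal.mul_rpow_of_nonneg _ _ hh, geomWeight_rpow]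
    have e5 : c / 2 * (1 / 2) = c / 4 := by ring
    rw [e5]
    have e6 : ∀ y : ℝ≥0∞, y ^ (1 / 2 : ℝ) * y ^ (1 / 2 : ℝ) = y := fun y => by
      rw [← ENNReal.rpow_add_of_nonneg _ _ hh hh]; norm_num
    calc _ = (C ^ (1 / 2 : ℝ) * C ^ (1 / 2 : ℝ)) * (geomWeight (c / 4) (k - l) *
          geomWeight (c / 4) (m - n) * geomWeight (c / 4) (k - m)) *
          (((a k * a l * (a m * a n)) ^ (p / 4)) ^ (1 / 2 : ℝ) *
          ((a k * a l * (a m * a n)) ^ (p / 4)) ^ (1 / 2 : ℝ)) * geomWeight (c / 4) (l - n) := by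
          ring
      _ ≤ _ := by
          rw [e6, e6]
          exact mul_le_of_le_one_right' (geomWeight_le_one (by positivity) _)
  have hq : (0 : ℝ) ≤ 1 / (p / 4) := by positivity
  refine (ENNReal.rpow_le_rpow h3 hq).trans_eq ?_
  simp only [ENNReal.mul_rpow_of_nonneg _ _ hq, geomWeight_rpow, ← ENNReal.rpow_mul]
  have e7 : c / 4 * (4 / p) = c / p := by field_simp
  have e8 : p / 4 * (4 / p) = 1 := by field_simp
  have e9 : 1 / (p / 4) = 4 / p := by field_simp
  simp only [e7, e8, e9, ENNReal.rpow_one, mul_assoc]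

/-- Almost orthogonality: geometrically decaying interactions give an `ℓ²` bound which gains a
power of the largest piece. -/
theorem lintegral_tsum_rpow_le (hu : ∀ k, Measurable (u k)) (hua : ∀ k x, u k x ≤ a k)
    (h : ∀ k l, ∫⁻ x, u k x ^ 4 * u l x ^ 2 ∂μ ≤ C * geomWeight c (k - l) * (a k ^ 4 * a l ^ 2))
    (hc : 0 ≤ c) (hp : 6 ≤ p) :
    (∫⁻ x, (∑' k, u k x) ^ p ∂μ) ^ (4 / p) ≤
      C ^ (4 / p) * (2 * (∑' j, geomWeight (c / p) j) ^ 3 * (⨆ k, a k) ^ 2 * ∑' k, a k ^ 2) := by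
  have hp0 : 0 < p := by linarith
  -- The fourth power of the sum is a quadruple series, to which Minkowski's inequality in `L^{p/4}`
  -- applies because `p / 4 ≥ 1`.
  have e1 : ∀ x, (∑' k, u k x) ^ p = (∑' q : (ℤ × ℤ) × (ℤ × ℤ),
      u q.1.1 x * u q.1.2 x * (u q.2.1 x * u q.2.2 x)) ^ (p / 4) := by
    intro x
    rw [tsum_quadruple_eq (fun k => u k x), ← ENNReal.rpow_natCast, ← ENNReal.rpow_mul]
    congr 1
    push_cast
    ring
  set g : (ℤ × ℤ) × (ℤ × ℤ) → X → ℝ≥0∞ := fun q x =>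
    u q.1.1 x * u q.1.2 x * (u q.2.1 x * u q.2.2 x) with hg
  have hgm : ∀ q, Measurable (g q) := fun q =>
    ((hu q.1.1).mul (hu q.1.2)).mul ((hu q.2.1).mul (hu q.2.2))
  have e2 : 4 / p = 1 / (p / 4) := by field_simp
  calc (∫⁻ x, (∑' k, u k x) ^ p ∂μ) ^ (4 / p)
      = (∫⁻ x, (∑' q, g q x) ^ (p / 4) ∂μ) ^ (1 / (p / 4)) := by
        rw [e2, lintegral_congr e1]
    _ ≤ ∑' q, (∫⁻ x, g q x ^ (p / 4) ∂μ) ^ (1 / (p / 4)) :=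
        lintegral_rpow_tsum_le hgm (by linarith)
    _ ≤ ∑' q : (ℤ × ℤ) × (ℤ × ℤ), C ^ (4 / p) * (geomWeight (c / p) (q.1.1 - q.1.2) *
          geomWeight (c / p) (q.2.1 - q.2.2) * geomWeight (c / p) (q.1.1 - q.2.1) *
          (a q.1.1 * a q.1.2 * (a q.2.1 * a q.2.2))) :=
        ENNReal.tsum_le_tsum fun q =>
          lintegral_quadruple_rpow_le hu hua h hc hp q.1.1 q.1.2 q.2.1 q.2.2
    _ ≤ _ := by
        rw [ENNReal.tsum_mul_left]
        exact mul_le_mul_right (tsum_quadruple_le (geomWeight (c / p)) a) _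

end Summation

/-! ### The refined Strichartz estimate for `d = 1` -/

lemma extensionIntegral_eq {d : ℕ} (f : Ambient d → ℂ) (w : Ambient d) :
    extensionIntegral f w = ∫ z, character w z * f z ∂(sigma d) := rfl

lemma stronglyMeasurable_extensionIntegral {d : ℕ} {f : Ambient d → ℂ} (hf : Measurable f) :
    StronglyMeasurable (extensionIntegral f) := by
  have hmeas : Measurable fun q : Ambient d × Ambient d => character q.1 q.2 * f q.2 :=
    (measurable_character measurable_fst measurable_snd).mul (hf.comp measurable_snd)
  exact hmeas.stronglyMeasurable.integral_prod_right' (ν := sigma d)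

lemma extensionIntegral_mul {d : ℕ} (f g : Ambient d → ℂ) (w : Ambient d) :
    extensionIntegral f w * extensionIntegral g w =
      ∫ q : Ambient d × Ambient d, character w (q.1 + q.2) * (f q.1 * g q.2)
        ∂((sigma d).prod (sigma d)) := by
  rw [extensionIntegral_eq, extensionIntegral_eq, ← integral_prod_mul]
  refine integral_congr_ae ?_
  filter_upwards with q
  rw [character_add]
  ring

lemma extensionIntegral_mul_mul {d : ℕ} (f g h : Ambient d → ℂ) (w : Ambient d) :
    extensionIntegral f w * (extensionIntegral g w * extensionIntegral h w) =
      ∫ q : Ambient d × Ambient d × Ambient d, character w (q.1 + q.2.1 + q.2.2) *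
        (f q.1 * (g q.2.1 * h q.2.2)) ∂((sigma d).prod ((sigma d).prod (sigma d))) := by
  rw [extensionIntegral_mul, extensionIntegral_eq, ← integral_prod_mul]
  refine integral_congr_ae ?_
  filter_upwards with q
  simp only [add_assoc, character_add]
  ring

lemma eLpNorm_two_sq {X : Type*} [MeasurableSpace X] (μ : Measure X) (f : X → ℂ) :
    eLpNorm f 2 μ ^ 2 = ∫⁻ x, ‖f x‖ₑ ^ 2 ∂μ := by
  have := eLpNorm_nnreal_pow_eq_lintegral (μ := μ) (f := f) (p := 2) two_ne_zero
  simpa only [NNReal.coe_ofNat, ENNReal.rpow_two, ENNReal.coe_ofNat] using this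

lemma lintegral_enorm_sq_triple_one_le {f g h : Ambient 1 → ℂ} (hf : Measurable f)
    (hg : Measurable g) (hh : Measurable h) (hfi : Integrable f (sigma 1))
    (hgi : Integrable g (sigma 1)) (hhi : Integrable h (sigma 1)) :
    ∫⁻ w, ‖extensionIntegral f w * (extensionIntegral g w * extensionIntegral h w)‖ₑ ^ 2 ≤
      2 * 1 * ENNReal.ofReal ((2 * Real.pi) ^ (1 + 1)) *
        ∫⁻ q : Ambient 1 × Ambient 1 × Ambient 1, ‖f q.1 * (g q.2.1 * h q.2.2)‖ₑ ^ 2 *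
          ENNReal.ofReal (2 * Real.pi / Real.sqrt (Real.sqrt
            (mink (q.1 + q.2.1 + q.2.2) (q.1 + q.2.1 + q.2.2))))
          ∂((sigma 1).prod ((sigma 1).prod (sigma 1))) := by
  simp_rw [extensionIntegral_mul_mul]
  have hm : Measurable fun z : Ambient 1 => mink z z := measurable_mink measurable_id measurable_id
  have hS : Measurable fun q : Ambient 1 × Ambient 1 × Ambient 1 => q.1 + q.2.1 + q.2.2 := by
    fun_prop
  refine lintegral_enorm_sq_le _ hS (h := fun q => f q.1 * (g q.2.1 * h q.2.2)) (by fun_prop)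
    (hfi.mul_prod (hgi.mul_prod hhi))
    (ω := fun z => ENNReal.ofReal (2 * Real.pi / Real.sqrt (Real.sqrt (mink z z))))
    (by fun_prop) ?_ (C := 1) (fun φ hφ => by
      rw [one_mul]; exact lintegral_sigma_one_triple_le hφ)
  have h1 := (Measure.quasiMeasurePreserving_fst (μ := sigma 1)
    (ν := (sigma 1).prod (sigma 1))).ae ae_mem_hyperboloid
  have h2 := (Measure.quasiMeasurePreserving_snd (μ := sigma 1)
    (ν := (sigma 1).prod (sigma 1))).ae (Measure.quasiMeasurePreserving_fst.ae ae_mem_hyperboloid)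
  have h3 := (Measure.quasiMeasurePreserving_snd (μ := sigma 1)
    (ν := (sigma 1).prod (sigma 1))).ae (Measure.quasiMeasurePreserving_snd.ae ae_mem_hyperboloid)
  filter_upwards [h1, h2, h3] with q a b c
  refine ⟨?_, ENNReal.ofReal_ne_top⟩
  have e1 := one_le_mink a b
  have e2 := one_le_mink a c
  have e3 := one_le_mink b c
  have e4 := mink_self_eq_one a
  have e5 := mink_self_eq_one b
  have e6 := mink_self_eq_one c
  have : 0 < mink (q.1 + q.2.1 + q.2.2) (q.1 + q.2.1 + q.2.2) := by
    simp only [mink_add_left, mink_add_right, mink_comm q.2.1 q.1, mink_comm q.2.2 q.1,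
      mink_comm q.2.2 q.2.1]
    linarith
  have := Real.sqrt_pos.2 (Real.sqrt_pos.2 this)
  simp only [ne_eq, ENNReal.ofReal_eq_zero, not_le]
  positivity

lemma planeEmb_hypPolar_mem_hyperboloid (θ : ℝ) : planeEmb (hypPolar 1 θ) ∈ hyperboloid 1 := by
  refine mem_hyperboloid_of_mink ?_ ?_
  · rw [mink_planeEmb_self]
    have := Real.cosh_sq θ
    simp only [hypPolar]
    linear_combination this
  · simpa [planeEmb, hypPolar] using Real.cosh_pos θ

lemma planeEmb_hypPolar_mem_cap {θ : ℝ} {k : ℤ} :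
    planeEmb (hypPolar 1 θ) ∈ cap k ↔ θ ∈ Ico ((k : ℝ) - 1 / 2) ((k : ℝ) + 1 / 2) := by
  have : (planeEmb (hypPolar 1 θ)).1 0 = Real.sinh θ := by simp [planeEmb, hypPolar]
  change _ ∧ _ ≤ _ ∧ _ < _ ↔ _
  rw [this, Real.sinh_le_sinh, Real.sinh_lt_sinh]
  exact ⟨fun h => h.2, fun h => ⟨planeEmb_hypPolar_mem_hyperboloid θ, h⟩⟩

lemma exists_eq_planeEmb_hypPolar {z : Ambient 1} (hz : z ∈ hyperboloid 1) :
    ∃ θ, z = planeEmb (hypPolar 1 θ) := by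
  refine ⟨Real.arsinh (z.1 0), ?_⟩
  have h1 : z.1 = (!₂[z.1 0] : E 1) := by
    ext i; fin_cases i; simp
  have h2 : z.2 = bracket z.1 := hz
  refine Prod.ext ?_ ?_
  · simp only [planeEmb, hypPolar, Real.sinh_arsinh, one_mul]
    exact h1
  · simp only [planeEmb, hypPolar, Real.cosh_arsinh, one_mul]
    rw [h2, bracket]
    congr 2
    conv_lhs => rw [h1]
    exact norm_sq_line _

lemma measurableSet_cap (k : ℤ) : MeasurableSet (cap k) := by
  have h : Measurable fun z : Ambient 1 => z.1 0 := by fun_prop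
  exact measurableSet_hyperboloid.inter ((measurableSet_le measurable_const h).inter
    (measurableSet_lt h measurable_const))

lemma pairwise_disjoint_cap : Pairwise (Function.onFun Disjoint cap) := by
  intro k l hkl
  refine Set.disjoint_left.2 fun z hk hl => hkl ?_
  obtain ⟨θ, rfl⟩ := exists_eq_planeEmb_hypPolar hk.1
  rw [planeEmb_hypPolar_mem_cap] at hk hl
  have h1 : (k : ℝ) < l + 1 := by linarith [hk.1, hl.2]
  have h2 : (l : ℝ) < k + 1 := by linarith [hl.1, hk.2]
  norm_cast at h1 h2
  omega

lemma iUnion_cap : ⋃ k, cap k = hyperboloid 1 := by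
  refine subset_antisymm (iUnion_subset fun k z hz => hz.1) fun z hz => ?_
  obtain ⟨θ, rfl⟩ := exists_eq_planeEmb_hypPolar hz
  refine mem_iUnion.2 ⟨⌊θ + 1 / 2⌋, planeEmb_hypPolar_mem_cap.2 ⟨?_, ?_⟩⟩
  · linarith [Int.floor_le (θ + 1 / 2)]
  · linarith [Int.lt_floor_add_one (θ + 1 / 2)]

lemma sigma_cap_le (k : ℤ) : sigma 1 (cap k) ≤ 1 := by
  rw [← lintegral_indicator_one (measurableSet_cap k),
    lintegral_sigma_one (measurable_one.indicator (measurableSet_cap k))]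
  have : ∀ θ, (cap k).indicator (1 : Ambient 1 → ℝ≥0∞) (planeEmb (hypPolar 1 θ)) =
      (Ico ((k : ℝ) - 1 / 2) ((k : ℝ) + 1 / 2)).indicator 1 θ := fun θ => by
    by_cases h : θ ∈ Ico ((k : ℝ) - 1 / 2) ((k : ℝ) + 1 / 2)
    · rw [indicator_of_mem h, indicator_of_mem (planeEmb_hypPolar_mem_cap.2 h)]; rfl
    · rw [indicator_of_notMem h, indicator_of_notMem (mt planeEmb_hypPolar_mem_cap.1 h)]
  simp_rw [this]
  rw [lintegral_indicator_one measurableSet_Ico, Real.volume_Ico]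
  rw [show (k : ℝ) + 1 / 2 - (k - 1 / 2) = 1 by ring, ENNReal.ofReal_one]

/-- The product is `cosh (θ - θ')`. Since caps are unit intervals of rapidity, `|θ - θ'| ≥ |k - l| -
1`. -/
lemma exp_le_two_mul_mink {k l : ℤ} {z w : Ambient 1} (hz : z ∈ cap k) (hw : w ∈ cap l) :
    Real.exp (|((k - l : ℤ) : ℝ)| - 1) ≤ 2 * mink z w := by
  obtain ⟨θ, rfl⟩ := exists_eq_planeEmb_hypPolar hz.1
  obtain ⟨θ', rfl⟩ := exists_eq_planeEmb_hypPolar hw.1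
  rw [planeEmb_hypPolar_mem_cap] at hz hw
  have e : mink (planeEmb (hypPolar 1 θ)) (planeEmb (hypPolar 1 θ')) = Real.cosh (θ - θ') := by
    simp only [mink, planeEmb, hypPolar, PiLp.inner_apply, Real.cosh_sub]
    simp
    ring
  have h1 : |((k - l : ℤ) : ℝ)| - 1 ≤ |θ - θ'| := by
    push_cast
    rcases abs_cases ((k : ℝ) - l) with h | h
    · rw [h.1]; refine le_trans ?_ (le_abs_self _); linarith [hz.1, hw.2]
    · rw [h.1]; refine le_trans ?_ (neg_le_abs _); linarith [hz.2, hw.1]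
  rw [e, ← Real.cosh_abs, Real.cosh_eq]
  have := Real.exp_pos (-|θ - θ'|)
  have := Real.exp_le_exp.2 h1
  linarith

/-- The squared length of the sum contains `2 ⟨x, z⟩ ≥ e^{|k-l|-1}` and otherwise only positive
terms. The weight involves the fourth root of the squared length, hence the decay rate `1/4`. -/
lemma tripleWeight_le {k l : ℤ} {x y z : Ambient 1} (hx : x ∈ cap k) (hy : y ∈ hyperboloid 1)
    (hz : z ∈ cap l) :
    ENNReal.ofReal (2 * Real.pi / Real.sqrt (Real.sqrt (mink (x + y + z) (x + y + z)))) ≤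
      ENNReal.ofReal (2 * Real.pi * Real.exp (1 / 4)) * geomWeight (1 / 4) (k - l) := by
  rw [geomWeight, ← ENNReal.ofReal_mul (by positivity)]
  refine ENNReal.ofReal_le_ofReal ?_
  have e1 := one_le_mink hx.1 hy
  have e2 := exp_le_two_mul_mink hx hz
  have e3 := one_le_mink hy hz.1
  have e4 := mink_self_eq_one hx.1
  have e5 := mink_self_eq_one hy
  have e6 := mink_self_eq_one hz.1
  have h1 : Real.exp (|((k - l : ℤ) : ℝ)| - 1) ≤ mink (x + y + z) (x + y + z) := by
    simp only [mink_add_left, mink_add_right, mink_comm y x, mink_comm z x, mink_comm z y]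
    linarith
  have h2 : Real.exp ((|((k - l : ℤ) : ℝ)| - 1) / 4) ≤
      Real.sqrt (Real.sqrt (mink (x + y + z) (x + y + z))) := by
    refine Real.le_sqrt_of_sq_le (Real.le_sqrt_of_sq_le (le_trans (le_of_eq ?_) h1))
    rw [← pow_mul, ← Real.exp_nat_mul]
    congr 1
    push_cast
    ring
  calc 2 * Real.pi / Real.sqrt (Real.sqrt (mink (x + y + z) (x + y + z)))
      ≤ 2 * Real.pi / Real.exp ((|((k - l : ℤ) : ℝ)| - 1) / 4) := by gcongr
    _ = 2 * Real.pi * Real.exp (1 / 4) * Real.exp (-(1 / 4) * |((k - l : ℤ) : ℝ)|) := by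
        rw [div_eq_mul_inv, ← Real.exp_neg, mul_assoc (2 * Real.pi), ← Real.exp_add]
        congr 2
        ring

/-- The constant of the trilinear interaction estimate for caps. -/
def capConstant : ℝ≥0∞ := 2 * 1 * ENNReal.ofReal ((2 * Real.pi) ^ (1 + 1)) *
  ENNReal.ofReal (2 * Real.pi * Real.exp (1 / 4))

lemma capConstant_ne_top : capConstant ≠ ∞ := by
  unfold capConstant
  finiteness

/-- The trilinear estimate with two copies of the piece on `C_k` and one on `C_l`; the kernel is
bounded uniformly on the support by the decaying weight. -/
lemma lintegral_cap_interaction_le {f : Ambient 1 → ℂ} (hf : Measurable f)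
    (hfi : Integrable f (sigma 1)) (k l : ℤ) :
    ∫⁻ w, ‖extensionIntegral ((cap k).indicator f) w‖ₑ ^ 4 *
        ‖extensionIntegral ((cap l).indicator f) w‖ₑ ^ 2 ≤
      capConstant * geomWeight (1 / 4) (k - l) *
        (capNorm f (cap k) ^ 4 * capNorm f (cap l) ^ 2) := by
  have hm : ∀ k, Measurable ((cap k).indicator f) := fun k => hf.indicator (measurableSet_cap k)
  have hi : ∀ k, Integrable ((cap k).indicator f) (sigma 1) := fun k =>
    hfi.indicator (measurableSet_cap k)
  have hsq : ∀ k, ∫⁻ z, ‖(cap k).indicator f z‖ₑ ^ 2 ∂(sigma 1) = capNorm f (cap k) ^ 2 := by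
    intro k
    rw [capNorm, eLpNorm_two_sq, ← lintegral_indicator (measurableSet_cap k)]
    refine lintegral_congr fun z => ?_
    by_cases hz : z ∈ cap k <;> simp [hz]
  have h1 := lintegral_enorm_sq_triple_one_le (hm k) (hm k) (hm l) (hi k) (hi k) (hi l)
  calc _ = ∫⁻ w, ‖extensionIntegral ((cap k).indicator f) w *
        (extensionIntegral ((cap k).indicator f) w *
          extensionIntegral ((cap l).indicator f) w)‖ₑ ^ 2 := by
        refine lintegral_congr fun w => ?_
        simp only [enorm_mul]
        ring
    _ ≤ _ := h1
    _ ≤ 2 * 1 * ENNReal.ofReal ((2 * Real.pi) ^ (1 + 1)) *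
        ∫⁻ q : Ambient 1 × Ambient 1 × Ambient 1,
          ENNReal.ofReal (2 * Real.pi * Real.exp (1 / 4)) * geomWeight (1 / 4) (k - l) *
          (‖(cap k).indicator f q.1‖ₑ ^ 2 * (‖(cap k).indicator f q.2.1‖ₑ ^ 2 *
            ‖(cap l).indicator f q.2.2‖ₑ ^ 2)) ∂((sigma 1).prod ((sigma 1).prod (sigma 1))) := by
        refine mul_le_mul_right (lintegral_mono fun q => ?_) _
        by_cases hk : q.1 ∈ cap k
        swap; · simp [hk]
        by_cases hk2 : q.2.1 ∈ cap k
        swap; · simp [hk2]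
        by_cases hl : q.2.2 ∈ cap l
        swap; · simp [hl]
        rw [enorm_mul, enorm_mul, mul_pow, mul_pow, mul_comm]
        exact mul_le_mul_left (tripleWeight_le hk hk2.1 hl) _
    _ = _ := by
        have hme : ∀ k, AEMeasurable (fun z => ‖(cap k).indicator f z‖ₑ ^ 2) (sigma 1) := fun k =>
          ((hm k).enorm.pow_const 2).aemeasurable
        rw [lintegral_const_mul', lintegral_prod_mul (hme k)
          (g := fun q : Ambient 1 × Ambient 1 => ‖(cap k).indicator f q.1‖ₑ ^ 2 *
            ‖(cap l).indicator f q.2‖ₑ ^ 2), lintegral_prod_mul (hme k) (hme l), hsq, hsq]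
        · unfold capConstant
          ring
        · have h2 := hm k
          have h3 := hm l
          exact Measurable.aemeasurable (by fun_prop)
        · unfold geomWeight
          finiteness

/-- A cap has `σ`-measure at most 1, so the `L¹` norm on it is at most the `L²` norm. This pointwise
bound serves the exponents above 6. -/
lemma enorm_extensionIntegral_cap_le {f : Ambient 1 → ℂ} (hf : Measurable f) (k : ℤ)
    (w : Ambient 1) :
    ‖extensionIntegral ((cap k).indicator f) w‖ₑ ≤ capNorm f (cap k) := by
  have h1 : extensionIntegral ((cap k).indicator f) w =
      ∫ z in cap k, character w z * f z ∂(sigma 1) := by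
    rw [extensionIntegral_eq, ← integral_indicator (measurableSet_cap k)]
    refine integral_congr_ae ?_
    filter_upwards with z
    by_cases hz : z ∈ cap k <;> simp [hz]
  rw [h1]
  refine (enorm_integral_le_lintegral_enorm _).trans ?_
  have h2 : ∀ z, ‖character w z * f z‖ₑ = ‖f z‖ₑ := fun z => by
    rw [enorm_mul, ← ofReal_norm, norm_character, ENNReal.ofReal_one, one_mul]
  simp_rw [h2]
  rw [← eLpNorm_one_eq_lintegral_enorm]
  have h3 := eLpNorm_le_eLpNorm_mul_rpow_measure_univ (μ := (sigma 1).restrict (cap k))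
    (show (1 : ℝ≥0∞) ≤ 2 by norm_num) hf.aestronglyMeasurable
  refine h3.trans ?_
  rw [capNorm]
  refine mul_le_of_le_one_right' (ENNReal.rpow_le_one ?_ (by norm_num))
  rw [Measure.restrict_apply_univ]
  exact sigma_cap_le k

lemma enorm_extensionIntegral_le_tsum {f : Ambient 1 → ℂ}
    (hfi : Integrable f (sigma 1)) (w : Ambient 1) :
    ‖extensionIntegral f w‖ₑ ≤ ∑' k, ‖extensionIntegral ((cap k).indicator f) w‖ₑ := by
  have hc : Integrable (fun z => character w z * f z) (sigma 1) :=
    hfi.bdd_mul (c := 1) (measurable_character measurable_const measurable_id).aestronglyMeasurable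
      (Eventually.of_forall fun z => (norm_character w z).le)
  have h1 : ∀ k, extensionIntegral ((cap k).indicator f) w =
      ∫ z in cap k, character w z * f z ∂(sigma 1) := by
    intro k
    rw [extensionIntegral_eq, ← integral_indicator (measurableSet_cap k)]
    refine integral_congr_ae ?_
    filter_upwards with z
    by_cases hz : z ∈ cap k <;> simp [hz]
  have h2 := hasSum_integral_iUnion (fun k => measurableSet_cap k) pairwise_disjoint_cap
    (hc.integrableOn (s := ⋃ k, cap k))
  have h3 : ∫ z in ⋃ k, cap k, character w z * f z ∂(sigma 1) = extensionIntegral f w := by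
    rw [iUnion_cap, extensionIntegral_eq, Measure.restrict_eq_self_of_ae_mem ae_mem_hyperboloid]
  rw [h3] at h2
  simp_rw [h1]
  rw [← h2.tsum_eq]
  exact enorm_tsum_le_tsum_enorm

lemma tsum_capNorm_sq (f : Ambient 1 → ℂ) :
    ∑' k, capNorm f (cap k) ^ 2 = eLpNorm f 2 (sigma 1) ^ 2 := by
  simp_rw [capNorm, eLpNorm_two_sq]
  rw [← lintegral_iUnion measurableSet_cap pairwise_disjoint_cap, iUnion_cap,
    Measure.restrict_eq_self_of_ae_mem ae_mem_hyperboloid]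

/-- The refined Strichartz estimate on the hyperbola. -/
theorem exists_eLpNorm_extensionIntegral_one_le {p : ℝ} (hp : 6 ≤ p) :
    ∃ C : ℝ≥0∞, C ≠ ∞ ∧ ∀ f : Ambient 1 → ℂ, Measurable f → Integrable f (sigma 1) →
      eLpNorm (extensionIntegral f) (ENNReal.ofReal p) volume ^ 4 ≤
        C * (⨆ k, capNorm f (cap k)) ^ 2 * eLpNorm f 2 (sigma 1) ^ 2 := by
  have hp0 : 0 < p := by linarith
  refine ⟨capConstant ^ (4 / p) * (2 * (∑' j, geomWeight (1 / 4 / p) j) ^ 3), ?_, fun f hf hfi => ?_⟩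
  · refine ENNReal.mul_ne_top (ENNReal.rpow_ne_top_of_nonneg (by positivity) capConstant_ne_top)
      (ENNReal.mul_ne_top ENNReal.ofNat_ne_top
        (ENNReal.pow_ne_top (tsum_geomWeight_ne_top (by positivity))))
  · have hm : ∀ k, Measurable fun w => ‖extensionIntegral ((cap k).indicator f) w‖ₑ := fun k =>
      (stronglyMeasurable_extensionIntegral
        (hf.indicator (measurableSet_cap k))).measurable.enorm
    have h1 := lintegral_tsum_rpow_le (μ := (volume : Measure (Ambient 1)))
      (a := fun k => capNorm f (cap k)) hm
      (enorm_extensionIntegral_cap_le hf) (lintegral_cap_interaction_le hf hfi) (by norm_num) hp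
    rw [tsum_capNorm_sq] at h1
    rw [eLpNorm_eq_lintegral_rpow_enorm_toReal (by simpa using hp0) ENNReal.ofReal_ne_top,
      ENNReal.toReal_ofReal hp0.le, ← ENNReal.rpow_natCast, ← ENNReal.rpow_mul]
    have e : 1 / p * ((4 : ℕ) : ℝ) = 4 / p := by push_cast; ring
    rw [e]
    calc _ ≤ _ := ENNReal.rpow_le_rpow (lintegral_mono fun w => ENNReal.rpow_le_rpow
          (enorm_extensionIntegral_le_tsum hfi w) hp0.le) (by positivity)
      _ ≤ _ := h1
      _ = _ := by ring

/-! ### The Lorentz maps and their invariants -/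

lemma mink_pos {d : ℕ} {u v : Ambient d} (hu : 0 < u.2) (huu : 0 < mink u u) (hv : 0 < v.2)
    (hvv : 0 < mink v v) : 0 < mink u v := by
  rw [mink, real_inner_self_eq_norm_sq] at huu hvv
  have h1 : ‖u.1‖ < u.2 := lt_of_pow_lt_pow_left₀ 2 hu.le (by linarith)
  have h2 : ‖v.1‖ < v.2 := lt_of_pow_lt_pow_left₀ 2 hv.le (by linarith)
  have h3 := real_inner_le_norm u.1 v.1
  have h4 := mul_lt_mul'' h1 h2 (norm_nonneg _) (norm_nonneg _)
  rw [mink]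
  linarith

lemma sqrt_one_sub_tanh_sq (k : ℝ) : Real.sqrt (1 - Real.tanh k ^ 2) = 1 / Real.cosh k := by
  have hc := Real.cosh_pos k
  rw [show 1 - Real.tanh k ^ 2 = (1 / Real.cosh k) ^ 2 by
    rw [Real.tanh_eq_sinh_div_cosh]
    field_simp
    linarith [Real.cosh_sq k]]
  exact Real.sqrt_sq (by positivity)

/-- With velocity `tanh k` the boost is a hyperbolic rotation by `k`, hence a translation by `k` in
the rapidity. -/
lemma boost_tanh {d : ℕ} [NeZero d] (k : ℝ) (z : Ambient d) :
    boost (Real.tanh k) z = (WithLp.toLp 2 (Function.update (fun i => z.1 i) 0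
      (z.1 0 * Real.cosh k + z.2 * Real.sinh k)), z.2 * Real.cosh k + z.1 0 * Real.sinh k) := by
  have hc := Real.cosh_pos k
  rw [boost, sqrt_one_sub_tanh_sq, Real.tanh_eq_sinh_div_cosh]
  refine Prod.ext ?_ ?_
  · simp only
    congr 2
    field_simp
  · simp only
    field_simp

lemma measurable_boost {d : ℕ} [NeZero d] (t : ℝ) : Measurable (boost (d := d) t) := by
  unfold boost
  refine Measurable.prodMk ?_ (by fun_prop)
  refine (WithLp.measurable_toLp 2 _).comp (measurable_pi_iff.2 fun i => ?_)
  by_cases hi : i = 0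
  · subst hi
    simp only [Function.update_self]
    fun_prop
  · simp only [Function.update_of_ne hi]
    fun_prop

lemma boost_planeEmb (k s θ : ℝ) :
    boost (Real.tanh k) (planeEmb (hypPolar s θ)) = planeEmb (hypPolar s (θ + k)) := by
  rw [boost_tanh]
  refine Prod.ext ?_ ?_
  · ext i
    fin_cases i
    simp [planeEmb, hypPolar, Real.sinh_add]
    ring
  · simp [planeEmb, hypPolar, Real.cosh_add]
    ring

lemma boost_sliceEmb (k s θ v : ℝ) :
    boost (Real.tanh k) (sliceEmb (hypPolar s θ, v)) = sliceEmb (hypPolar s (θ + k), v) := by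
  rw [boost_tanh]
  refine Prod.ext ?_ ?_
  · ext i
    fin_cases i
    · simp [sliceEmb, hypPolar, Real.sinh_add]
      ring
    · simp [sliceEmb]
  · simp [sliceEmb, hypPolar, Real.cosh_add]
    ring

lemma measurePreserving_boost_one (k : ℝ) :
    MeasurePreserving (boost (d := 1) (Real.tanh k)) (sigma 1) (sigma 1) := by
  have hb := measurable_boost (d := 1) (Real.tanh k)
  refine ⟨hb, Measure.ext_of_lintegral _ fun φ hφ => ?_⟩
  rw [lintegral_map hφ hb, lintegral_sigma_one hφ,
    lintegral_sigma_one (φ := fun z => φ (boost (Real.tanh k) z)) (hφ.comp hb)]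
  simp_rw [boost_planeEmb]
  exact lintegral_add_right_eq_self (fun θ => φ (planeEmb (hypPolar 1 θ))) k

lemma measurePreserving_boost_two (k : ℝ) :
    MeasurePreserving (boost (d := 2) (Real.tanh k)) (sigma 2) (sigma 2) := by
  have hb := measurable_boost (d := 2) (Real.tanh k)
  refine ⟨hb, Measure.ext_of_lintegral _ fun φ hφ => ?_⟩
  rw [lintegral_map hφ hb, lintegral_sigma_two hφ,
    lintegral_sigma_two (φ := fun z => φ (boost (Real.tanh k) z)) (hφ.comp hb)]
  simp_rw [boost_sliceEmb]
  exact lintegral_congr fun v =>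
    lintegral_add_right_eq_self (fun θ => φ (sliceEmb (hypPolar (sliceMass v) θ, v))) k

lemma mink_two (z w : Ambient 2) : mink z w = z.2 * w.2 - (z.1 0 * w.1 0 + z.1 1 * w.1 1) := by
  simp [mink, PiLp.inner_apply, Fin.sum_univ_two, mul_comm]

lemma mink_boost (k : ℝ) (z w : Ambient 2) :
    mink (boost (Real.tanh k) z) (boost (Real.tanh k) w) = mink z w := by
  have := Real.cosh_sq k
  rw [boost_tanh, boost_tanh, mink_two, mink_two]
  simp
  linear_combination (z.2 * w.2 - z.1 0 * w.1 0) * this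

lemma mink_rotation (φ : ℝ) (z w : Ambient 2) : mink (rotation φ z) (rotation φ w) = mink z w := by
  have := Real.sin_sq_add_cos_sq φ
  rw [mink_two, mink_two]
  simp [rotation]
  linear_combination (z.1 0 * w.1 0 + z.1 1 * w.1 1) * this

/-- The rotation of the plane by the angle `φ`, as an isometry. -/
def planeRotation (φ : ℝ) : E 2 →ₗᵢ[ℝ] E 2 where
  toFun y := !₂[y 0 * Real.cos φ + y 1 * Real.sin φ, -y 0 * Real.sin φ + y 1 * Real.cos φ]
  map_add' y y' := by
    ext i
    fin_cases i <;> simp <;> ring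
  map_smul' c y := by
    ext i
    fin_cases i <;> simp <;> ring
  norm_map' y := by
    have h1 : ‖y‖ ^ 2 = y 0 ^ 2 + y 1 ^ 2 := by
      simp [EuclideanSpace.norm_sq_eq, Fin.sum_univ_two]
    have h2 := Real.sin_sq_add_cos_sq φ
    refine (sq_eq_sq₀ (norm_nonneg _) (norm_nonneg _)).1 ?_
    rw [h1]
    refine (norm_sq_plane _ _).trans ?_
    linear_combination (y 0 ^ 2 + y 1 ^ 2) * h2

lemma measurable_rotation (φ : ℝ) : Measurable (rotation φ) :=
  ((planeRotation φ).continuous.measurable.comp measurable_fst).prodMk measurable_snd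

lemma measurePreserving_rotation (φ : ℝ) :
    MeasurePreserving (rotation φ) (sigma 2) (sigma 2) := by
  have hb := measurable_rotation φ
  have hR : MeasurePreserving (planeRotation φ) :=
    ((planeRotation φ).toLinearIsometryEquiv rfl).measurePreserving
  have hbr := measurable_bracket (d := 2)
  refine ⟨hb, Measure.ext_of_lintegral _ fun ψ hψ => ?_⟩
  rw [lintegral_map hψ hb, lintegral_sigma hψ,
    lintegral_sigma (φ := fun z => ψ (rotation φ z)) (hψ.comp hb),
    ← hR.lintegral_comp (f := fun y => ψ (y, bracket y) * ENNReal.ofReal (1 / bracket y))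
      (by fun_prop)]
  refine lintegral_congr fun y => ?_
  have : bracket (planeRotation φ y) = bracket y := by
    rw [bracket, bracket, LinearIsometry.norm_map]
  rw [this]
  rfl

/-- The Lorentz transformation `R_φ ∘ L^s` with `s = tanh k`. -/
def lorentz (φ k : ℝ) : Ambient 2 → Ambient 2 := rotation φ ∘ boost (Real.tanh k)

lemma measurePreserving_lorentz (φ k : ℝ) :
    MeasurePreserving (lorentz φ k) (sigma 2) (sigma 2) :=
  (measurePreserving_rotation φ).comp (measurePreserving_boost_two k)

lemma mink_lorentz (φ k : ℝ) (z w : Ambient 2) :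
    mink (lorentz φ k z) (lorentz φ k w) = mink z w := by
  simp only [lorentz, Function.comp_apply, mink_rotation, mink_boost]

/-- `R_φ` turns clockwise, sending `(r, 0)` to `(r cos φ, -r sin φ)`; so `φ` is the argument of `a -
ib`, shifted into `[0, 2π)`. -/
lemma exists_cos_sin_eq (a b : ℝ) : ∃ φ ∈ Ico (0 : ℝ) (2 * Real.pi),
    a = Real.sqrt (a ^ 2 + b ^ 2) * Real.cos φ ∧ b = -Real.sqrt (a ^ 2 + b ^ 2) * Real.sin φ := by
  set z : ℂ := ⟨a, -b⟩ with hz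
  have hn : ‖z‖ = Real.sqrt (a ^ 2 + b ^ 2) := by
    rw [Complex.norm_eq_sqrt_sq_add_sq]; simp [hz]
  have h1 : a = ‖z‖ * Real.cos z.arg := by rw [Complex.norm_mul_cos_arg]
  have h2 : b = -‖z‖ * Real.sin z.arg := by
    rw [neg_mul, Complex.norm_mul_sin_arg]; simp [hz]
  rw [← hn]
  have h3 := Complex.neg_pi_lt_arg z
  have h4 := Complex.arg_le_pi z
  have := Real.pi_pos
  rcases le_or_gt 0 z.arg with h | h
  · exact ⟨z.arg, ⟨h, by linarith⟩, h1, h2⟩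
  · refine ⟨z.arg + 2 * Real.pi, ⟨by linarith, by linarith⟩, ?_, ?_⟩
    · rw [Real.cos_add_two_pi]; exact h1
    · rw [Real.sin_add_two_pi]; exact h2

/-- Boosting the time axis by the rapidity `arsinh (r / M)` gives the right length `r` of the
spatial part and the right last coordinate; a rotation then fixes its direction. -/
lemma exists_lorentz_eq {z : Ambient 2} (h0 : 0 < z.2) (h : 0 < mink z z) :
    ∃ φ ∈ Ico (0 : ℝ) (2 * Real.pi), ∃ k, lorentz φ k (0, Real.sqrt (mink z z)) = z := by
  obtain ⟨φ, hφ, h1, h2⟩ := exists_cos_sin_eq (z.1 0) (z.1 1)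
  set r := Real.sqrt (z.1 0 ^ 2 + z.1 1 ^ 2) with hr
  have hr2 : r ^ 2 = z.1 0 ^ 2 + z.1 1 ^ 2 := Real.sq_sqrt (by positivity)
  set M := Real.sqrt (mink z z) with hM
  have hM0 : 0 < M := Real.sqrt_pos.2 h
  have hM2 : M ^ 2 = mink z z := Real.sq_sqrt h.le
  obtain ⟨k, hs, hc⟩ : ∃ k, M * Real.sinh k = r ∧ M * Real.cosh k = z.2 := by
    refine ⟨Real.arsinh (r / M), ?_, ?_⟩
    · rw [Real.sinh_arsinh]; field_simp
    · rw [Real.cosh_arsinh]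
      have e : 1 + (r / M) ^ 2 = (z.2 / M) ^ 2 := by
        field_simp
        rw [hM2, hr2, mink_two]
        ring
      rw [e, Real.sqrt_sq (by positivity)]
      field_simp
  refine ⟨φ, hφ, k, ?_⟩
  rw [lorentz, Function.comp_apply, boost_tanh]
  refine Prod.ext ?_ ?_
  · ext i
    fin_cases i
    · simp [rotation, hs]
      exact h1.symm
    · simp [rotation, hs]
      linarith
  · simp [rotation, hc]

lemma lorentz_mem_hyperboloid {φ k : ℝ} {z : Ambient 2} (hz : z ∈ hyperboloid 2) :
    lorentz φ k z ∈ hyperboloid 2 := by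
  refine mem_hyperboloid_of_mink ?_ ?_
  · rw [mink_lorentz, mink_self_eq_one hz]
  · have h1 : z.2 = bracket z.1 := hz
    have h2 : |z.1 0| ≤ z.2 := by
      have := bracket_sq z.1
      have h3 : ‖z.1‖ ^ 2 = z.1 0 ^ 2 + z.1 1 ^ 2 := by
        simp [EuclideanSpace.norm_sq_eq, Fin.sum_univ_two]
      rw [h1]
      exact abs_le_of_sq_le_sq (by nlinarith [sq_nonneg (z.1 1)]) (bracket_pos _).le
    have h3 : |Real.sinh k| < Real.cosh k := by
      refine abs_lt_of_sq_lt_sq ?_ (Real.cosh_pos k).le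
      rw [Real.cosh_sq]; linarith
    have h4 := snd_pos_of_mem hz
    have h5 : |z.1 0 * Real.sinh k| < z.2 * Real.cosh k := by
      rw [abs_mul]
      exact mul_lt_mul_of_le_of_lt_of_nonneg_of_pos h2 h3 (abs_nonneg _) h4
    rw [lorentz, Function.comp_apply, boost_tanh]
    simp only [rotation]
    linarith [neg_abs_le (z.1 0 * Real.sinh k)]

/-! ### Threefold convolution for `d = 2`, and the `L⁶` and `L⁴` bounds -/

lemma lintegral_sigma_two_radial_le {G : ℝ → ℝ≥0∞} (hG : Measurable G) :
    ∫⁻ z, G z.2 ∂(sigma 2) ≤ ENNReal.ofReal (2 * Real.pi) * ∫⁻ c in Ioi (1 : ℝ), G c := by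
  have hb := measurable_bracket (d := 2)
  have e : ∀ x : ℝ × ℝ, bracket (!₂[x.1, x.2] : E 2) = Real.sqrt (1 + (x.1 ^ 2 + x.2 ^ 2)) :=
    fun x => by rw [bracket, norm_sq_plane]
  rw [lintegral_sigma (φ := fun z : Ambient 2 => G z.2) (by fun_prop),
    ← measurePreserving_plane.lintegral_comp (f := fun y : E 2 =>
      G (bracket y) * ENNReal.ofReal (1 / bracket y)) (by fun_prop)]
  simp_rw [e]
  rw [← lintegral_comp_polarCoord_symm, polarCoord_target, Measure.volume_eq_prod,
    ← Measure.prod_restrict, lintegral_prod _ (Measurable.aemeasurable (by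
      simp only [polarCoord_symm_apply]; fun_prop))]
  have e2 : ∀ r θ : ℝ, (r * Real.cos θ) ^ 2 + (r * Real.sin θ) ^ 2 = r ^ 2 := fun r θ => by
    linear_combination r ^ 2 * Real.sin_sq_add_cos_sq θ
  simp only [polarCoord_symm_apply, e2, lintegral_const, Measure.restrict_apply_univ,
    Real.volume_Ioo, sub_neg_eq_add, smul_eq_mul, ← two_mul]
  rw [lintegral_mul_const _ (by fun_prop), mul_comm]
  refine mul_le_mul_right ?_ _
  have hpos : ∀ r : ℝ, 0 < 1 + r ^ 2 := fun r => by positivity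
  -- With `c = √(1 + r²)` one has `r dr / √(1 + r²) = dc`, so the last coordinate is distributed
  -- with constant density `2π` on `(1, ∞)`.
  refine le_trans (setLIntegral_mono_ae (by fun_prop) ?_) (lintegral_comp_mul_abs_deriv_le
    (s := Ioi 0) (f := fun r => Real.sqrt (1 + r ^ 2)) (f' := fun r => r / Real.sqrt (1 + r ^ 2))
    measurableSet_Ioi (fun r _ => ?_) ?_ ?_ G)
  · refine Eventually.of_forall fun r hr => ?_
    have hr : (0 : ℝ) < r := hr
    rw [abs_of_nonneg (by positivity), div_eq_mul_one_div r, ENNReal.ofReal_mul hr.le]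
    exact le_of_eq (by ring)
  · have h := (((hasDerivAt_id r).pow 2).const_add 1).sqrt (hpos r).ne'
    refine h.congr_deriv ?_
    simp
    field_simp
  · intro r hr r' hr' h
    have h := (Real.sqrt_inj (hpos r).le (hpos r').le).1 h
    exact (sq_eq_sq₀ (le_of_lt hr) (le_of_lt hr')).1 (by linarith)
  · intro r hr
    have hr : (0 : ℝ) < r := hr
    exact Real.lt_sqrt_of_sq_lt (by nlinarith)

/-- The density of `σ * σ` on `ℝ³` at a point `z - x`, where `x` lies on the hyperboloid, in terms
of `a = ⟨z, z⟩` and `b = ⟨z, x⟩`. -/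
def pairKernel (a b : ℝ) : ℝ≥0∞ :=
  if 0 < a - b ∧ 4 ≤ a - 2 * b + 1 then ENNReal.ofReal (2 * Real.pi / Real.sqrt (a - 2 * b + 1))
  else 0

lemma measurable_pairKernel : Measurable fun q : ℝ × ℝ => pairKernel q.1 q.2 := by
  unfold pairKernel
  have h1 : MeasurableSet {q : ℝ × ℝ | 0 < q.1 - q.2} :=
    measurableSet_lt measurable_const (by fun_prop)
  have h2 : MeasurableSet {q : ℝ × ℝ | 4 ≤ q.1 - 2 * q.2 + 1} :=
    measurableSet_le measurable_const (by fun_prop)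
  exact Measurable.ite (h1.inter h2) (by fun_prop) measurable_const

/-- In the variable `s = √(M² - 2Mc + 1)` the kernel `2π / s` becomes the constant `2π / M`. Since
`c > 1`, `s` ranges within `(0, M - 1)`, and the total is at most `2π (M - 1) / M`. -/
lemma lintegral_pairKernel_le {M : ℝ} (hM : 0 < M) :
    ∫⁻ c in Ioi (1 : ℝ), pairKernel (M ^ 2) (M * c) ≤ ENNReal.ofReal (2 * Real.pi) := by
  set s : Set ℝ := {c | 1 < c ∧ 0 < M ^ 2 - M * c ∧ 4 ≤ M ^ 2 - 2 * (M * c) + 1} with hs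
  have h1 : MeasurableSet {c : ℝ | 0 < M ^ 2 - M * c} :=
    measurableSet_lt measurable_const (by fun_prop)
  have h2 : MeasurableSet {c : ℝ | 4 ≤ M ^ 2 - 2 * (M * c) + 1} :=
    measurableSet_le measurable_const (by fun_prop)
  have hsm : MeasurableSet s := measurableSet_Ioi.inter (h1.inter h2)
  have hpos : ∀ c ∈ s, 0 < M ^ 2 - 2 * (M * c) + 1 := fun c hc => by linarith [hc.2.2]
  have hM1 : ∀ c ∈ s, 1 < M := fun c hc => by nlinarith [hc.1, hc.2.1]
  have key := lintegral_comp_mul_abs_deriv_le (s := s) (t := Ioo 0 (M - 1))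
    (f := fun c => Real.sqrt (M ^ 2 - 2 * (M * c) + 1))
    (f' := fun c => -M / Real.sqrt (M ^ 2 - 2 * (M * c) + 1)) hsm (fun c hc => ?_) ?_ ?_
    (fun _ => ENNReal.ofReal (2 * Real.pi / M))
  · calc ∫⁻ c in Ioi (1 : ℝ), pairKernel (M ^ 2) (M * c)
        = ∫⁻ c in s, ENNReal.ofReal |-M / Real.sqrt (M ^ 2 - 2 * (M * c) + 1)| *
            ENNReal.ofReal (2 * Real.pi / M) := by
          rw [← lintegral_indicator hsm, ← lintegral_indicator measurableSet_Ioi]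
          refine lintegral_congr fun c => ?_
          by_cases hc : 1 < c
          · rw [indicator_of_mem (show c ∈ Ioi (1 : ℝ) from hc), pairKernel]
            by_cases h : 0 < M ^ 2 - M * c ∧ 4 ≤ M ^ 2 - 2 * (M * c) + 1
            · have hcs : c ∈ s := ⟨hc, h⟩
              have := Real.sqrt_pos.2 (hpos c hcs)
              rw [if_pos h, indicator_of_mem hcs, ← ENNReal.ofReal_mul (abs_nonneg _), abs_div,
                abs_neg, abs_of_pos hM, abs_of_pos this]
              congr 1
              field_simp
            · rw [if_neg h, indicator_of_notMem (fun hcs => h hcs.2)]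
          · rw [indicator_of_notMem (show c ∉ Ioi (1 : ℝ) from hc),
              indicator_of_notMem (fun hcs => hc hcs.1)]
      _ ≤ _ := key
      _ ≤ ENNReal.ofReal (2 * Real.pi) := by
          rw [setLIntegral_const, Real.volume_Ioo, ← ENNReal.ofReal_mul (by positivity)]
          refine ENNReal.ofReal_le_ofReal ?_
          rw [div_mul_eq_mul_div, div_le_iff₀ hM]
          nlinarith [Real.pi_pos]
  · have h := (((((hasDerivAt_id c).const_mul M).const_mul 2).const_sub (M ^ 2)).add_const 1).sqrt
      (hpos c hc).ne'
    refine h.congr_deriv ?_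
    have := Real.sqrt_pos.2 (hpos c hc)
    simp
    field_simp
  · intro c hc c' hc' h
    have h := (Real.sqrt_inj (hpos c hc).le (hpos c' hc').le).1 h
    have : M * c = M * c' := by linarith
    exact mul_left_cancel₀ hM.ne' this
  · intro c hc
    have := hM1 c hc
    refine ⟨Real.sqrt_pos.2 (hpos c hc), ?_⟩
    rw [Real.sqrt_lt' (by linarith)]
    nlinarith [hc.1]

lemma mink_zero_left {d : ℕ} (M : ℝ) (x : Ambient d) : mink (0, M) x = M * x.2 := by
  simp [mink]

/-- By Lorentz invariance `z` may be taken on the time axis, where `⟨z, x⟩` depends only on the last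
coordinate of `x`. -/
lemma lintegral_pairKernel_mink_le {z : Ambient 2} (h0 : 0 < z.2) (h : 0 < mink z z) :
    ∫⁻ x, pairKernel (mink z z) (mink z x) ∂(sigma 2) ≤
      ENNReal.ofReal (2 * Real.pi) * ENNReal.ofReal (2 * Real.pi) := by
  obtain ⟨φ, -, k, hz⟩ := exists_lorentz_eq h0 h
  set M := Real.sqrt (mink z z) with hM
  have hM0 : 0 < M := Real.sqrt_pos.2 h
  have hM2 : M ^ 2 = mink z z := Real.sq_sqrt h.le
  have hk : ∀ a, Measurable (pairKernel a) := fun a =>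
    measurable_pairKernel.comp (measurable_const.prodMk measurable_id)
  have hm : Measurable fun x : Ambient 2 => mink z x := measurable_mink measurable_const measurable_id
  rw [← (measurePreserving_lorentz φ k).lintegral_comp
    (f := fun x => pairKernel (mink z z) (mink z x)) ((hk _).comp hm), ← hM2]
  have e : ∀ x, mink z (lorentz φ k x) = M * x.2 := fun x => by
    rw [← mink_zero_left, ← mink_lorentz φ k (0, M), hz]
  simp_rw [e]
  refine (lintegral_sigma_two_radial_le (G := fun c => pairKernel (M ^ 2) (M * c))
    ((hk _).comp (measurable_const_mul M))).trans ?_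
  exact mul_le_mul_right (lintegral_pairKernel_le hM0) _

/-- For `z` in the open forward cone this is the preceding radial integral. Otherwise the integrand
vanishes almost everywhere: `z - x` in the cone would put `z = (z - x) + x` in it as well. -/
lemma lintegral_pairDensity_sub_le (z : Ambient 2) :
    ∫⁻ x, (if 0 < (z - x).2 ∧ 4 ≤ mink (z - x) (z - x) then
        ENNReal.ofReal (2 * Real.pi / Real.sqrt (mink (z - x) (z - x))) else 0) ∂(sigma 2) ≤
      ENNReal.ofReal (2 * Real.pi) * ENNReal.ofReal (2 * Real.pi) := by
  by_cases hz : 0 < z.2 ∧ 0 < mink z z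
  · refine le_trans (lintegral_mono_ae ?_) (lintegral_pairKernel_mink_le hz.1 hz.2)
    filter_upwards [ae_mem_hyperboloid] with x hx
    split_ifs with h
    · have e1 : mink (z - x) (z - x) = mink z z - 2 * mink z x + 1 := by
        rw [mink_sub_self, mink_self_eq_one hx]
      have e2 : mink z (z - x) = mink z z - mink z x := by
        have := mink_add_right z (z - x) x
        rw [sub_add_cancel] at this
        linarith
      have h2 := mink_pos hz.1 hz.2 h.1 (by linarith [h.2])
      rw [pairKernel, if_pos ⟨by linarith, by linarith [h.2]⟩, e1]
    · exact zero_le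
  · refine le_trans (le_of_eq ?_) zero_le
    refine (lintegral_congr_ae (g := fun _ => 0) ?_).trans lintegral_zero
    filter_upwards [ae_mem_hyperboloid] with x hx
    refine if_neg fun h => hz ?_
    have hx2 := snd_pos_of_mem hx
    have hxx := mink_self_eq_one hx
    have h2 := mink_pos h.1 (by linarith [h.2]) hx2 (by linarith)
    have e1 : mink (z - x + x) (z - x + x) =
        mink (z - x) (z - x) + 2 * mink (z - x) x + mink x x := by
      rw [mink_add_left, mink_add_right, mink_add_right, mink_comm x (z - x)]
      ring
    rw [sub_add_cancel] at e1
    exact ⟨by have := h.1; rw [Prod.snd_sub] at this; linarith, by linarith [h.2]⟩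

/-- The density of `σ * σ * σ` at `z` is controlled by the integral over `x` of the twofold density
at `z - x`, bounded uniformly in `z` just above. -/
theorem lintegral_sigma_two_triple_le {φ : Ambient 2 → ℝ≥0∞} (hφ : Measurable φ) :
    ∫⁻ q : Ambient 2 × Ambient 2 × Ambient 2, φ (q.1 + q.2.1 + q.2.2)
        ∂((sigma 2).prod ((sigma 2).prod (sigma 2))) ≤
      ENNReal.ofReal (2 * Real.pi) * ENNReal.ofReal (2 * Real.pi) * ∫⁻ z, φ z := by
  set K : Ambient 2 → ℝ≥0∞ := fun z => if 0 < z.2 ∧ 4 ≤ mink z z then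
        ENNReal.ofReal (2 * Real.pi / Real.sqrt (mink z z)) else 0 with hK
  have hm : Measurable fun z : Ambient 2 => mink z z := measurable_mink measurable_id measurable_id
  have hKm : Measurable K :=
    Measurable.ite ((measurableSet_lt measurable_const measurable_snd).inter
      (measurableSet_le measurable_const hm)) (by fun_prop) measurable_const
  rw [lintegral_prod _ (by fun_prop)]
  calc ∫⁻ x, ∫⁻ q : Ambient 2 × Ambient 2, φ (x + q.1 + q.2) ∂((sigma 2).prod (sigma 2)) ∂(sigma 2)
      ≤ ∫⁻ x, (∫⁻ z, φ z * K (z - x)) ∂(sigma 2) := by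
        refine lintegral_mono fun x => ?_
        have h := lintegral_sigma_two_pair_le (φ := fun z => φ (x + z)) (by fun_prop)
        simp only [add_assoc]
        refine h.trans (le_of_eq ?_)
        rw [← lintegral_add_left_eq_self (fun z => φ z * K (z - x)) x]
        refine lintegral_congr fun z => ?_
        rw [add_sub_cancel_left]
    _ = ∫⁻ z, (∫⁻ x, φ z * K (z - x) ∂(sigma 2)) := by
        refine lintegral_lintegral_swap (f := fun x z => φ z * K (z - x))
          (Measurable.aemeasurable ?_)
        have : Measurable fun q : Ambient 2 × Ambient 2 => K (q.2 - q.1) := hKm.comp (by fun_prop)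
        exact (hφ.comp measurable_snd).mul this
    _ ≤ ∫⁻ z, φ z * (ENNReal.ofReal (2 * Real.pi) * ENNReal.ofReal (2 * Real.pi)) := by
        refine lintegral_mono fun z => ?_
        have : Measurable fun x => K (z - x) := hKm.comp (by fun_prop)
        rw [lintegral_const_mul _ this]
        exact mul_le_mul_right (lintegral_pairDensity_sub_le z) _
    _ = _ := by rw [lintegral_mul_const _ hφ, mul_comm]

/-- The constant in the `L⁶` estimate on the two-dimensional hyperboloid. -/
def strichartzConstant : ℝ≥0∞ := 2 * (ENNReal.ofReal (2 * Real.pi) * ENNReal.ofReal (2 * Real.pi)) *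
  ENNReal.ofReal ((2 * Real.pi) ^ (2 + 1))

lemma strichartzConstant_ne_top : strichartzConstant ≠ ∞ := by
  unfold strichartzConstant
  finiteness

theorem lintegral_enorm_extensionIntegral_pow_six_le {f : Ambient 2 → ℂ} (hf : Measurable f)
    (hfi : Integrable f (sigma 2)) :
    ∫⁻ w, ‖extensionIntegral f w‖ₑ ^ 6 ≤ strichartzConstant * eLpNorm f 2 (sigma 2) ^ 6 := by
  have hS : Measurable fun q : Ambient 2 × Ambient 2 × Ambient 2 => q.1 + q.2.1 + q.2.2 := by
    fun_prop
  have h1 := lintegral_enorm_sq_le _ hS (h := fun q => f q.1 * (f q.2.1 * f q.2.2)) (by fun_prop)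
    (hfi.mul_prod (hfi.mul_prod hfi)) (ω := fun _ => 1) measurable_const
    (Eventually.of_forall fun _ => ⟨one_ne_zero, ENNReal.one_ne_top⟩)
    (C := ENNReal.ofReal (2 * Real.pi) * ENNReal.ofReal (2 * Real.pi)) (fun φ hφ => by
      simp only [mul_one]; exact lintegral_sigma_two_triple_le hφ)
  have hme : AEMeasurable (fun z => ‖f z‖ₑ ^ 2) (sigma 2) := (hf.enorm.pow_const 2).aemeasurable
  have e0 : ∀ a b c : ℝ≥0∞, (a * (b * c)) ^ 2 = a ^ 2 * (b ^ 2 * c ^ 2) := fun a b c => by ring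
  simp_rw [← extensionIntegral_mul_mul, mul_one, enorm_mul, e0] at h1
  have e : ∫⁻ q : Ambient 2 × Ambient 2 × Ambient 2, ‖f q.1‖ₑ ^ 2 * (‖f q.2.1‖ₑ ^ 2 *
      ‖f q.2.2‖ₑ ^ 2) ∂((sigma 2).prod ((sigma 2).prod (sigma 2))) =
        eLpNorm f 2 (sigma 2) ^ 6 := by
    rw [lintegral_prod_mul hme (g := fun q : Ambient 2 × Ambient 2 => ‖f q.1‖ₑ ^ 2 *
      ‖f q.2‖ₑ ^ 2) (by fun_prop), lintegral_prod_mul hme hme, ← eLpNorm_two_sq]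
    ring
  rw [e] at h1
  refine le_trans (lintegral_mono fun w => ?_) h1
  exact le_of_eq (by ring)

/-- The weighted `L²` bound for `(Tf)²`. The weight `2π / s` is kept inside the integral, because
its decay for distant points is what makes the far interactions small. -/
theorem lintegral_enorm_extensionIntegral_pow_four_le {f : Ambient 2 → ℂ} (hf : Measurable f)
    (hfi : Integrable f (sigma 2)) :
    ∫⁻ w, ‖extensionIntegral f w‖ₑ ^ 4 ≤ 2 * 1 * ENNReal.ofReal ((2 * Real.pi) ^ (2 + 1)) *
      ∫⁻ q : Ambient 2 × Ambient 2, ‖f q.1 * f q.2‖ₑ ^ 2 *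
        ENNReal.ofReal (2 * Real.pi / Real.sqrt (mink (q.1 + q.2) (q.1 + q.2)))
        ∂((sigma 2).prod (sigma 2)) := by
  have hm : Measurable fun z : Ambient 2 => mink z z := measurable_mink measurable_id measurable_id
  have hS : Measurable fun q : Ambient 2 × Ambient 2 => q.1 + q.2 := by fun_prop
  have h1 := lintegral_enorm_sq_le _ hS (h := fun q => f q.1 * f q.2) (by fun_prop)
    (hfi.mul_prod hfi) (ω := fun z => ENNReal.ofReal (2 * Real.pi / Real.sqrt (mink z z)))
    (by fun_prop) ?_ (C := 1) (fun φ hφ => by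
      rw [one_mul]
      refine (lintegral_sigma_two_pair_le hφ).trans (lintegral_mono fun z => ?_)
      refine mul_le_mul_right ?_ _
      split_ifs
      · exact le_rfl
      · exact zero_le)
  · refine le_trans (lintegral_mono fun w => ?_) h1
    rw [← extensionIntegral_mul, enorm_mul]
    exact le_of_eq (by ring)
  have h1 := (Measure.quasiMeasurePreserving_fst (μ := sigma 2)
    (ν := sigma 2)).ae ae_mem_hyperboloid
  have h2 := (Measure.quasiMeasurePreserving_snd (μ := sigma 2)
    (ν := sigma 2)).ae ae_mem_hyperboloid
  filter_upwards [h1, h2] with q a b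
  refine ⟨?_, ENNReal.ofReal_ne_top⟩
  have e1 := one_le_mink a b
  have e2 := mink_self_eq_one a
  have e3 := mink_self_eq_one b
  have : 0 < mink (q.1 + q.2) (q.1 + q.2) := by
    simp only [mink_add_left, mink_add_right, mink_comm q.2 q.1]
    linarith
  have := Real.sqrt_pos.2 this
  simp only [ne_eq, ENNReal.ofReal_eq_zero, not_le]
  positivity

/-! ### Hyperbolic balls and the splitting into near and far pairs -/

/-- The set of points within a fixed hyperbolic distance of `P`. -/
def hypBall (P : Ambient 2) : Set (Ambient 2) := {Q | mink P Q ≤ Real.sqrt (1 + 8 * Real.pi ^ 2)}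

lemma measurableSet_mink_le (P : Ambient 2) (A : ℝ) : MeasurableSet {Q | mink P Q ≤ A} :=
  measurableSet_le (measurable_mink measurable_const measurable_id) measurable_const

lemma exists_cover_hypBall (A : ℝ) : ∃ t : Finset (E 2), ∀ Q ∈ hyperboloid 2, Q.2 ≤ A →
    ∃ y ∈ t, Q ∈ hypBall (y, bracket y) := by
  have hb := continuous_bracket (d := 2)
  have hK : IsCompact (Metric.closedBall (0 : E 2) A) := isCompact_closedBall 0 A
  obtain ⟨t, -, ht⟩ := hK.elim_nhds_subcover
    (fun y => {y' | mink (y, bracket y) (y', bracket y') < Real.sqrt (1 + 8 * Real.pi ^ 2)})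
    (fun y _ => by
      refine IsOpen.mem_nhds (isOpen_lt ?_ continuous_const) ?_
      · unfold mink
        exact (continuous_const.mul hb).sub (continuous_const.inner continuous_id)
      · change mink (y, bracket y) (y, bracket y) < _
        rw [mink_self_eq_one (show (y, bracket y) ∈ hyperboloid 2 from rfl)]
        refine Real.lt_sqrt_of_sq_lt ?_
        have := Real.pi_pos
        nlinarith)
  refine ⟨t, fun Q hQ hA => ?_⟩
  have hQ' : Q.2 = bracket Q.1 := hQ
  have h1 : Q.1 ∈ Metric.closedBall (0 : E 2) A := by
    rw [mem_closedBall_zero_iff]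
    refine le_trans ?_ hA
    rw [hQ']
    exact Real.le_sqrt_of_sq_le (by linarith)
  obtain ⟨y, hy, hyQ⟩ := mem_iUnion₂.1 (ht h1)
  refine ⟨y, hy, ?_⟩
  change mink (y, bracket y) (Q.1, bracket Q.1) < _ at hyQ
  rw [← hQ'] at hyQ
  exact hyQ.le

lemma exists_lorentz_eq_of_mem {P : Ambient 2} (hP : P ∈ hyperboloid 2) :
    ∃ φ ∈ Ico (0 : ℝ) (2 * Real.pi), ∃ k, lorentz φ k (0, 1) = P := by
  have h := mink_self_eq_one hP
  have := exists_lorentz_eq (snd_pos_of_mem hP) (by rw [h]; exact one_pos)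
  rwa [h, Real.sqrt_one] at this

lemma setLIntegral_lorentz {u : Ambient 2 → ℝ≥0∞} (hu : Measurable u) (φ k A : ℝ) (P : Ambient 2) :
    ∫⁻ Q in {Q | mink P Q ≤ A}, u (lorentz φ k Q) ∂(sigma 2) =
      ∫⁻ Q in {Q | mink (lorentz φ k P) Q ≤ A}, u Q ∂(sigma 2) := by
  rw [← (measurePreserving_lorentz φ k).setLIntegral_comp_preimage (measurableSet_mink_le _ _) hu]
  have : lorentz φ k ⁻¹' {Q | mink (lorentz φ k P) Q ≤ A} = {Q | mink P Q ≤ A} := by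
    ext Q
    rw [mem_preimage, mem_ofPred_eq, mem_ofPred_eq, mink_lorentz]
  rw [this]

/-- A large ball about `(0, 1)` is covered by finitely many fixed-size balls by compactness. Lorentz
maps transport the cover to any centre, so the count depends on `A` alone. -/
lemma exists_setLIntegral_mink_le (A : ℝ) : ∃ N : ℕ, ∀ (u : Ambient 2 → ℝ≥0∞) (B : ℝ≥0∞),
    Measurable u → (∀ P ∈ hyperboloid 2, ∫⁻ Q in hypBall P, u Q ∂(sigma 2) ≤ B) →
    ∀ P ∈ hyperboloid 2, ∫⁻ Q in {Q | mink P Q ≤ A}, u Q ∂(sigma 2) ≤ N * B := by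
  obtain ⟨t, ht⟩ := exists_cover_hypBall A
  refine ⟨t.card, fun u B hu hB P hP => ?_⟩
  obtain ⟨φ, -, k, rfl⟩ := exists_lorentz_eq_of_mem hP
  rw [← setLIntegral_lorentz hu]
  calc ∫⁻ Q in {Q | mink (0, 1) Q ≤ A}, u (lorentz φ k Q) ∂(sigma 2)
      ≤ ∫⁻ Q in ⋃ y : t, hypBall (y, bracket y.1), u (lorentz φ k Q) ∂(sigma 2) := by
        refine lintegral_mono' (Measure.restrict_mono_ae ?_) le_rfl
        filter_upwards [ae_mem_hyperboloid] with Q hQ hA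
        have hA' : mink (0, 1) Q ≤ A := hA
        rw [mink_zero_left, one_mul] at hA'
        obtain ⟨y, hy, h⟩ := ht Q hQ hA'
        exact mem_iUnion.2 ⟨⟨y, hy⟩, h⟩
    _ ≤ ∑ y : t, ∫⁻ Q in hypBall (y, bracket y.1), u (lorentz φ k Q) ∂(sigma 2) := by
        rw [← tsum_fintype (L := .unconditional _)]
        exact lintegral_iUnion_le _ _
    _ ≤ ∑ y : t, B := by
        refine Finset.sum_le_sum fun y _ => ?_
        rw [hypBall, setLIntegral_lorentz hu]
        exact hB _ (lorentz_mem_hyperboloid rfl)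
    _ = t.card * B := by simp

/-- Pairs with `⟨P, Q⟩ ≤ A` have kernel at most `2π`, and the mass within reach of `P` is at most `N
B²`. Pairs with `⟨P, Q⟩ > A` have kernel at most `2π / √A`, because `⟨P + Q, P + Q⟩ = 2 + 2⟨P, Q⟩`.
-/
theorem exists_lintegral_pow_four_le {A : ℝ} (hA : 0 < A) : ∃ N : ℕ, ∀ (f : Ambient 2 → ℂ)
    (B : ℝ≥0∞), Measurable f → Integrable f (sigma 2) →
    (∀ P ∈ hyperboloid 2, capNorm f (hypBall P) ≤ B) →
    ∫⁻ w, ‖extensionIntegral f w‖ₑ ^ 4 ≤ 2 * ENNReal.ofReal ((2 * Real.pi) ^ 3) *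
      (ENNReal.ofReal (2 * Real.pi) * (N * B ^ 2) +
        ENNReal.ofReal (2 * Real.pi / Real.sqrt A) * eLpNorm f 2 (sigma 2) ^ 2) *
      eLpNorm f 2 (sigma 2) ^ 2 := by
  obtain ⟨N, hN⟩ := exists_setLIntegral_mink_le A
  refine ⟨N, fun f B hf hfi hB => ?_⟩
  refine (lintegral_enorm_extensionIntegral_pow_four_le hf hfi).trans ?_
  rw [mul_one, mul_assoc (2 * ENNReal.ofReal _)]
  refine mul_le_mul_right ?_ _
  set u : Ambient 2 → ℝ≥0∞ := fun z => ‖f z‖ₑ ^ 2 with hu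
  have hum : Measurable u := hf.enorm.pow_const 2
  have hball := hN u (B ^ 2) hum (fun P hP => by
    rw [hu, ← eLpNorm_two_sq]
    exact pow_le_pow_left₀ zero_le (hB P hP) 2)
  have hm : Measurable fun q : Ambient 2 × Ambient 2 => mink (q.1 + q.2) (q.1 + q.2) :=
    measurable_mink (by fun_prop) (by fun_prop)
  set c₁ := ENNReal.ofReal (2 * Real.pi)
  set c₂ := ENNReal.ofReal (2 * Real.pi / Real.sqrt A)
  rw [lintegral_prod _ (by fun_prop), eLpNorm_two_sq]
  calc ∫⁻ P, ∫⁻ Q, ‖f P * f Q‖ₑ ^ 2 *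
        ENNReal.ofReal (2 * Real.pi / Real.sqrt (mink (P + Q) (P + Q))) ∂(sigma 2) ∂(sigma 2)
      ≤ ∫⁻ P, (c₁ * (N * B ^ 2) + c₂ * ∫⁻ z, u z ∂(sigma 2)) * u P ∂(sigma 2) := by
        refine lintegral_mono_ae ?_
        filter_upwards [ae_mem_hyperboloid] with P hP
        have hs := measurableSet_mink_le P A
        calc ∫⁻ Q, ‖f P * f Q‖ₑ ^ 2 *
              ENNReal.ofReal (2 * Real.pi / Real.sqrt (mink (P + Q) (P + Q))) ∂(sigma 2)
            ≤ ∫⁻ Q, u P * (c₁ * {Q | mink P Q ≤ A}.indicator u Q + c₂ * u Q) ∂(sigma 2) := by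
              refine lintegral_mono_ae ?_
              filter_upwards [ae_mem_hyperboloid] with Q hQ
              have e1 := one_le_mink hP hQ
              have e2 : mink (P + Q) (P + Q) = 2 + 2 * mink P Q := by
                simp only [mink_add_left, mink_add_right, mink_comm Q P, mink_self_eq_one hP,
                  mink_self_eq_one hQ]
                ring
              rw [enorm_mul, mul_pow, mul_assoc, e2]
              refine mul_le_mul_right ?_ _
              by_cases h : mink P Q ≤ A
              · rw [indicator_of_mem (show Q ∈ {Q | mink P Q ≤ A} from h), mul_comm]
                refine le_add_right (mul_le_mul_left (ENNReal.ofReal_le_ofReal ?_) _)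
                refine div_le_self (by positivity) (Real.le_sqrt_of_sq_le (by linarith))
              · rw [indicator_of_notMem (show Q ∉ {Q | mink P Q ≤ A} from h), mul_zero, zero_add,
                  mul_comm]
                refine mul_le_mul_left (ENNReal.ofReal_le_ofReal ?_) _
                have := Real.sqrt_pos.2 hA
                have h' := not_le.1 h
                gcongr
                linarith
          _ = u P * (c₁ * ∫⁻ Q in {Q | mink P Q ≤ A}, u Q ∂(sigma 2) +
                c₂ * ∫⁻ z, u z ∂(sigma 2)) := by
              have hi : Measurable ({Q | mink P Q ≤ A}.indicator u) := hum.indicator hs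
              rw [lintegral_const_mul _ (by fun_prop), lintegral_add_left (by fun_prop),
                lintegral_const_mul _ hi, lintegral_const_mul _ hum, lintegral_indicator hs]
          _ ≤ _ := by
              rw [mul_comm]
              have := hball P hP
              gcongr
    _ = _ := by rw [lintegral_const_mul _ hum]

/-- Hölder with `p = 4 (6 - p) / 2 + 6 (p - 4) / 2`. The exponent on the fourth-power integral
vanishes at `p = 6`, so the endpoint gives no gain. -/
lemma lintegral_rpow_le_four_six {X : Type*} [MeasurableSpace X] {μ : Measure X} {u : X → ℝ≥0∞}
    (hu : AEMeasurable u μ) {p : ℝ} (hp : 4 ≤ p) (hp' : p ≤ 6) :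
    ∫⁻ x, u x ^ p ∂μ ≤
      (∫⁻ x, u x ^ 4 ∂μ) ^ ((6 - p) / 2) * (∫⁻ x, u x ^ 6 ∂μ) ^ ((p - 4) / 2) := by
  refine le_trans (le_of_eq (lintegral_congr fun x => ?_)) (ENNReal.lintegral_mul_norm_pow_le
    (hu.pow_const 4) (hu.pow_const 6) (by linarith) (by linarith) (by ring))
  rw [← ENNReal.rpow_natCast, ← ENNReal.rpow_natCast, ← ENNReal.rpow_mul, ← ENNReal.rpow_mul,
    ← ENNReal.rpow_add_of_nonneg _ _ (by push_cast; linarith) (by push_cast; linarith)]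
  congr 1
  push_cast
  ring

lemma eLpNorm_ofReal_rpow {X : Type*} [MeasurableSpace X] {μ : Measure X} {p : ℝ} (hp : 0 < p)
    (F : X → ℂ) : eLpNorm F (ENNReal.ofReal p) μ ^ p = ∫⁻ x, ‖F x‖ₑ ^ p ∂μ := by
  rw [eLpNorm_eq_lintegral_rpow_enorm_toReal (by simpa using hp) ENNReal.ofReal_ne_top,
    ENNReal.toReal_ofReal hp.le, ← ENNReal.rpow_mul, one_div_mul_cancel hp.ne', ENNReal.rpow_one]

theorem eLpNorm_extensionIntegral_two_rpow_le {f : Ambient 2 → ℂ} (hf : Measurable f)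
    (hfi : Integrable f (sigma 2)) {p : ℝ} (hp : 4 ≤ p) (hp' : p ≤ 6) :
    eLpNorm (extensionIntegral f) (ENNReal.ofReal p) volume ^ p ≤
      (∫⁻ w, ‖extensionIntegral f w‖ₑ ^ 4) ^ ((6 - p) / 2) *
        (strichartzConstant * eLpNorm f 2 (sigma 2) ^ 6) ^ ((p - 4) / 2) := by
  rw [eLpNorm_ofReal_rpow (by linarith)]
  refine (lintegral_rpow_le_four_six
    (stronglyMeasurable_extensionIntegral hf).measurable.enorm.aemeasurable hp hp').trans ?_
  exact mul_le_mul_right (ENNReal.rpow_le_rpow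
    (lintegral_enorm_extensionIntegral_pow_six_le hf hfi) (by linarith)) _

/-! ### Small mass on all caps forces a small extension -/

/-- Functions of bounded `L²` norm whose mass on every set of the family is small have small
extension. -/
def HasSmallExtension {d : ℕ} {ι : Type*} (p : ℝ) (𝒮 : ι → Set (Ambient d)) : Prop :=
  ∀ ε : ℝ≥0∞, ε ≠ 0 → ∃ η : ℝ≥0∞, η ≠ 0 ∧ η ≠ ∞ ∧ ∀ f : Ambient d → ℂ, Measurable f →
    Integrable f (sigma d) → eLpNorm f 2 (sigma d) ≤ 2 → (∀ i, capNorm f (𝒮 i) ≤ η) →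
    eLpNorm (extensionIntegral f) (ENNReal.ofReal p) volume ≤ ε

lemma exists_pos_lt_of_tendsto {Φ : ℝ≥0∞ → ℝ≥0∞} (hΦ : ContinuousAt Φ 0) {δ : ℝ≥0∞}
    (h : Φ 0 < δ) : ∃ η : ℝ≥0∞, η ≠ 0 ∧ η ≠ ∞ ∧ Φ η < δ := by
  have h1 : ∀ᶠ η in 𝓝[>] (0 : ℝ≥0∞), Φ η < δ ∧ η < 1 :=
    nhdsWithin_le_nhds ((hΦ.eventually (gt_mem_nhds h)).and (gt_mem_nhds one_pos))
  obtain ⟨η, ⟨h2, h3⟩, h4⟩ := (h1.and self_mem_nhdsWithin).exists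
  exact ⟨η, (ne_of_gt h4), (h3.trans ENNReal.one_lt_top).ne, h2⟩

theorem hasSmallExtension_cap {p : ℝ} (hp : 6 ≤ p) : HasSmallExtension p cap := by
  intro ε hε
  obtain ⟨C, hC, h⟩ := exists_eLpNorm_extensionIntegral_one_le hp
  obtain ⟨η, h0, h1, h2⟩ := exists_pos_lt_of_tendsto (Φ := fun η => C * η ^ 2 * 2 ^ 2)
    (δ := ε ^ 4) (Continuous.continuousAt ((ENNReal.continuous_mul_const (by finiteness)).comp
      ((ENNReal.continuous_const_mul hC).comp (ENNReal.continuous_pow 2))))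
      (by simpa using ENNReal.pow_pos (pos_iff_ne_zero.2 hε) 4)
  refine ⟨η, h0, h1, fun f hf hfi hf2 hcap => ?_⟩
  have h3 : eLpNorm (extensionIntegral f) (ENNReal.ofReal p) volume ^ 4 ≤ ε ^ 4 := by
    refine (h f hf hfi).trans (le_trans ?_ h2.le)
    have := iSup_le hcap
    gcongr
  exact (ENNReal.pow_le_pow_left_iff four_ne_zero).1 h3

theorem hasSmallExtension_hypBall {p : ℝ} (hp : 4 ≤ p) (hp' : p < 6) :
    HasSmallExtension p fun P : hyperboloid 2 => hypBall P := by
  intro ε hε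
  set θ := (6 - p) / 2 with hθ
  have hθ0 : 0 < θ := by rw [hθ]; linarith
  set K := (strichartzConstant * 2 ^ 6) ^ ((p - 4) / 2) with hK
  have hKt : K ≠ ∞ := ENNReal.rpow_ne_top_of_nonneg (by linarith)
    (ENNReal.mul_ne_top strichartzConstant_ne_top (by finiteness))
  set c : ℝ≥0∞ := 2 * ENNReal.ofReal ((2 * Real.pi) ^ 3) with hc
  have hct : c ≠ ∞ := by rw [hc]; finiteness
  have hΨ : Continuous fun x : ℝ≥0∞ => (c * x * 2 ^ 2) ^ θ * K :=
    (ENNReal.continuous_mul_const hKt).comp (ENNReal.continuous_rpow_const.comp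
      ((ENNReal.continuous_mul_const (by finiteness)).comp (ENNReal.continuous_const_mul hct)))
  have hεp : 0 < ε ^ p := by
    rcases eq_or_ne ε ∞ with rfl | h
    · simp [ENNReal.top_rpow_of_pos (show 0 < p by linarith)]
    · exact ENNReal.rpow_pos (pos_iff_ne_zero.2 hε) h
  obtain ⟨δ, hδ0, hδ1, hδ⟩ := exists_pos_lt_of_tendsto hΨ.continuousAt (δ := ε ^ p)
    (by simpa [hθ0] using hεp)
  -- The order of choice matters: `A` makes the far part small for every `f`, this fixes `N`, and
  -- only then is `η` chosen to make the near part small.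
  obtain ⟨A, hA, hAδ⟩ : ∃ A : ℝ, 0 < A ∧
      ENNReal.ofReal (2 * Real.pi / Real.sqrt A) * 2 ^ 2 < δ := by
    have h1 : Tendsto (fun A => ENNReal.ofReal (2 * Real.pi / Real.sqrt A) * 2 ^ 2) atTop
        (𝓝 (ENNReal.ofReal 0 * 2 ^ 2)) :=
      ENNReal.Tendsto.mul_const (ENNReal.tendsto_ofReal
        (Real.tendsto_sqrt_atTop.const_div_atTop _)) (Or.inr (by finiteness))
    rw [ENNReal.ofReal_zero, zero_mul] at h1
    obtain ⟨A, h2, h3⟩ := ((h1.eventually (gt_mem_nhds (pos_iff_ne_zero.2 hδ0))).and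
      (eventually_gt_atTop 0)).exists
    exact ⟨A, h3, h2⟩
  obtain ⟨N, hN⟩ := exists_lintegral_pow_four_le hA
  obtain ⟨η, h0, h1, h2⟩ := exists_pos_lt_of_tendsto (Φ := fun η =>
      ENNReal.ofReal (2 * Real.pi) * (N * η ^ 2) +
        ENNReal.ofReal (2 * Real.pi / Real.sqrt A) * 2 ^ 2) (δ := δ)
    (Continuous.continuousAt (((ENNReal.continuous_const_mul ENNReal.ofReal_ne_top).comp
      ((ENNReal.continuous_const_mul (by finiteness)).comp (ENNReal.continuous_pow 2))).add
        continuous_const)) (by simpa using hAδ)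
  refine ⟨η, h0, h1, fun f hf hfi hf2 hcap => ?_⟩
  have h4 := hN f η hf hfi fun P hP => hcap ⟨P, hP⟩
  have hp0 : 0 < p := by linarith
  rw [← ENNReal.rpow_le_rpow_iff hp0]
  refine (eLpNorm_extensionIntegral_two_rpow_le hf hfi hp hp'.le).trans (le_trans ?_ hδ.le)
  refine mul_le_mul' (ENNReal.rpow_le_rpow (h4.trans ?_) hθ0.le)
    (ENNReal.rpow_le_rpow (by gcongr) (by linarith))
  refine mul_le_mul' (mul_le_mul_right (le_trans ?_ h2.le) _) (by gcongr)
  gcongr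

/-! ### From Schwartz functions to extremizing sequences -/

lemma measurable_lift {d : ℕ} (g : 𝓢(E d, ℂ)) : Measurable (lift g) :=
  g.continuous.measurable.comp measurable_fst

lemma withDensity_bracket_le {d : ℕ} :
    ((volume : Measure (E d)).withDensity fun y => ENNReal.ofReal (1 / bracket y)) ≤ volume := by
  refine (withDensity_mono (g := 1) (Eventually.of_forall fun y => ?_)).trans withDensity_one.le
  refine ENNReal.ofReal_le_one.2 ?_
  rw [div_le_one (bracket_pos y)]
  exact one_le_bracket y

lemma integrable_lift {d : ℕ} (g : 𝓢(E d, ℂ)) : Integrable (lift g) (sigma d) := by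
  rw [sigma, integrable_map_measure (measurable_lift g).aestronglyMeasurable
    measurable_graph.aemeasurable]
  exact (g.integrable (μ := volume)).mono_measure withDensity_bracket_le

lemma memLp_lift {d : ℕ} (g : 𝓢(E d, ℂ)) : MemLp (lift g) 2 (sigma d) := by
  rw [sigma, memLp_map_measure_iff (measurable_lift g).aestronglyMeasurable
    measurable_graph.aemeasurable]
  exact (g.memLp 2 volume).mono_measure withDensity_bracket_le

lemma integrable_character_mul {d : ℕ} {f : Ambient d → ℂ} (hf : Integrable f (sigma d))
    (w : Ambient d) : Integrable (fun z => character w z * f z) (sigma d) :=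
  hf.bdd_mul (c := 1) (measurable_character measurable_const measurable_id).aestronglyMeasurable
    (Eventually.of_forall fun z => (norm_character w z).le)

lemma extensionIntegral_sub {d : ℕ} {f g : Ambient d → ℂ} (hf : Integrable f (sigma d))
    (hg : Integrable g (sigma d)) :
    extensionIntegral (f - g) = extensionIntegral f - extensionIntegral g := by
  funext w
  rw [Pi.sub_apply, extensionIntegral_eq, extensionIntegral_eq, extensionIntegral_eq,
    ← integral_sub (integrable_character_mul hf w) (integrable_character_mul hg w)]
  simp only [Pi.sub_apply, mul_sub]

lemma extensionIntegral_smul {d : ℕ} (c : ℂ) (f : Ambient d → ℂ) :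
    extensionIntegral (c • f) = c • extensionIntegral f := by
  funext w
  rw [Pi.smul_apply, extensionIntegral_eq, extensionIntegral_eq, ← integral_smul]
  simp only [Pi.smul_apply, smul_eq_mul, mul_left_comm]

lemma continuous_extensionIntegral {d : ℕ} {f : Ambient d → ℂ} (hf : Integrable f (sigma d)) :
    Continuous (extensionIntegral f) := by
  refine continuous_of_dominated (fun w => (integrable_character_mul hf w).aestronglyMeasurable)
    (fun w => Eventually.of_forall fun z => ?_) hf.norm (Eventually.of_forall fun z => ?_)
  · rw [norm_mul]
    exact (mul_le_of_le_one_left (norm_nonneg _) (norm_character w z).le)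
  · fun_prop

/-- A nonnegative Schwartz function whose extension does not vanish at the origin. -/
lemma exists_extensionIntegral_lift_ne_zero (d : ℕ) :
    ∃ g : 𝓢(E d, ℂ), extensionIntegral (lift g) 0 ≠ 0 := by
  let b : ContDiffBump (0 : E d) := ⟨1, 2, one_pos, one_lt_two⟩
  have h1 : HasCompactSupport fun y => (b y : ℂ) :=
    b.hasCompactSupport.comp_left Complex.ofReal_zero
  have h2 : ContDiff ℝ ((⊤ : ℕ∞) : WithTop ℕ∞) fun y => (b y : ℂ) := Complex.ofRealCLM.contDiff.comp b.contDiff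
  set g := h1.toSchwartzMap h2 with hg
  have hgb : ∀ y, g y = (b y : ℂ) := fun y => rfl
  refine ⟨g, ?_⟩
  set ν := (volume : Measure (E d)).withDensity fun y => ENNReal.ofReal (1 / bracket y) with hν
  have e1 : extensionIntegral (lift g) 0 = ∫ z, lift g z ∂(sigma d) := by
    rw [extensionIntegral_eq]
    simp [character]
  have e2 : ∫ z, lift g z ∂(sigma d) = ((∫ y, b y ∂ν : ℝ) : ℂ) := by
    rw [sigma, integral_map measurable_graph.aemeasurable (measurable_lift g).aestronglyMeasurable,
      ← integral_complex_ofReal]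
    rfl
  have hbm := measurable_bracket (d := d)
  have hac : (volume : Measure (E d)) ≪ ν := withDensity_absolutelyContinuous' (by fun_prop)
    (Eventually.of_forall fun y => by
      have := bracket_pos y
      simp only [ne_eq, ENNReal.ofReal_eq_zero, not_le]
      positivity)
  have hi : Integrable b ν :=
    (b.continuous.integrable_of_hasCompactSupport b.hasCompactSupport (μ := volume)).mono_measure
      withDensity_bracket_le
  rw [e1, e2, Complex.ofReal_ne_zero]
  refine ((integral_pos_iff_support_of_nonneg (fun y => b.nonneg) hi).2 ?_).ne'
  refine pos_iff_ne_zero.2 fun h => ?_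
  have := hac h
  rw [b.support_eq] at this
  exact (Metric.measure_ball_pos volume (0 : E d) two_pos).ne' this

variable {d : ℕ} {ι : Type*} {p : ℝ} {𝒮 : ι → Set (Ambient d)}

lemma aestronglyMeasurable_extensionIntegral_lift (g : 𝓢(E d, ℂ)) :
    AEStronglyMeasurable (extensionIntegral (lift g)) volume :=
  (continuous_extensionIntegral (integrable_lift g)).aestronglyMeasurable

/-- A small total norm is small on every set, so the principle already contains continuity at 0 of
the extension on integrable functions; this serves in place of a separate Strichartz inequality. -/
lemma HasSmallExtension.exists_eLpNorm_le (h : HasSmallExtension p 𝒮) {ε : ℝ≥0∞} (hε : ε ≠ 0) :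
    ∃ η : ℝ≥0∞, η ≠ 0 ∧ ∀ f : Ambient d → ℂ, Measurable f → Integrable f (sigma d) →
      eLpNorm f 2 (sigma d) ≤ η → eLpNorm (extensionIntegral f) (ENNReal.ofReal p) volume ≤ ε := by
  obtain ⟨η, h0, h1, h2⟩ := h ε hε
  refine ⟨min η 2, by simp [h0], fun f hf hfi hf2 => h2 f hf hfi (hf2.trans (min_le_right _ _))
    fun i => ?_⟩
  exact (eLpNorm_mono_measure f Measure.restrict_le_self).trans (hf2.trans (min_le_left _ _))

lemma HasSmallExtension.tendsto (h : HasSmallExtension p 𝒮) {f : ℕ → Ambient d → ℂ}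
    (hf : ∀ k, Measurable (f k)) (hfi : ∀ k, Integrable (f k) (sigma d))
    (h0 : Tendsto (fun k => eLpNorm (f k) 2 (sigma d)) atTop (𝓝 0)) :
    Tendsto (fun k => eLpNorm (extensionIntegral (f k)) (ENNReal.ofReal p) volume) atTop
      (𝓝 0) := by
  refine ENNReal.tendsto_nhds_zero.2 fun ε hε => ?_
  obtain ⟨η, h1, h2⟩ := h.exists_eLpNorm_le hε.ne'
  filter_upwards [ENNReal.tendsto_nhds_zero.1 h0 η (pos_iff_ne_zero.2 h1)] with k hk
  exact h2 _ (hf k) (hfi k) hk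

/-- By scaling: a small multiple of `g` has extension of norm at most 1, so the norm for `g` itself
cannot be infinite. -/
lemma HasSmallExtension.memLp (h : HasSmallExtension p 𝒮) (g : 𝓢(E d, ℂ)) :
    MemLp (extensionIntegral (lift g)) (ENNReal.ofReal p) volume := by
  refine ⟨aestronglyMeasurable_extensionIntegral_lift g, lt_top_iff_ne_top.2 fun htop => ?_⟩
  obtain ⟨η, h1, h2⟩ := h.exists_eLpNorm_le one_ne_zero
  obtain ⟨c, hc0, hc1, hc⟩ := exists_pos_lt_of_tendsto
    (Φ := fun c => c * eLpNorm (lift g) 2 (sigma d)) (δ := η)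
    (ENNReal.continuous_mul_const (memLp_lift g).2.ne).continuousAt
    (by simpa using pos_iff_ne_zero.2 h1)
  have hcn : ‖(c.toReal : ℂ)‖ₑ = c := by
    rw [← ofReal_norm, Complex.norm_real, Real.norm_of_nonneg ENNReal.toReal_nonneg,
      ENNReal.ofReal_toReal hc1]
  have h3 := h2 ((c.toReal : ℂ) • lift g) ((measurable_lift g).const_smul (c.toReal : ℂ))
    ((integrable_lift g).smul (c.toReal : ℂ)) (by rw [eLpNorm_const_smul, hcn]; exact hc.le)
  rw [extensionIntegral_smul, eLpNorm_const_smul, hcn, htop, ENNReal.mul_top hc0] at h3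
  exact ENNReal.one_ne_top (top_le_iff.1 h3)

lemma HasSmallExtension.isExtensionOf (h : HasSmallExtension p 𝒮) (g : 𝓢(E d, ℂ)) :
    IsExtensionOf p (lift g) (extensionIntegral (lift g)) :=
  ⟨h.memLp g, fun _ => g, by simp, by simp⟩

/-- `extension` is a choice among representatives. Two Schwartz sequences with the same `L²` limit
have extensions with the same `L^p` limit, and this is the half of uniqueness that the lower bound
on the optimal constant needs. -/
lemma HasSmallExtension.eLpNorm_le (h : HasSmallExtension p 𝒮) (hp : 1 ≤ p) (g : 𝓢(E d, ℂ))
    {F : Ambient d → ℂ} (hF : IsExtensionOf p (lift g) F) :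
    eLpNorm (extensionIntegral (lift g)) (ENNReal.ofReal p) volume ≤
      eLpNorm F (ENNReal.ofReal p) volume := by
  obtain ⟨hFm, G, hG1, hG2⟩ := hF
  have hp1 : 1 ≤ ENNReal.ofReal p := ENNReal.one_le_ofReal.2 hp
  have h1 := h.tendsto (f := fun k => lift g - lift (G k))
    (fun k => (measurable_lift g).sub (measurable_lift (G k)))
    (fun k => (integrable_lift g).sub (integrable_lift (G k))) hG1
  have h2 := (h1.add hG2).add_const (eLpNorm F (ENNReal.ofReal p) volume)
  rw [add_zero, zero_add] at h2
  refine ge_of_tendsto' h2 fun k => ?_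
  have a1 := aestronglyMeasurable_extensionIntegral_lift g
  have a2 := aestronglyMeasurable_extensionIntegral_lift (G k)
  rw [extensionIntegral_sub (integrable_lift g) (integrable_lift (G k))]
  calc eLpNorm (extensionIntegral (lift g)) (ENNReal.ofReal p) volume
      = eLpNorm ((extensionIntegral (lift g) - extensionIntegral (lift (G k))) -
          (F - extensionIntegral (lift (G k))) + F) (ENNReal.ofReal p) volume := by
        congr 1
        ring
    _ ≤ _ := (eLpNorm_add_le ((a1.sub a2).sub (hFm.1.sub a2)) hFm.1 hp1).trans
        (add_le_add_left (eLpNorm_sub_le (a1.sub a2) (hFm.1.sub a2) hp1) _)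

lemma isExtensionOf_extension {f : Ambient d → ℂ} (h : ∃ F, IsExtensionOf p f F) :
    IsExtensionOf p f (extension p f) := by
  rw [extension, dif_pos h]
  exact h.choose_spec

/-- One bump function suffices: its extension integral is continuous and nonzero at the origin, so
its `L^p` norm is positive. -/
lemma HasSmallExtension.optimalConstant_pos (h : HasSmallExtension p 𝒮) (hp : 1 ≤ p) :
    0 < optimalConstant d p := by
  obtain ⟨g, hg⟩ := exists_extensionIntegral_lift_ne_zero d
  have hne : eLpNorm (lift g) 2 (sigma d) ≠ 0 := by
    intro h0
    rw [eLpNorm_eq_zero_iff (measurable_lift g).aestronglyMeasurable two_ne_zero] at h0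
    refine hg ?_
    rw [extensionIntegral_eq, ← integral_zero (Ambient d) ℂ (μ := sigma d)]
    refine integral_congr_ae ?_
    filter_upwards [h0] with z hz
    rw [hz, Pi.zero_apply, mul_zero]
  have hT : eLpNorm (extensionIntegral (lift g)) (ENNReal.ofReal p) volume ≠ 0 := by
    intro h0
    have hp0 : ENNReal.ofReal p ≠ 0 := by
      rw [ne_eq, ENNReal.ofReal_eq_zero, not_le]
      exact one_pos.trans_le hp
    rw [eLpNorm_eq_zero_iff (aestronglyMeasurable_extensionIntegral_lift g) hp0] at h0
    have h1 := ((continuous_extensionIntegral (integrable_lift g)).ae_eq_iff_eq volume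
      continuous_zero).1 h0
    exact hg (congrFun h1 0)
  have h1 := h.eLpNorm_le hp g (isExtensionOf_extension ⟨_, h.isExtensionOf g⟩)
  refine lt_of_lt_of_le ?_ (le_iSup
    (fun f : {f : Ambient d → ℂ // MemLp f 2 (sigma d) ∧ eLpNorm f 2 (sigma d) ≠ 0} =>
      extensionRatio p f.1) ⟨lift g, memLp_lift g, hne⟩)
  exact ENNReal.div_pos ((pos_iff_ne_zero.2 hT).trans_le h1).ne' (memLp_lift g).2.ne

lemma HasSmallExtension.exists_eLpNorm_extension_le (h : HasSmallExtension p 𝒮) (hp : 1 ≤ p)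
    {ε : ℝ≥0∞} (hε : ε ≠ 0) : ∃ η : ℝ≥0∞, η ≠ 0 ∧ η ≠ ∞ ∧ ∀ f : Ambient d → ℂ,
      MemLp f 2 (sigma d) → eLpNorm f 2 (sigma d) = 1 → (∀ i, capNorm f (𝒮 i) ≤ η) →
      eLpNorm (extension p f) (ENNReal.ofReal p) volume ≤ ε := by
  obtain ⟨η, h0, h1, h2⟩ := h ε hε
  have h02 : η / 2 ≠ 0 := (ENNReal.half_pos h0).ne'
  refine ⟨η / 2, h02, ENNReal.div_ne_top h1 two_ne_zero, fun f hf hf1 hcap => ?_⟩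
  by_cases hF : ∃ F, IsExtensionOf p f F
  swap
  · rw [extension, dif_neg hF, eLpNorm_zero]
    exact zero_le
  obtain ⟨hFm, g, hg1, hg2⟩ := isExtensionOf_extension hF
  set F := extension p f
  have hp1 : 1 ≤ ENNReal.ofReal p := ENNReal.one_le_ofReal.2 hp
  have h3 := hg2.add_const ε
  rw [zero_add] at h3
  refine ge_of_tendsto h3 ?_
  -- An approximant within distance 1 has norm at most 2, which accounts for the bound 2 in
  -- `HasSmallExtension`. Within `η / 2` its cap norms stay below `η`.
  filter_upwards [ENNReal.tendsto_nhds_zero.1 hg1 1 one_pos,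
    ENNReal.tendsto_nhds_zero.1 hg1 (η / 2) (pos_iff_ne_zero.2 h02)] with k hk1 hk2
  have hmono : ∀ ν ≤ sigma d, eLpNorm (lift (g k)) 2 ν ≤
      eLpNorm f 2 ν + eLpNorm (f - lift (g k)) 2 (sigma d) := fun ν hν => by
    have a1 := hf.1.mono_measure hν
    have a2 : AEStronglyMeasurable (lift (g k)) ν := (measurable_lift (g k)).aestronglyMeasurable
    calc eLpNorm (lift (g k)) 2 ν = eLpNorm (f - (f - lift (g k))) 2 ν := by rw [sub_sub_cancel]
      _ ≤ eLpNorm f 2 ν + eLpNorm (f - lift (g k)) 2 ν :=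
          eLpNorm_sub_le a1 (a1.sub a2) one_le_two
      _ ≤ _ := add_le_add_right (eLpNorm_mono_measure _ hν) _
  have h4 := h2 (lift (g k)) (measurable_lift (g k)) (integrable_lift (g k))
    ((hmono _ le_rfl).trans (by rw [hf1]; exact (add_le_add_right hk1 _).trans one_add_one_eq_two.le))
    fun i => (hmono _ Measure.restrict_le_self).trans
      ((add_le_add (hcap i) hk2).trans (ENNReal.add_halves η).le)
  have a2 := aestronglyMeasurable_extensionIntegral_lift (g k)
  calc eLpNorm F (ENNReal.ofReal p) volume
      = eLpNorm ((F - extensionIntegral (lift (g k))) + extensionIntegral (lift (g k)))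
          (ENNReal.ofReal p) volume := by rw [sub_add_cancel]
    _ ≤ _ := (eLpNorm_add_le (hFm.1.sub a2) a2 hp1).trans (add_le_add_right h4 _)

/-- Fix `ε` strictly between 0 and the optimal constant. The quotients eventually exceed `ε`, which
is impossible for a normalised function with all cap norms below the matching `η`. -/
theorem HasSmallExtension.exists_lt_capNorm (h : HasSmallExtension p 𝒮) (hp : 1 ≤ p) :
    ∃ η : ℝ, 0 < η ∧ ∀ f : ℕ → Ambient d → ℂ, IsExtremizingSequence p f →
      (∀ n, eLpNorm (f n) 2 (sigma d) = 1) →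
      ∃ n₀ : ℕ, ∀ n ≥ n₀, ∃ i, ENNReal.ofReal η < capNorm (f n) (𝒮 i) := by
  obtain ⟨ε, hε0, hε⟩ := exists_between (h.optimalConstant_pos hp)
  obtain ⟨η, h0, h1, h2⟩ := h.exists_eLpNorm_extension_le hp hε0.ne'
  refine ⟨η.toReal, ENNReal.toReal_pos h0 h1, fun f hf hf1 => ?_⟩
  obtain ⟨n₀, hn₀⟩ := eventually_atTop.1 (hf.2.eventually (lt_mem_nhds hε))
  refine ⟨n₀, fun n hn => ?_⟩
  by_contra! hcon
  rw [ENNReal.ofReal_toReal h1] at hcon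
  have h3 := hn₀ n hn
  rw [extensionRatio, hf1, div_one] at h3
  exact h3.not_ge (h2 (f n) (hf.1 n).1 (hf1 n) hcon)

/-! ### Moving the heavy cap to the prescribed position -/

lemma capNorm_comp_measurePreserving {d : ℕ} {f : Ambient d → ℂ} {Λ : Ambient d → Ambient d}
    (hf : AEStronglyMeasurable f (sigma d)) (hΛ : MeasurePreserving Λ (sigma d) (sigma d))
    {C D : Set (Ambient d)} (hD : MeasurableSet D) (h : ∀ z ∈ hyperboloid d, z ∈ C ↔ Λ z ∈ D) :
    capNorm (f ∘ Λ) C = capNorm f D := by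
  have hC : C =ᵐ[sigma d] Λ ⁻¹' D := by
    filter_upwards [ae_mem_hyperboloid] with z hz
    exact propext (h z hz)
  rw [capNorm, Measure.restrict_congr_set hC]
  exact eLpNorm_comp_measurePreserving hf.restrict (hΛ.restrict_preimage hD)

/-- An integer rapidity shift permutes the caps, so the supremum over all caps is unchanged by such
a boost. -/
lemma capNorm_comp_boost {f : Ambient 1 → ℂ} (hf : AEStronglyMeasurable f (sigma 1)) (j k : ℤ) :
    capNorm (f ∘ boost (Real.tanh k)) (cap j) = capNorm f (cap (j + k)) := by
  refine capNorm_comp_measurePreserving hf (measurePreserving_boost_one k) (measurableSet_cap _)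
    fun z hz => ?_
  obtain ⟨θ, rfl⟩ := exists_eq_planeEmb_hypPolar hz
  rw [boost_planeEmb, planeEmb_hypPolar_mem_cap, planeEmb_hypPolar_mem_cap, mem_Ico, mem_Ico]
  push_cast
  constructor <;> rintro ⟨h1, h2⟩ <;> constructor <;> linarith

/-- As `(2√2 π)² = 8π²`, the cap `D` is the trace on the hyperboloid of `hypBall (0, 1)`. -/
lemma mem_centralCap_iff {z : Ambient 2} (hz : z ∈ hyperboloid 2) :
    z ∈ centralCap ↔ z.2 ≤ Real.sqrt (1 + 8 * Real.pi ^ 2) := by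
  have h1 : z.2 = bracket z.1 := hz
  have h2 : (2 * Real.sqrt 2 * Real.pi) ^ 2 = 8 * Real.pi ^ 2 := by
    rw [mul_pow, mul_pow, Real.sq_sqrt zero_le_two]
    ring
  have h3 : z ∈ centralCap ↔ ‖z.1‖ ≤ 2 * Real.sqrt 2 * Real.pi := ⟨fun h => h.2, fun h => ⟨hz, h⟩⟩
  rw [h3, h1, bracket, Real.sqrt_le_sqrt_iff (by positivity), add_le_add_iff_left, ← h2,
    sq_le_sq₀ (norm_nonneg _) (by positivity)]

lemma capNorm_comp_lorentz {f : Ambient 2 → ℂ} (hf : AEStronglyMeasurable f (sigma 2)) (φ k : ℝ) :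
    capNorm (f ∘ lorentz φ k) centralCap = capNorm f (hypBall (lorentz φ k (0, 1))) := by
  refine capNorm_comp_measurePreserving hf (measurePreserving_lorentz φ k)
    (measurableSet_mink_le _ _) fun z hz => ?_
  rw [mem_centralCap_iff hz, hypBall, mem_ofPred_eq, mink_lorentz, mink_zero_left, one_mul]

lemma exists_half_iSup_le {ι : Type*} {a : ι → ℝ≥0∞} (h0 : (⨆ i, a i) ≠ 0)
    (h1 : (⨆ i, a i) ≠ ∞) : ∃ i, 1 / 2 * ⨆ i, a i ≤ a i := by
  have h : 1 / 2 * (⨆ i, a i) < ⨆ i, a i := by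
    rw [one_div, mul_comm, ← div_eq_mul_inv]
    exact ENNReal.half_lt_self h0 h1
  obtain ⟨i, hi⟩ := lt_iSup_iff.1 h
  exact ⟨i, hi.le⟩

lemma tanh_mem_Ioo (k : ℝ) : Real.tanh k ∈ Ioo (-1 : ℝ) 1 :=
  ⟨Real.neg_one_lt_tanh k, Real.tanh_lt_one k⟩

end Hyperboloid

end

theorem mainTheorem7 :
    (∀ p : ℝ, 6 ≤ p → ∃ η : ℝ, 0 < η ∧
      ∀ f : ℕ → Hyperboloid.Ambient 1 → ℂ,
        Hyperboloid.IsExtremizingSequence p f →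
        (∀ n, eLpNorm (f n) 2 (Hyperboloid.sigma 1) = 1) →
        ∃ n₀ : ℕ, ∀ n ≥ n₀, ∃ s ∈ Ioo (-1 : ℝ) 1,
          (1 / 2 : ℝ≥0∞) * (⨆ k : ℤ,
              Hyperboloid.capNorm (f n ∘ Hyperboloid.boost s) (Hyperboloid.cap k)) ≤
            Hyperboloid.capNorm (f n ∘ Hyperboloid.boost s) (Hyperboloid.cap 0) ∧
          ENNReal.ofReal η ≤
            (1 / 2 : ℝ≥0∞) * (⨆ k : ℤ,
              Hyperboloid.capNorm (f n ∘ Hyperboloid.boost s) (Hyperboloid.cap k))) ∧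
    (∀ p : ℝ, 4 ≤ p → p < 6 → ∃ η : ℝ, 0 < η ∧
      ∀ f : ℕ → Hyperboloid.Ambient 2 → ℂ,
        Hyperboloid.IsExtremizingSequence p f →
        (∀ n, eLpNorm (f n) 2 (Hyperboloid.sigma 2) = 1) →
        ∃ n₀ : ℕ, ∀ n ≥ n₀, ∃ s ∈ Ioo (-1 : ℝ) 1, ∃ φ ∈ Ico (0 : ℝ) (2 * Real.pi),
          ENNReal.ofReal η ≤
            Hyperboloid.capNorm (f n ∘ (Hyperboloid.rotation φ ∘ Hyperboloid.boost s))
              Hyperboloid.centralCap) := by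
  refine ⟨fun p hp => ?_, fun p hp hp' => ?_⟩
  · obtain ⟨η, hη, h⟩ := (Hyperboloid.hasSmallExtension_cap hp).exists_lt_capNorm (by linarith)
    refine ⟨η / 2, by positivity, fun f hf hf1 => ?_⟩
    obtain ⟨n₀, hn₀⟩ := h f hf hf1
    refine ⟨n₀, fun n hn => ?_⟩
    obtain ⟨i, hi⟩ := hn₀ n hn
    have hm := (hf.1 n).1.1
    set a : ℤ → ℝ≥0∞ := fun k => Hyperboloid.capNorm (f n) (Hyperboloid.cap k) with ha
    have h1 : ENNReal.ofReal η ≤ ⨆ k, a k := hi.le.trans (le_iSup a i)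
    -- The supremum is positive and finite, so half of it is strictly smaller and is exceeded by
    -- some cap `k`, which the boost moves to `C_0`. Since the supremum is at least `η`, the
    -- constant for part (1) is `η / 2`.
    have h2 : ⨆ k, a k ≤ 1 := iSup_le fun k =>
      (eLpNorm_mono_measure _ Measure.restrict_le_self).trans (hf1 n).le
    obtain ⟨k, hk⟩ := Hyperboloid.exists_half_iSup_le (a := a)
      ((ENNReal.ofReal_pos.2 hη).trans_le h1).ne' (h2.trans_lt ENNReal.one_lt_top).ne
    have e : ∀ j, Hyperboloid.capNorm (f n ∘ Hyperboloid.boost (Real.tanh k))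
        (Hyperboloid.cap j) = a (j + k) := fun j => Hyperboloid.capNorm_comp_boost hm j k
    refine ⟨Real.tanh k, Hyperboloid.tanh_mem_Ioo k, ?_⟩
    simp only [e, zero_add]
    have e' : ⨆ j, a (j + k) = ⨆ j, a j := (Equiv.addRight k).iSup_comp (g := a)
    rw [e']
    refine ⟨hk, ?_⟩
    rw [one_div, mul_comm, ← div_eq_mul_inv, ENNReal.ofReal_div_of_pos two_pos,
      ENNReal.ofReal_ofNat]
    exact ENNReal.div_le_div_right h1 2
  · obtain ⟨η, hη, h⟩ := (Hyperboloid.hasSmallExtension_hypBall hp hp').exists_lt_capNorm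
      (by linarith)
    refine ⟨η, hη, fun f hf hf1 => ?_⟩
    obtain ⟨n₀, hn₀⟩ := h f hf hf1
    refine ⟨n₀, fun n hn => ?_⟩
    obtain ⟨⟨P, hP⟩, hi⟩ := hn₀ n hn
    -- The centre of the heavy ball is the image of `(0, 1)` under `R_φ ∘ L^s`, so pulling back by
    -- this map turns the ball into `D`.
    obtain ⟨φ, hφ, k, rfl⟩ := Hyperboloid.exists_lorentz_eq_of_mem hP
    refine ⟨Real.tanh k, Hyperboloid.tanh_mem_Ioo k, φ, hφ, ?_⟩
    exact hi.le.trans (Hyperboloid.capNorm_comp_lorentz (hf.1 n).1.1 φ k).ge
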